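/- **Theorem 5.7.** *Notation.* Let $e_{ab}$, $1\le a,b\le 4$, be the standard generators of $\mathfrak{gl}_4$, $[e_{ab},e_{cd}]=\delta_{bc}e_{ad}-\delta_{ad}e_{cb}$. The Yangian $Y(\mathfrak{gl}_4)$ is the unital associative $\mathbb C$-algebra generated by the coefficients of the series $T^a_b(u)=\delta_{ab}+\sum_{s\ge1}(T^a_b)^{\{s\}}u^{-s}$ with the defining relations $(u-v)[T^a_b(u),T^c_d(v)]=T^a_d(u)T^c_b(v)-T^a_d(v)T^c_b(u)$. For a $\mathfrak{gl}_4$-module $V$ over $\mathbb C$ and $x\in\mathbb C$, the evaluation module $V(x)$ is the space $V$ on which $Y(\mathfrak{gl}_4)$ acts through the homomorphism $T^a_b(u)\mapsto\delta_{ab}+e_{ba}(u-x)^{-1}$ to $U(\mathfrak{gl}_4)$, where $(u-x)^{-1}$ is expanded in $u^{-1}$. Let $v\in V$ be a $\mathfrak{gl}_4$-singular vector of weight $(\Lambda^1,\dots,\Lambda^4)\in\mathbb C^4$: $e_{ab}v=0$ for $a<b$ and $e_{aa}v=\Lambda^av$ for all $a$. Let $\boldsymbol\xi=(\xi_1,\xi_2,\xi_3)$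 be nonnegative integers, let $\boldsymbol t^a=(t^a_1,\dots,t^a_{\xi_a})$, $a=1,2,3$, be independent variables, and $\boldsymbol t=(\boldsymbol t^1,\boldsymbol t^2,\boldsymbol t^3)$. Let $T(u)=(T^a_b(u))_{a,b=1}^4$ ($a$ numbers rows) and $R(u)=1+u^{-1}\sum_{a,b}E_{ab}\otimes E_{ba}$ on $\mathbb C^4\otimes\mathbb C^4$. On $(\mathbb C^4)^{\otimes(\xi_1+\xi_2+\xi_3)}$, number the tensor factors by the pairs $(a,k)$, $1\le k\le\xi_a$, in lexicographic order, and set $$\mathbb T^{[a]}=T^{(a,1)}(t^a_1)\cdots T^{(a,\xi_a)}(t^a_{\xi_a}),\qquad \mathbb R^{[a,b]}=\prod^{\rightarrow}_{1\le k\le\xi_a}\ \prod^{\leftarrow}_{1\le l\le\xi_b}R^{(a,k),(b,l)}(t^a_k-t^b_l),$$ where superscripts in parentheses show the factors in which a matrix acts, and the arrows show the direction in which the index increases. The nested Bethe vector is $\mathbb B_{\boldsymbol\xi}(\boldsymbol t)v$, where $\mathbb B_{\boldsymbol\xi}(\boldsymbol t)$ is the entry of $\mathbb T^{[1]}\mathbb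 T^{[2]}\mathbb T^{[3]}\mathbb R^{[3,2]}\mathbb R^{[3,1]}\mathbb R^{[2,1]}$ in the row $1^{\xi_1},2^{\xi_2},3^{\xi_3}$ and the column $2^{\xi_1},3^{\xi_2},4^{\xi_3}$. For a function $f$ of $t_1,\dots,t_m$ put $$\overline{\mathrm{Sym}}_{\boldsymbol t}f=\sum_{\sigma\in S_m}(fQ_m)(t_{\sigma(1)},\dots,t_{\sigma(m)}),\qquad Q_m=\prod_{1\le i<j\le m}\frac{t_i-t_j-1}{t_i-t_j}.$$ For sequences $\boldsymbol i=\{i_1<\dots<i_p\}$ and $\boldsymbol j=\{j_1<\dots<j_q\}$ in $\{1,\dots,\xi_2\}$ with $p\le\xi_3$, $q\le\xi_1$, put $$G_{\boldsymbol i,\boldsymbol j}(\boldsymbol t)=\prod_{a=1}^p\Biggl(\frac{t^3_a-x+\Lambda^3}{t^3_a-t^2_{i_a}}\prod_{m=i_a+1}^{\xi_2}\frac{t^3_a-t^2_m+1}{t^3_a-t^2_m}\Biggr)\prod_{s=1}^q\Biggl(\frac{t^1_{\xi_1-q+s}-x+\Lambda^2}{t^2_{j_s}-t^1_{\xi_1-q+s}}\prod_{l=1}^{j_s-1}\frac{t^2_l-t^1_{\xi_1-q+s}+1}{t^2_l-t^1_{\xi_1-q+s}}\Biggr).$$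 *Statement.* For every triple $(p,q,r)$ with $0\le p\le\min(\xi_2,\xi_3)$, $0\le q\le\min(\xi_2,\xi_1)$, $\max(0,p+q-\xi_2)\le r\le\min(p,q)$, fix sequences $\boldsymbol i=\{i_1<\dots<i_p\}$ and $\boldsymbol j=\{j_1<\dots<j_q\}$ in $\{1,\dots,\xi_2\}$ with $|\{i_1,\dots,i_p\}\cap\{j_1,\dots,j_q\}|=r$. Then: (a) In $V(x)$ one has $$\mathbb B_{\boldsymbol\xi}(\boldsymbol t)v=\prod_{a=1}^3\prod_{k=1}^{\xi_a}\frac1{t^a_k-x}\sum_{p=0}^{\min(\xi_2,\xi_3)}\ \sum_{q=0}^{\min(\xi_2,\xi_1)}\ \sum_{r=\max(0,p+q-\xi_2)}^{\min(p,q)}\overline{\mathrm{Sym}}_{\boldsymbol t^1}\overline{\mathrm{Sym}}_{\boldsymbol t^2}\overline{\mathrm{Sym}}_{\boldsymbol t^3}G_{\boldsymbol i,\boldsymbol j}(\boldsymbol t)\cdot\frac{e_{32}^{\xi_2-p-q+r}e_{31}^{q-r}e_{42}^{p-r}e_{41}^{r}e_{21}^{\xi_1-q}e_{43}^{\xi_3-p}v}{(\xi_2-p-q+r)!\,(q-r)!\,(p-r)!\,r!\,(\xi_1-q)!\,(\xi_3-p)!}.$$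 (b) For every $(p,q,r)$, the function $\overline{\mathrm{Sym}}_{\boldsymbol t^1}\overline{\mathrm{Sym}}_{\boldsymbol t^2}\overline{\mathrm{Sym}}_{\boldsymbol t^3}G_{\boldsymbol i,\boldsymbol j}(\boldsymbol t)$ does not depend on the choice of the sequences $\boldsymbol i,\boldsymbol j$. -/

import Mathlib

open scoped Kronecker

attribute [local instance] LieRing.ofAssociativeRing

noncomputable section

namespace NestedBethe

/-! ### The Yangian of `gl_n` and its evaluation modules -/

/-- The matrix Lie algebra `gl_n` over the complex numbers (with the commutator bracket). -/
abbrev Gl (n : ℕ) : Type := Matrix (Fin n) (Fin n) ℂ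

/-- The universal enveloping algebra `U(gl_n)`. -/
abbrev UGl (n : ℕ) : Type := UniversalEnvelopingAlgebra ℂ (Gl n)

/-- The standard generator `e_{ab}` of `gl_n`, a matrix unit. -/
def eMat {n : ℕ} (a b : Fin n) : Gl n := Matrix.single a b 1

/-- The free algebra on symbols `(a, b, s)`, standing for the coefficient of `u^{-(s+1)}`
in the series `T^a_b(u)`. -/
abbrev FreeT (n : ℕ) : Type := FreeAlgebra ℂ (Fin n × Fin n × ℕ)

/-- The coefficient of `u^{-s}` in `T^a_b(u) = δ_{ab} + ∑_{s ≥ 1} (T^a_b)^{s} u^{-s}`,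
in the free algebra. -/
def freeT {n : ℕ} (a b : Fin n) : ℕ → FreeT n
  | 0 => if a = b then 1 else 0
  | s + 1 => FreeAlgebra.ι ℂ (a, b, s)

/-- The defining relations of the Yangian: the coefficients of `u^{-r} v^{-s}`, `r, s ≥ 0`, in
`(u - v) [T^a_b(u), T^c_d(v)] = T^a_d(u) T^c_b(v) - T^a_d(v) T^c_b(u)`. -/
inductive YangianRel (n : ℕ) : FreeT n → FreeT n → Prop
  | rel (a b c d : Fin n) (r s : ℕ) : YangianRel n
      (⁅freeT a b (r + 1), freeT c d s⁆ - ⁅freeT a b r, freeT c d (s + 1)⁆)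
      (freeT a d r * freeT c b s - freeT a d s * freeT c b r)

/-- The Yangian `Y(gl_n)`. -/
def Yangian (n : ℕ) : Type := RingQuot (YangianRel n)

instance (n : ℕ) : Ring (Yangian n) := inferInstanceAs (Ring (RingQuot (YangianRel n)))

instance (n : ℕ) : Algebra ℂ (Yangian n) := inferInstanceAs (Algebra ℂ (RingQuot (YangianRel n)))

/-- The quotient map from the free algebra to the Yangian. -/
def yMk (n : ℕ) : FreeT n →ₐ[ℂ] Yangian n := RingQuot.mkAlgHom ℂ (YangianRel n)

/-- The coefficient `(T^a_b)^{s}` of `u^{-s}` in the generating series `T^a_b(u)`. -/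
def yT {n : ℕ} (a b : Fin n) (s : ℕ) : Yangian n :=
  yMk n (freeT a b s)

theorem yT_zero {n : ℕ} (a b : Fin n) : yT a b 0 = if a = b then 1 else 0 := by
  unfold yT freeT
  split_ifs <;> simp

theorem yT_rel {n : ℕ} (a b c d : Fin n) (r s : ℕ) :
    ⁅yT a b (r + 1), yT c d s⁆ - ⁅yT a b r, yT c d (s + 1)⁆
      = yT a d r * yT c b s - yT a d s * yT c b r := by
  have h : yMk n _ = yMk n _ := RingQuot.mkAlgHom_rel ℂ (YangianRel.rel a b c d r s)
  simpa [yT, Ring.lie_def] using h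

/-- The universal property of the Yangian: a family `t a b s` with `t a b 0 = δ_{ab}` that
satisfies the defining relations gives an algebra homomorphism. -/
def yangianLift {n : ℕ} {A : Type*} [Ring A] [Algebra ℂ A] (t : Fin n → Fin n → ℕ → A)
    (h0 : ∀ a b, t a b 0 = if a = b then 1 else 0)
    (hrel : ∀ a b c d r s, ⁅t a b (r + 1), t c d s⁆ - ⁅t a b r, t c d (s + 1)⁆
      = t a d r * t c b s - t a d s * t c b r) : Yangian n →ₐ[ℂ] A :=
  RingQuot.liftAlgHom ℂ ⟨FreeAlgebra.lift ℂ fun g => t g.1 g.2.1 (g.2.2 + 1), by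
    have key : ∀ a b s,
        FreeAlgebra.lift ℂ (fun g : Fin n × Fin n × ℕ => t g.1 g.2.1 (g.2.2 + 1)) (freeT a b s)
          = t a b s := by
      intro a b s
      cases s with
      | zero => rw [h0, freeT]; split_ifs <;> simp
      | succ s => simp [freeT]
    rintro _ _ ⟨a, b, c, d, r, s⟩
    simpa only [map_sub, map_mul, Ring.lie_def, key] using hrel a b c d r s⟩

theorem yangianLift_yT {n : ℕ} {A : Type*} [Ring A] [Algebra ℂ A] (t : Fin n → Fin n → ℕ → A)
    (h0 : ∀ a b, t a b 0 = if a = b then 1 else 0)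
    (hrel : ∀ a b c d r s, ⁅t a b (r + 1), t c d s⁆ - ⁅t a b r, t c d (s + 1)⁆
      = t a d r * t c b s - t a d s * t c b r) (a b : Fin n) (s : ℕ) :
    yangianLift t h0 hrel (yT a b s) = t a b s := by
  refine (RingQuot.liftAlgHom_mkAlgHom_apply ..).trans ?_
  cases s with
  | zero => rw [h0, freeT]; split_ifs <;> simp
  | succ s => simp [freeT]

/-- The coefficient of `u^{-s}` in `T^a_b(u - x)`, with every `(u - x)^{-k}`, `k ≥ 1`, expanded in
`u^{-1}`: for `s = m + 1` it is `∑_{k ≤ m} (m choose k) x^{m-k} (T^a_b)^{k+1}`. -/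
def shiftT {n : ℕ} (x : ℂ) (a b : Fin n) : ℕ → Yangian n
  | 0 => if a = b then 1 else 0
  | m + 1 => ∑ k ∈ Finset.range (m + 1), ((m.choose k : ℂ) * x ^ (m - k)) • yT a b (k + 1)

/-- The entries `c(s, k)` with `T^a_b(u - x)_s = ∑_k c(s, k) (T^a_b)^{k}`. -/
def shiftCoeff (x : ℂ) : ℕ → ℕ → ℂ
  | 0, 0 => 1
  | 0, _ + 1 => 0
  | _ + 1, 0 => 0
  | m + 1, k + 1 => (m.choose k : ℂ) * x ^ (m - k)

theorem shiftCoeff_eq_zero (x : ℂ) {s k : ℕ} (h : s < k) : shiftCoeff x s k = 0 := by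
  cases s <;> cases k <;> simp_all [shiftCoeff, Nat.choose_eq_zero_of_lt]

theorem shiftCoeff_succ (x : ℂ) (s k : ℕ) :
    shiftCoeff x (s + 1) (k + 1) = shiftCoeff x s k + x * shiftCoeff x s (k + 1) := by
  cases s with
  | zero => cases k <;> simp [shiftCoeff]
  | succ m =>
    cases k with
    | zero => simp [shiftCoeff, pow_succ]; ring
    | succ k =>
      simp only [shiftCoeff, Nat.choose_succ_succ, Nat.cast_add]
      rcases Nat.lt_or_ge m (k + 1) with h | h
      · simp [Nat.choose_eq_zero_of_lt h]
      · obtain ⟨j, rfl⟩ := Nat.exists_eq_add_of_le h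
        have e1 : k + 1 + j + 1 - (k + 1) = j + 1 := by omega
        have e2 : k + 1 + j - k = j + 1 := by omega
        have e3 : k + 1 + j - (k + 1) = j := by omega
        rw [e1, e2, e3]; ring

theorem shiftT_eq {n : ℕ} (x : ℂ) (a b : Fin n) (s N : ℕ) (h : s < N) :
    shiftT x a b s = ∑ k ∈ Finset.range N, shiftCoeff x s k • yT a b k := by
  rw [← Finset.sum_subset (Finset.range_mono (Nat.succ_le_of_lt h))]
  · cases s with
    | zero => simp [shiftT, shiftCoeff, yT_zero]
    | succ m => rw [Finset.sum_range_succ']; simp [shiftT, shiftCoeff]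
  · intro k _ hk
    rw [shiftCoeff_eq_zero, zero_smul]
    simpa [Nat.lt_succ_iff] using hk

theorem shiftT_rel {n : ℕ} (x : ℂ) (a b c d : Fin n) (r s : ℕ) :
    ⁅shiftT x a b (r + 1), shiftT x c d s⁆ - ⁅shiftT x a b r, shiftT x c d (s + 1)⁆
      = shiftT x a d r * shiftT x c b s - shiftT x a d s * shiftT x c b r := by
  have sl : ∀ (z : ℂ) (p q : Yangian n), ⁅z • p, q⁆ = z • ⁅p, q⁆ := by
    intro z p q; simp [Ring.lie_def, smul_sub]
  have ls : ∀ (z : ℂ) (p q : Yangian n), ⁅p, z • q⁆ = z • ⁅p, q⁆ := by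
    intro z p q; simp [Ring.lie_def, smul_sub]
  have comm0 : ∀ (a b : Fin n) (y : Yangian n), ⁅yT a b 0, y⁆ = 0 := by
    intro a b y; rw [yT_zero]; split_ifs <;> simp [Ring.lie_def]
  have comm0' : ∀ (a b : Fin n) (y : Yangian n), ⁅y, yT a b 0⁆ = 0 := by
    intro a b y; rw [yT_zero]; split_ifs <;> simp [Ring.lie_def]
  -- modulo the central term, the shifted series satisfies the Pascal recursion
  have step : ∀ (a b : Fin n) (s N : ℕ), s < N → ∃ z : ℂ,
      shiftT x a b (s + 1) + z • yT a b 0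
        = ∑ k ∈ Finset.range N, shiftCoeff x s k • yT a b (k + 1) + x • shiftT x a b s := by
    intro a b s N h
    refine ⟨x * shiftCoeff x s 0, ?_⟩
    have hz : shiftCoeff x (s + 1) 0 = 0 := rfl
    rw [shiftT_eq x a b (s + 1) (N + 1) (by omega), shiftT_eq x a b s (N + 1) (by omega),
      Finset.sum_range_succ', Finset.sum_range_succ' _ N, hz]
    simp only [shiftCoeff_succ, add_smul, Finset.sum_add_distrib, smul_add, Finset.smul_sum,
      smul_smul, zero_smul, add_zero]
    abel
  obtain ⟨z1, h1⟩ := step a b r (r + s + 1) (by omega)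
  obtain ⟨z2, h2⟩ := step c d s (r + s + 1) (by omega)
  have hA := shiftT_eq x a b r (r + s + 1) (by omega)
  have hB := shiftT_eq x c d s (r + s + 1) (by omega)
  have e1 : ⁅shiftT x a b (r + 1), shiftT x c d s⁆
      = ⁅∑ k ∈ Finset.range (r + s + 1), shiftCoeff x r k • yT a b (k + 1), shiftT x c d s⁆
        + x • ⁅shiftT x a b r, shiftT x c d s⁆ := by
    rw [← sl, ← add_lie, ← h1, add_lie, sl, comm0, smul_zero, add_zero]
  have e2 : ⁅shiftT x a b r, shiftT x c d (s + 1)⁆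
      = ⁅shiftT x a b r, ∑ k ∈ Finset.range (r + s + 1), shiftCoeff x s k • yT c d (k + 1)⁆
        + x • ⁅shiftT x a b r, shiftT x c d s⁆ := by
    rw [← ls, ← lie_add, ← h2, lie_add, ls, comm0', smul_zero, add_zero]
  rw [e1, e2, add_sub_add_right_eq_sub, hA, hB, shiftT_eq x a d r (r + s + 1) (by omega),
    shiftT_eq x a d s (r + s + 1) (by omega), shiftT_eq x c b s (r + s + 1) (by omega),
    shiftT_eq x c b r (r + s + 1) (by omega)]
  generalize r + s + 1 = N
  have hR : (∑ k ∈ Finset.range N, shiftCoeff x s k • yT a d k)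
        * (∑ k ∈ Finset.range N, shiftCoeff x r k • yT c b k)
      = ∑ k ∈ Finset.range N, ∑ l ∈ Finset.range N,
          (shiftCoeff x r k * shiftCoeff x s l) • (yT a d l * yT c b k) := by
    rw [Finset.sum_mul_sum, Finset.sum_comm]
    simp only [smul_mul_smul_comm, mul_comm (shiftCoeff x s _)]
  have hL : (∑ k ∈ Finset.range N, shiftCoeff x r k • yT a d k)
        * (∑ k ∈ Finset.range N, shiftCoeff x s k • yT c b k)
      = ∑ k ∈ Finset.range N, ∑ l ∈ Finset.range N,
          (shiftCoeff x r k * shiftCoeff x s l) • (yT a d k * yT c b l) := by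
    rw [Finset.sum_mul_sum]
    simp only [smul_mul_smul_comm]
  rw [hR, hL, sum_lie_sum, sum_lie_sum]
  simp only [sl, ls, smul_smul, ← Finset.sum_sub_distrib, ← smul_sub]
  refine Finset.sum_congr rfl fun k _ => Finset.sum_congr rfl fun l _ => ?_
  rw [← yT_rel, smul_sub]

theorem shiftT_zero {n : ℕ} (x : ℂ) (a b : Fin n) : shiftT x a b 0 = if a = b then 1 else 0 := rfl

/-- The automorphism `ρ_x : T(u) ↦ T(u - x)` of the Yangian, as an endomorphism. -/
def shiftHom (n : ℕ) (x : ℂ) : Yangian n →ₐ[ℂ] Yangian n :=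
  yangianLift (shiftT x) (shiftT_zero x) (shiftT_rel x)

/-- The generator `e_{ab}` in `U(gl_n)`. -/
def eU {n : ℕ} (a b : Fin n) : UGl n := UniversalEnvelopingAlgebra.ι ℂ (eMat a b)

/-- The coefficient of `u^{-s}` in `δ_{ab} + e_{ba} u^{-1}`. -/
def evalT {n : ℕ} (a b : Fin n) : ℕ → UGl n
  | 0 => if a = b then 1 else 0
  | 1 => eU b a
  | _ + 2 => 0

theorem evalT_zero {n : ℕ} (a b : Fin n) : evalT a b 0 = if a = b then 1 else 0 := rfl

theorem eU_lie {n : ℕ} (a b c d : Fin n) :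
    ⁅eU a b, eU c d⁆ = (if b = c then eU a d else 0) - (if a = d then eU c b else 0) := by
  unfold eU eMat
  rw [← LieHom.map_lie, LieRing.of_associative_ring_bracket, map_sub]
  congr 1
  · split_ifs with h
    · subst h; rw [Matrix.single_mul_single_same, one_mul]
    · rw [Matrix.single_mul_single_of_ne _ _ _ _ h, map_zero]
  · split_ifs with h
    · subst h; rw [Matrix.single_mul_single_same, one_mul]
    · rw [Matrix.single_mul_single_of_ne _ _ _ _ (Ne.symm h), map_zero]

theorem evalT_rel {n : ℕ} (a b c d : Fin n) (r s : ℕ) :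
    ⁅evalT a b (r + 1), evalT c d s⁆ - ⁅evalT a b r, evalT c d (s + 1)⁆
      = evalT a d r * evalT c b s - evalT a d s * evalT c b r := by
  have h := eU_lie b a d c
  have one_l : ∀ (P : Prop) [Decidable P] (y : UGl n), ⁅(if P then 1 else 0 : UGl n), y⁆ = 0 := by
    intro P _ y; split_ifs <;> simp [Ring.lie_def]
  have l_one : ∀ (P : Prop) [Decidable P] (y : UGl n), ⁅y, (if P then 1 else 0 : UGl n)⁆ = 0 := by
    intro P _ y; split_ifs <;> simp [Ring.lie_def]
  rcases r with _ | _ | r <;> rcases s with _ | _ | s <;>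
    simp only [evalT, one_l, l_one, lie_zero, zero_lie, sub_zero, zero_sub, mul_zero, zero_mul,
      sub_self, h]
  · simp only [eq_comm (a := b)]; split_ifs <;> simp
  · simp only [eq_comm (a := b)]; split_ifs <;> simp

/-- The evaluation homomorphism `ε : Y(gl_n) → U(gl_n)`, `T^a_b(u) ↦ δ_{ab} + e_{ba} u^{-1}`. -/
def evalHom (n : ℕ) : Yangian n →ₐ[ℂ] UGl n :=
  yangianLift evalT evalT_zero evalT_rel

/-- The action of `Y(gl_n)` on a `gl_n`-module through `ε ∘ ρ_x`. -/
def evalAction (n : ℕ) (V : Type*) [AddCommGroup V] [Module ℂ V] [LieRingModule (Gl n) V]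
    [LieModule ℂ (Gl n) V] (x : ℂ) : Yangian n →ₐ[ℂ] Module.End ℂ V :=
  ((UniversalEnvelopingAlgebra.lift ℂ (LieModule.toEnd ℂ (Gl n) V)).comp (evalHom n)).comp
    (shiftHom n x)

/-- The evaluation module `V(x)` over `Y(gl_n)`: the vector space underlying a `gl_n`-module `V`,
on which `Y(gl_n)` acts through `ε ∘ ρ_x`. -/
def EvalModule (_n : ℕ) (V : Type*) (_x : ℂ) : Type _ := V

instance {n : ℕ} {V : Type*} [AddCommGroup V] (x : ℂ) : AddCommGroup (EvalModule n V x) :=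
  inferInstanceAs (AddCommGroup V)

instance {n : ℕ} {V : Type*} [AddCommGroup V] [Module ℂ V] [LieRingModule (Gl n) V]
    [LieModule ℂ (Gl n) V] (x : ℂ) : Module (Yangian n) (EvalModule n V x) :=
  Module.compHom V (evalAction n V x).toRingHom

/-- A vector of `V`, regarded as a vector of `V(x)`. -/
def EvalModule.of (n : ℕ) {V : Type*} (x : ℂ) (v : V) : EvalModule n V x := v

/-- The action of `e_{ab}` on a `gl_n`-module. -/
def eOp (n : ℕ) (V : Type*) [AddCommGroup V] [Module ℂ V] [LieRingModule (Gl n) V]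
    [LieModule ℂ (Gl n) V] (a b : Fin n) : Module.End ℂ V :=
  LieModule.toEnd ℂ (Gl n) V (eMat a b)

/-- A singular vector of weight `Λ` in a `gl_n`-module: `e_{ab} v = 0` for `a < b` and
`e_{aa} v = Λ^a v`. -/
def IsSingularVector {n : ℕ} {V : Type*} [AddCommGroup V] [Module ℂ V] [LieRingModule (Gl n) V]
    [LieModule ℂ (Gl n) V] (Λ : Fin n → ℂ) (v : V) : Prop :=
  (∀ a b, a < b → eOp n V a b v = 0) ∧ ∀ a, eOp n V a a v = Λ a • v

/-! ### Functions of the variables `t^a_i`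

The rational functions in the variables `t^a_i` and the formal series in their inverses are both
viewed inside iterated Laurent series in the inverses of the variables.  The variables are
algebraically independent, so that rational functions in them are equal if and only if their
expansions are. -/

variable {m : ℕ}

/-- The positions `(a, i)`, `1 ≤ a ≤ n - 1`, `1 ≤ i ≤ ξ_a` (counted from `0`), in lexicographic
order.  They number both the variables `t^a_i` and the factors of `(ℂ^n)^{⊗ (ξ_1+…+ξ_{n-1})}`. -/
abbrev Pos (ξ : Fin m → ℕ) : Type := Σₗ a : Fin m, Fin (ξ a)

/-- The position `(a, i)`. -/
def pos {ξ : Fin m → ℕ} (a : Fin m) (i : Fin (ξ a)) : Pos ξ := toLex ⟨a, i⟩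

/-- Exponents of monomials in the inverses of the variables, in lexicographic order. -/
abbrev Expo (ξ : Fin m → ℕ) : Type := Lex (Pos ξ → ℤ)

/-- Iterated Laurent series in the inverses of the variables `t^a_i`, with coefficients in `A`;
the variables commute with the coefficients. -/
abbrev Ser (ξ : Fin m → ℕ) (A : Type*) [Zero A] : Type _ := HahnSeries (Expo ξ) A

/-- The exponent of the inverse of the variable at a given position. -/
def expo {ξ : Fin m → ℕ} (i : Pos ξ) : Expo ξ := toLex (Pi.single i 1)

/-- The variable `t^a_i`. -/
def tVar (ξ : Fin m → ℕ) (a : Fin m) (i : Fin (ξ a)) : Ser ξ ℂ :=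
  HahnSeries.single (-expo (pos a i)) 1

theorem expo_pos {ξ : Fin m → ℕ} (i : Pos ξ) : 0 < expo i := by
  refine ⟨i, fun j hj => ?_, ?_⟩
  · exact (Pi.single_eq_of_ne (M := fun _ : Pos ξ => ℤ) hj.ne 1).symm
  · exact lt_of_lt_of_eq (zero_lt_one (α := ℤ))
      (Pi.single_eq_same (M := fun _ : Pos ξ => ℤ) i 1).symm

/-- Substitution of the inverse of the variable at position `i` into a formal power series. -/
def substInv {ξ : Fin m → ℕ} {A : Type*} [Semiring A] (i : Pos ξ) : PowerSeries A →+* Ser ξ A :=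
  (HahnSeries.embDomainRingHom (multiplesHom (Expo ξ) (expo i))
    (fun _ _ h => (nsmul_left_strictMono (expo_pos i)).injective h)
    (fun _ _ => (nsmul_left_strictMono (expo_pos i)).le_iff_le)).comp
    HahnSeries.toPowerSeries.symm.toRingHom

/-- Series with scalar coefficients, as series with coefficients in a `ℂ`-algebra. -/
def scalar {ξ : Fin m → ℕ} (A : Type*) [Ring A] [Algebra ℂ A] : Ser ξ ℂ →+* Ser ξ A where
  toFun f := f.map (algebraMap ℂ A)
  map_one' := HahnSeries.map_one (algebraMap ℂ A).toMonoidWithZeroHom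
  map_mul' _ _ := HahnSeries.map_mul (algebraMap ℂ A).toNonUnitalRingHom
  map_zero' := HahnSeries.map_zero (algebraMap ℂ A).toMonoidWithZeroHom.toZeroHom
  map_add' _ _ := HahnSeries.map_add (algebraMap ℂ A).toAddMonoidHom

/-- The matrix `T(t^a_i)`, with entries the generating series `T^b_c(u)` of the Yangian at
`u = t^a_i`. -/
def tMatrix {ξ : Fin m → ℕ} (n : ℕ) (a : Fin m) (i : Fin (ξ a)) :
    Matrix (Fin n) (Fin n) (Ser ξ (Yangian n)) :=
  Matrix.of fun b c => substInv (pos a i) (PowerSeries.mk (yT b c))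

/-! ### The nested Bethe vector -/

/-- `M^{(i)}`: the matrix `M` acting in the `i`-th factor of a tensor power of `ℂ^n`.  Matrices
acting in tensor powers are labelled by multi-indices. -/
def onePos {n : ℕ} {P A : Type*} [Fintype P] [DecidableEq P] [Ring A]
    (M : Matrix (Fin n) (Fin n) A) (i : P) : Matrix (P → Fin n) (P → Fin n) A :=
  Matrix.of fun f g => if ∀ k, k ≠ i → f k = g k then M (f i) (g i) else 0

/-- `M^{(ij)}`: the matrix `M` acting in the `i`-th and the `j`-th factor. -/
def twoPos {n : ℕ} {P A : Type*} [Fintype P] [DecidableEq P] [Ring A]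
    (M : Matrix (Fin n × Fin n) (Fin n × Fin n) A) (i j : P) :
    Matrix (P → Fin n) (P → Fin n) A :=
  Matrix.of fun f g =>
    if ∀ k, k ≠ i → k ≠ j → f k = g k then M (f i, f j) (g i, g j) else 0

/-- The rational `R`-matrix `R(u) = 1 + u⁻¹ ∑_{a,b} E_{ab} ⊗ E_{ba}`. -/
def rMatrix {K : Type*} [Field K] (n : ℕ) (u : K) :
    Matrix (Fin n × Fin n) (Fin n × Fin n) K :=
  1 + u⁻¹ • ∑ a : Fin n, ∑ b : Fin n, Matrix.single a b (1 : K) ⊗ₖ Matrix.single b a (1 : K)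

/-- The ordered product `T^{(a,1)}(t^a_1) ⋯ T^{(a,ξ_a)}(t^a_{ξ_a})`. -/
def tBlock (n : ℕ) (ξ : Fin m → ℕ) (a : Fin m) :
    Matrix (Pos ξ → Fin n) (Pos ξ → Fin n) (Ser ξ (Yangian n)) :=
  (List.ofFn fun i : Fin (ξ a) => onePos (tMatrix n a i) (pos a i)).prod

/-- The ordered product over `i = 1, …, ξ_a` (increasing) and, inside, `l = 1, …, ξ_b` (decreasing)
of `R^{(a,i),(b,l)}(t^a_i - t^b_l)`. -/
def rBlock (n : ℕ) (ξ : Fin m → ℕ) (a b : Fin m) :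
    Matrix (Pos ξ → Fin n) (Pos ξ → Fin n) (Ser ξ (Yangian n)) :=
  (List.ofFn fun i : Fin (ξ a) =>
    (List.ofFn fun l : Fin (ξ b) =>
      twoPos ((rMatrix n (tVar ξ a i - tVar ξ b l)).map (scalar (Yangian n)))
        (pos a i) (pos b l)).reverse.prod).prod

/-- The product of the blocks `T^{[1]} ⋯ T^{[n-1]}` and of the blocks `R^{[a,b]}`, `b < a`, with
`a` decreasing and, for equal `a`, with `b` decreasing. -/
def tHat (n : ℕ) (ξ : Fin m → ℕ) :
    Matrix (Pos ξ → Fin n) (Pos ξ → Fin n) (Ser ξ (Yangian n)) :=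
  (List.ofFn fun a : Fin m => tBlock n ξ a).prod *
    ((List.finRange m).reverse.map fun a =>
      (((List.finRange m).filter (· < a)).reverse.map fun b => rBlock n ξ a b).prod).prod

/-- `𝔹_ξ(t)` for `n = m + 1`: the entry of the above product in the row
`1^{ξ_1}, …, (n-1)^{ξ_{n-1}}` and the column `2^{ξ_1}, …, n^{ξ_{n-1}}`. -/
def bethe (ξ : Fin m → ℕ) : Ser ξ (Yangian (m + 1)) :=
  tHat (m + 1) ξ (fun k => (ofLex k).1.castSucc) (fun k => (ofLex k).1.succ)

/-- Series in the inverses of the variables with coefficients in the evaluation module `V(x)`,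
a module over the series with coefficients in the Yangian. -/
abbrev VSer (n : ℕ) (ξ : Fin m → ℕ) (V : Type*) [AddCommGroup V] [Module ℂ V]
    [LieRingModule (Gl n) V] [LieModule ℂ (Gl n) V] (x : ℂ) : Type _ :=
  HahnModule (Expo ξ) (Yangian n) (EvalModule n V x)

/-- A vector of `V(x)`, as a constant series. -/
def const (n : ℕ) (ξ : Fin m → ℕ) {V : Type*} [AddCommGroup V] [Module ℂ V]
    [LieRingModule (Gl n) V] [LieModule ℂ (Gl n) V] (x : ℂ) (v : V) : VSer n ξ V x :=
  HahnModule.of (Yangian n) (HahnSeries.single 0 (EvalModule.of n x v))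

/-! ### Symmetrization and the function `G` -/

/-- `Q_k(t_1, …, t_k)`. -/
def qFun {K : Type*} [Field K] {k : ℕ} (t : Fin k → K) : K :=
  ∏ i, ∏ j ∈ Finset.Ioi i, (t i - t j - 1) / (t i - t j)

/-- The symmetrization `Sym_t f`. -/
def sym {K : Type*} [Field K] {k : ℕ} (f : (Fin k → K) → K) (t : Fin k → K) : K :=
  ∑ σ : Equiv.Perm (Fin k), f (t ∘ σ)

/-- The modified symmetrization `Sym_t (f Q_k)`. -/
def symBar {K : Type*} [Field K] {k : ℕ} (f : (Fin k → K) → K) (t : Fin k → K) : K :=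
  sym (fun s => f s * qFun s) t

/-- The function `G_{i,j}(t)` for `(ξ_1, ξ_2, ξ_3) = (k₁, k₂, k₃)`, with all indices counted from `0`.
The variable `w` in the last product is `t^1_{ξ_1-q+s}`, `s = 1, …, q` (counted from `1`). -/
def gFun {K : Type*} [Field K] {k₁ k₂ k₃ p q : ℕ} (hp : p ≤ k₃) (hq : q ≤ k₁) (x Λ2 Λ3 : K)
    (i : Fin p ↪o Fin k₂) (j : Fin q ↪o Fin k₂)
    (t1 : Fin k₁ → K) (t2 : Fin k₂ → K) (t3 : Fin k₃ → K) : K :=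
  (∏ a : Fin p,
    let u := t3 (Fin.castLE hp a)
    (u - x + Λ3) / (u - t2 (i a)) * ∏ l ∈ Finset.Ioi (i a), (u - t2 l + 1) / (u - t2 l)) *
  ∏ s : Fin q,
    let w := t1 (Fin.cast (Nat.sub_add_cancel hq) (Fin.natAdd (k₁ - q) s))
    (w - x + Λ2) / (t2 (j s) - w) * ∏ l ∈ Finset.Iio (j s), (t2 l - w + 1) / (t2 l - w)

/-- `Sym̄_{t¹} Sym̄_{t²} Sym̄_{t³} G_{i,j}(t)` at the variables `t^a_i`.
Here `Λ2` and `Λ3` stand for `Λ²` and `Λ³`. -/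
def symG (ξ : Fin 3 → ℕ) {p q : ℕ} (hp : p ≤ ξ 2) (hq : q ≤ ξ 0) (x Λ2 Λ3 : ℂ)
    (i : Fin p ↪o Fin (ξ 1)) (j : Fin q ↪o Fin (ξ 1)) : Ser ξ ℂ :=
  symBar (fun s1 => symBar (fun s2 => symBar (fun s3 =>
    gFun hp hq (HahnSeries.C x) (HahnSeries.C Λ2) (HahnSeries.C Λ3) i j s1 s2 s3)
    (tVar ξ 2)) (tVar ξ 1)) (tVar ξ 0)

/-- The number of common values of two sequences. -/
def interCard {k p q : ℕ} (i : Fin p ↪o Fin k) (j : Fin q ↪o Fin k) : ℕ :=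
  (Finset.univ.image i ∩ Finset.univ.image j).card

theorem le_left_of_fin {a b : ℕ} (p : Fin (min a b + 1)) : (p : ℕ) ≤ a :=
  (Nat.lt_succ_iff.mp p.2).trans (min_le_left a b)

theorem le_right_of_fin {a b : ℕ} (p : Fin (min a b + 1)) : (p : ℕ) ≤ b :=
  (Nat.lt_succ_iff.mp p.2).trans (min_le_right a b)

/-- With `e_{ab}` numbered from `1`, the vector
`e32^{k₂-p-q+r} e31^{q-r} e42^{p-r} e41^r e21^{k₁-q} e43^{k₃-p} v`. -/
def monoVec {V : Type*} [AddCommGroup V] [Module ℂ V] [LieRingModule (Gl 4) V]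
    [LieModule ℂ (Gl 4) V] (k₁ k₂ k₃ p q r : ℕ) (v : V) : V :=
  (eOp 4 V 2 1 ^ (k₂ + r - p - q) * eOp 4 V 2 0 ^ (q - r) * eOp 4 V 3 1 ^ (p - r) * eOp 4 V 3 0 ^ r *
    eOp 4 V 1 0 ^ (k₁ - q) * eOp 4 V 3 2 ^ (k₃ - p)) v

/-- The product of the factorials of the exponents in the above vector. -/
def factProd (k₁ k₂ k₃ p q r : ℕ) : ℕ :=
  (k₂ + r - p - q).factorial * (q - r).factorial * (p - r).factorial * r.factorial *
    (k₁ - q).factorial * (k₃ - p).factorial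

end NestedBethe

end

noncomputable section

namespace NestedBethe

open Equiv Equiv.Perm

/-! Both sides are reduced to one double sum over configurations `b`, `b'` of `true` and `false` on
the variables t². Its terms are products of two six-vertex partition functions, `partFun` in t¹, t²
and `partFunNeg` in t³, t², multiplied by a lowering monomial whose exponents depend only on the
numbers of `false` values in `b`, in `b'` and in both at once. Letters are counted from 0 below, as
in the code.

Representation side (`blocks_apply`, `bethe_smul_const`). The Yang-Baxter and RTT relations for
blocks turn T¹T²T³R³²R³¹R²¹ into R²¹T²T¹T³R³¹R³² (`gridProd_rearrange`). Now R²¹ acts only on the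
row index, R³¹R³² only on the column index. The factor R³¹ drops out: exchanging letters of blocks 1
and 3 puts the column letter 1 into T³, whose rows carry the letter 2, and the resulting operator
e₁₂ kills the vectors obtained from v. In each of R²¹ and R³² only two letters occur, so their
entries are those of products of six-vertex monodromy matrices (`exch_grid_apply`). The entries of
T¹ and T³ left over are 1 plus a multiple of a diagonal generator, or a multiple of a lowering
generator; on the weight vectors at hand they produce `boundaryWeight`. Those of T² are commuting
lowering operators. Conservation of excitations then fixes all exponents (`chainOp_boundaryWeight`).

Symmetrization side. A function on the orbit of a generic point extends to at most one family
indexed by permutations on which Demazure-Lusztig operators act by translation (`IsFam`). Two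
families have a pairing, a sum over permutations of values at the base point and at its reversal.
Multiplication by coordinates is self-adjoint for it, so the pairing is diagonal in delta functions
on the orbit. Adjointness of translations and the value on constant families force the diagonal
coefficients to be Q. Thus (`pairing_eq_sum`) a symmetrization weighted by Q equals a sum over
permutations of configurations at one fixed point.

This identity is used twice. Applied row by row, it identifies the modified symmetrization of an
explicit product with a partition function (`chainOp_eq_symBar`), which settles t¹ and t³. Applied
to t², it gives `symBar_gFun`: the symmetrized G is a product of two factorials with the sum over u
of the partition functions at `avoid j ∘ u` and `avoid i ∘ u`. This sum sees the pair of sequences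
only through its orbit, hence through p, q, r, which is (b). Sorting the sum by configurations
produces stabilizer orders; with the two factorials they are exactly the denominator in (a)
(`sum_partFun_eq`), and summing over p, q, r recovers the double sum (`sum_partFun_smul`).

All of this runs over the field of Hahn series in the inverse variables; `serAction` makes the
Yangian series act by operators linear over that field. -/

/-! ### Exchange families indexed by permutations -/

section Families

variable {K : Type*} [Field K] {n : ℕ}

/-- A point with coordinates whose differences avoid `0` and `±1`. -/
def Generic (t : Fin n → K) : Prop :=
  ∀ i j, i ≠ j → t i - t j ≠ 0 ∧ 1 + (t i - t j) ≠ 0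

theorem Generic.comp {t : Fin n → K} (ht : Generic t) (σ : Perm (Fin n)) : Generic (t ∘ σ) :=
  fun i j hij => ht (σ i) (σ j) (σ.injective.ne hij)

theorem adjacent_induction {motive : Perm (Fin n) → Prop} (one : motive 1)
    (mul : ∀ k l : Fin n, (k : ℕ) + 1 = l → ∀ w, motive w → motive (w * swap k l))
    (w : Perm (Fin n)) : motive w := by
  cases n with
  | zero => rwa [Subsingleton.elim w 1]
  | succ n =>
    refine Submonoid.closure_induction_right (motive := fun w _ => motive w) one ?_
      ((mclosure_swap_castSucc_succ n).symm ▸ Submonoid.mem_top w)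
    rintro x _ _ ⟨i, rfl⟩ hx
    exact mul _ _ (by simp) _ hx

theorem adjacent_induction_left {motive : Perm (Fin n) → Prop} (one : motive 1)
    (mul : ∀ k l : Fin n, (k : ℕ) + 1 = l → ∀ w, motive w → motive (swap k l * w))
    (w : Perm (Fin n)) : motive w := by
  have h := adjacent_induction (motive := fun w => motive w⁻¹) (by simpa using one)
    (fun k l hkl w hw => by simpa using mul k l hkl _ hw) w⁻¹
  simpa using h

/-- The family `w ↦ c w` of functions on the orbit of `t` (the second argument `σ` stands for the
point `t ∘ σ`) is permuted by the Demazure-Lusztig operators. -/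
def IsFam (t : Fin n → K) (c : Perm (Fin n) → Perm (Fin n) → K) : Prop :=
  ∀ k l : Fin n, (k : ℕ) + 1 = l → ∀ w σ,
    (1 + (t (σ k) - t (σ l))) * c w (σ * swap k l)
      = c w σ + (t (σ k) - t (σ l)) * c (swap k l * w) σ

/-- The relation can be solved for the member at `swap k l * w`, since the coefficient `t (σ k) - t
(σ l)` is nonzero; adjacent transpositions reach every index from 1. -/
theorem IsFam.ext {t : Fin n → K} (ht : Generic t) {a c : Perm (Fin n) → Perm (Fin n) → K}
    (ha : IsFam t a) (hc : IsFam t c) (h : ∀ σ, a 1 σ = c 1 σ) : a = c := by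
  suffices ∀ w σ, a w σ = c w σ from funext fun w => funext fun σ => this w σ
  intro w
  induction w using adjacent_induction_left with
  | one => exact h
  | mul k l hkl w ih =>
    intro σ
    have hne : k ≠ l := by rintro rfl; omega
    have h1 := ha k l hkl w σ
    have h2 := hc k l hkl w σ
    rw [ih, ih] at h1
    have hd := (ht (σ k) (σ l) (σ.injective.ne hne)).1
    exact mul_left_cancel₀ hd (by linear_combination h2 - h1)

theorem IsFam.sum {t : Fin n → K} {ι : Type*} (s : Finset ι)
    {c : ι → Perm (Fin n) → Perm (Fin n) → K} (x : ι → K) (hc : ∀ i ∈ s, IsFam t (c i)) :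
    IsFam t (fun w σ => ∑ i ∈ s, x i * c i w σ) := by
  intro k l hkl w σ
  simp only [Finset.mul_sum]
  rw [← Finset.sum_add_distrib]
  refine Finset.sum_congr rfl fun i hi => ?_
  linear_combination x i * hc i hi k l hkl w σ

theorem IsFam.mul_right {t : Fin n → K} {c : Perm (Fin n) → Perm (Fin n) → K} (hc : IsFam t c)
    (v : Perm (Fin n)) : IsFam t (fun w σ => c (w * v) σ) := by
  intro k l hkl w σ
  simpa only [mul_assoc] using hc k l hkl (w * v) σ

/-- The sign with which the pair `{i, j}` contributes to the commutation of a coordinate. -/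
def invSign (i : Fin n) (w : Perm (Fin n)) (j : Fin n) : K :=
  if j < i ∧ w i < w j then 1 else if i < j ∧ w j < w i then -1 else 0

/-- Multiplication of a family by the `i`-th coordinate function. -/
def coordMul (t : Fin n → K) (i : Fin n) (c : Perm (Fin n) → Perm (Fin n) → K) :
    Perm (Fin n) → Perm (Fin n) → K :=
  fun w σ => t (σ (w i)) * c w σ + ∑ j, invSign i w j * c (w * swap i j) σ

theorem coordMul_one (t : Fin n → K) (i : Fin n) (c : Perm (Fin n) → Perm (Fin n) → K)
    (σ : Perm (Fin n)) : coordMul t i c 1 σ = t (σ i) * c 1 σ := by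
  unfold coordMul
  rw [Finset.sum_eq_zero, add_zero]; · rfl
  intro j _
  have h : invSign (K := K) i 1 j = 0 := by
    unfold invSign
    rw [if_neg, if_neg] <;> rintro ⟨h1, h2⟩ <;> exact absurd h1 (not_lt_of_gt h2)
  rw [h, zero_mul]

theorem swap_adjacent_lt_iff {k l x y : Fin n} (hkl : (k : ℕ) + 1 = l)
    (h1 : ¬ (x = k ∧ y = l)) (h2 : ¬ (x = l ∧ y = k)) : swap k l x < swap k l y ↔ x < y := by
  simp only [swap_apply_def, Fin.lt_def, Fin.ext_iff] at *
  split_ifs <;> omega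

/-- This is the commutation rule of a degenerate affine Hecke algebra: moving a permutation past a
coordinate permutes the coordinate and leaves one correction for each inversion involving it. -/
theorem IsFam.coordMul {t : Fin n → K} {c : Perm (Fin n) → Perm (Fin n) → K} (hc : IsFam t c)
    (i : Fin n) : IsFam t (coordMul t i c) := by
  intro k l hkl w σ
  have hne : k ≠ l := by rintro rfl; omega
  set s := swap k l with hs
  set d := t (σ k) - t (σ l) with hd
  -- What remains of the relation once it is known for `c`: the change of the coordinate must cancel
  -- against the change of the inversion signs. Only the index `m` with `w m = s (w i)` can change
  -- sign, and there `s * (w * swap i m) = w`.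
  have key : (t (σ (s (w i))) - t (σ (w i))) * c w σ
      + d * ∑ j, (invSign i w j - invSign i (s * w) j) * c (s * (w * swap i j)) σ = 0 := by
    by_cases hik : w i = k ∨ w i = l
    · obtain ⟨m, hm, hm'⟩ : ∃ m, w m = s (w i) ∧ s (w m) = w i :=
        ⟨w⁻¹ (s (w i)), by simp, by simp [hs]⟩
      have hmi : m ≠ i := by
        rintro rfl
        rcases hik with h | h <;> simp [h, hs] at hm <;> exact hne (by simp [hm])
      rw [Finset.sum_eq_single m]
      · have hc' : s * (w * swap i m) = w := by
          rw [Equiv.mul_swap_eq_swap_mul w i m, hm, ← mul_assoc]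
          rcases hik with h | h <;> simp [h, hs, swap_comm l k]
        rw [hc']
        rcases hik with h | h
        · have e1 : s k = l := by simp [hs]
          have e2 : s l = k := by simp [hs]
          have hkl' : k < l := by rw [Fin.lt_def]; omega
          rw [h, e1] at hm
          simp only [invSign, Perm.mul_apply, hm, h, e1, e2, hkl', hkl'.not_gt, and_true, and_false,
            if_false]
          rcases lt_or_gt_of_ne hmi with h' | h'
          · simp only [h', h'.not_gt, if_true, if_false]; rw [hd]; ring
          · simp only [h', h'.not_gt, if_true, if_false]; rw [hd]; ring
        · have e1 : s k = l := by simp [hs]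
          have e2 : s l = k := by simp [hs]
          have hkl' : k < l := by rw [Fin.lt_def]; omega
          rw [h, e2] at hm
          simp only [invSign, Perm.mul_apply, hm, h, e1, e2, hkl', hkl'.not_gt, and_true, and_false,
            if_false]
          rcases lt_or_gt_of_ne hmi with h' | h'
          · simp only [h', h'.not_gt, if_true, if_false]; rw [hd]; ring
          · simp only [h', h'.not_gt, if_true, if_false]; rw [hd]; ring
      · intro j _ hj
        have hw : w j ≠ s (w i) := fun h => hj (w.injective (h.trans hm.symm))
        have h1 : s (w i) < s (w j) ↔ w i < w j := swap_adjacent_lt_iff hkl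
          (by rintro ⟨h, h'⟩; exact hw (by simp [h, h', hs]))
          (by rintro ⟨h, h'⟩; exact hw (by simp [h, h', hs]))
        have h2 : s (w j) < s (w i) ↔ w j < w i := swap_adjacent_lt_iff hkl
          (by rintro ⟨h, h'⟩; exact hw (by simp [h, h', hs]))
          (by rintro ⟨h, h'⟩; exact hw (by simp [h, h', hs]))
        simp only [invSign, Perm.mul_apply, h1, h2, sub_self, zero_mul]
      · simp
    · push Not at hik
      have e : s (w i) = w i := swap_apply_of_ne_of_ne hik.1 hik.2
      rw [e, sub_self, zero_mul, zero_add, Finset.sum_eq_zero, mul_zero]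
      intro j _
      have h1 : s (w i) < s (w j) ↔ w i < w j := swap_adjacent_lt_iff hkl
        (by rintro ⟨h, h'⟩; exact hik.1 h) (by rintro ⟨h, h'⟩; exact hik.2 h)
      have h2 : s (w j) < s (w i) ↔ w j < w i := swap_adjacent_lt_iff hkl
        (by rintro ⟨h, h'⟩; exact hik.2 h') (by rintro ⟨h, h'⟩; exact hik.1 h')
      simp only [invSign, Perm.mul_apply, h1, h2, sub_self, zero_mul]
  have hsum : (1 + d) * ∑ j, invSign i w j * c (w * swap i j) (σ * s)
      = ∑ j, invSign i w j * c (w * swap i j) σ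
        + d * ∑ j, invSign i w j * c (s * (w * swap i j)) σ := by
    simp only [Finset.mul_sum, ← Finset.sum_add_distrib]
    refine Finset.sum_congr rfl fun j _ => ?_
    linear_combination invSign i w j * hc k l hkl (w * swap i j) σ
  have h0 := hc k l hkl w σ
  simp only [sub_mul, Finset.sum_sub_distrib] at key
  simp only [NestedBethe.coordMul, Perm.mul_apply, mul_assoc] at *
  linear_combination t (σ (s (w i))) * h0 + hsum + key

/-- The pairing of two families. -/
def pairing (a c : Perm (Fin n) → Perm (Fin n) → K) : K :=
  ∑ u, a (Fin.revPerm * u) Fin.revPerm * c u 1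

/-- The reversal at the point and the one in the index cancel in the coordinate. In the correction
terms, the substitution of `u * swap i j` for `u` together with the reversal preserves the inversion
sign. -/
theorem pairing_coordMul (t : Fin n → K) (i : Fin n) (a c : Perm (Fin n) → Perm (Fin n) → K) :
    pairing (coordMul t i a) c = pairing a (coordMul t i c) := by
  unfold pairing coordMul
  simp only [add_mul, mul_add, Finset.sum_add_distrib, Finset.sum_mul, Finset.mul_sum]
  congr 1
  · refine Finset.sum_congr rfl fun u _ => ?_
    simp only [Perm.mul_apply, Fin.revPerm_apply, Fin.rev_rev, Perm.one_apply]
    ring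
  · rw [Finset.sum_comm, Finset.sum_comm (γ := Perm (Fin n)) (α := Fin n)]
    refine Finset.sum_congr rfl fun j _ => ?_
    rw [← Equiv.sum_comp (Equiv.mulRight (swap i j))]
    refine Finset.sum_congr rfl fun u _ => ?_
    have h : invSign (K := K) i (Fin.revPerm * (u * swap i j)) j = invSign i u j := by
      simp [invSign, Fin.rev_lt_rev]
    simp only [coe_mulRight, h, mul_assoc, swap_mul_self, mul_one]
    ring

theorem pairing_mul_right (v : Perm (Fin n)) (a c : Perm (Fin n) → Perm (Fin n) → K) :
    pairing (fun w => a (w * v)) c = pairing a (fun w => c (w * v⁻¹)) := by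
  unfold pairing
  rw [← Equiv.sum_comp (Equiv.mulRight v⁻¹)]
  simp [mul_assoc]

theorem pairing_sum_left {ι : Type*} (s : Finset ι) (x : ι → K)
    (a : ι → Perm (Fin n) → Perm (Fin n) → K) (c : Perm (Fin n) → Perm (Fin n) → K) :
    pairing (fun w σ => ∑ i ∈ s, x i * a i w σ) c = ∑ i ∈ s, x i * pairing (a i) c := by
  unfold pairing
  simp only [Finset.sum_mul, Finset.mul_sum]
  rw [Finset.sum_comm]
  simp only [mul_assoc]

theorem pairing_sum_right {ι : Type*} (s : Finset ι) (x : ι → K)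
    (c : ι → Perm (Fin n) → Perm (Fin n) → K) (a : Perm (Fin n) → Perm (Fin n) → K) :
    pairing a (fun w σ => ∑ i ∈ s, x i * c i w σ) = ∑ i ∈ s, x i * pairing a (c i) := by
  unfold pairing
  simp only [Finset.mul_sum]
  rw [Finset.sum_comm]
  refine Finset.sum_congr rfl fun i _ => Finset.sum_congr rfl fun u _ => ?_
  ring

/-- Functions on the orbit by which families can be multiplied, compatibly with the pairing. -/
def multipliers (t : Fin n → K) (ht : Generic t) : Subalgebra K (Perm (Fin n) → K) where
  carrier := {g | ∃ m : (Perm (Fin n) → Perm (Fin n) → K) → Perm (Fin n) → Perm (Fin n) → K,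
    (∀ c, IsFam t c → IsFam t (m c)) ∧ (∀ c σ, m c 1 σ = g σ * c 1 σ) ∧
    ∀ a c, IsFam t a → IsFam t c → pairing (m a) c = pairing a (m c)}
  mul_mem' := by
    rintro g g' ⟨m, h1, h2, h3⟩ ⟨m', h1', h2', h3'⟩
    refine ⟨fun c => m (m' c), fun c hc => h1 _ (h1' _ hc), fun c σ => ?_, fun a c ha hc => ?_⟩
    · change m (m' c) 1 σ = _
      rw [h2, h2', Pi.mul_apply, mul_assoc]
    -- Passing to the other argument reverses the order of the two operators. They commute on
    -- families, because a family is determined by its member at 1, where both act by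
    -- multiplication.
    · rw [h3 _ _ (h1' _ ha) hc, h3' _ _ ha (h1 _ hc)]
      congr 1
      refine (h1' _ (h1 _ hc)).ext ht (h1 _ (h1' _ hc)) fun σ => ?_
      change m' (m c) 1 σ = m (m' c) 1 σ
      rw [h2, h2', h2, h2']; ring
  add_mem' := by
    rintro g g' ⟨m, h1, h2, h3⟩ ⟨m', h1', h2', h3'⟩
    refine ⟨fun c => m c + m' c, fun c hc k l hkl w σ => ?_, fun c σ => ?_, fun a c ha hc => ?_⟩
    · have e := h1 c hc k l hkl w σ
      have e' := h1' c hc k l hkl w σ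
      simp only [Pi.add_apply]
      linear_combination e + e'
    · simp only [Pi.add_apply, h2, h2', add_mul]
    · have e := h3 a c ha hc
      have e' := h3' a c ha hc
      simp only [pairing, Pi.add_apply, add_mul, mul_add, Finset.sum_add_distrib] at *
      rw [e, e']
  algebraMap_mem' := by
    intro r
    refine ⟨fun c w σ => r * c w σ, fun c hc k l hkl w σ => ?_, fun c σ => rfl,
      fun a c _ _ => ?_⟩
    · linear_combination r * hc k l hkl w σ
    · exact Finset.sum_congr rfl fun u _ => by ring

theorem coord_mem_multipliers (t : Fin n → K) (ht : Generic t) (i : Fin n) :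
    (fun σ => t (σ i)) ∈ multipliers t ht :=
  ⟨coordMul t i, fun _ hc => hc.coordMul i, fun c σ => coordMul_one t i c σ,
    fun a c _ _ => pairing_coordMul t i a c⟩

theorem Generic.ne {t : Fin n → K} (ht : Generic t) {i j : Fin n} (h : i ≠ j) : t i ≠ t j :=
  sub_ne_zero.mp (ht i j h).1

/-- Lagrange interpolation in each coordinate: the factor for `i` is 1 if `σ i = τ i` and 0
otherwise, because the coordinates of the point are distinct. -/
theorem single_mem_multipliers (t : Fin n → K) (ht : Generic t) (τ : Perm (Fin n)) :
    (Pi.single τ 1 : Perm (Fin n) → K) ∈ multipliers t ht := by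
  have h : (Pi.single τ 1 : Perm (Fin n) → K)
      = ∏ i, ∏ m ∈ Finset.univ.erase (τ i), ((t (τ i) - t m)⁻¹ •
          ((fun σ => t (σ i)) - algebraMap K (Perm (Fin n) → K) (t m))) := by
    funext σ
    simp only [Finset.prod_apply, Pi.smul_apply, Pi.sub_apply, Pi.algebraMap_apply,
      Algebra.algebraMap_self_apply, smul_eq_mul]
    by_cases hσ : σ = τ
    · subst hσ
      rw [Pi.single_eq_same, Finset.prod_eq_one]
      intro i _
      refine Finset.prod_eq_one fun m hm => inv_mul_cancel₀ ?_
      exact (ht _ _ (Finset.ne_of_mem_erase hm).symm).1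
    · rw [Pi.single_eq_of_ne hσ]
      obtain ⟨i, hi⟩ : ∃ i, σ i ≠ τ i := by
        by_contra! h
        exact hσ (Equiv.ext h)
      refine (Finset.prod_eq_zero (Finset.mem_univ i) ?_).symm
      exact Finset.prod_eq_zero (Finset.mem_erase.mpr ⟨hi, Finset.mem_univ _⟩) (by simp)
  rw [h]
  refine Subalgebra.prod_mem _ fun i _ => Subalgebra.prod_mem _ fun m _ => ?_
  exact Subalgebra.smul_mem _ (Subalgebra.sub_mem _ (coord_mem_multipliers t ht i)
    (Subalgebra.algebraMap_mem _ _)) _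

theorem isFam_one (t : Fin n → K) : IsFam t (fun _ _ => 1) := by
  intro k l _ w σ; ring

/-- Multiplying the constant family by delta functions gives a dual basis of families. Orthogonality
follows by moving one delta function across the pairing, where it meets a different one and gives 0.
-/
theorem exists_isFam_single (t : Fin n → K) (ht : Generic t) :
    ∃ δ : Perm (Fin n) → Perm (Fin n) → Perm (Fin n) → K, (∀ τ, IsFam t (δ τ)) ∧
      (∀ τ σ, δ τ 1 σ = if σ = τ then 1 else 0) ∧
      ∀ τ τ', τ ≠ τ' → pairing (δ τ) (δ τ') = 0 := by
  choose m h1 h2 h3 using fun τ => single_mem_multipliers t ht τ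
  have hv : ∀ τ σ, m τ (fun _ _ => 1) 1 σ = if σ = τ then 1 else 0 := by
    intro τ σ; rw [h2, mul_one, Pi.single_apply]
  refine ⟨fun τ => m τ fun _ _ => 1, fun τ => h1 _ _ (isFam_one t), hv, fun τ τ' h => ?_⟩
  rw [h3 _ _ _ (isFam_one t) (h1 _ _ (isFam_one t))]
  have hz : m τ (m τ' fun _ _ => 1) = fun _ _ => 0 := by
    refine (h1 _ _ (h1 _ _ (isFam_one t))).ext ht (fun k l _ w σ => by ring) fun σ => ?_
    rw [h2, hv, Pi.single_apply]
    split_ifs with e e' <;> simp_all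
  rw [hz]; simp [pairing]

theorem IsFam.eq_sum {t : Fin n → K} (ht : Generic t)
    {δ : Perm (Fin n) → Perm (Fin n) → Perm (Fin n) → K} (h1 : ∀ τ, IsFam t (δ τ))
    (h2 : ∀ τ σ, δ τ 1 σ = if σ = τ then 1 else 0) {c : Perm (Fin n) → Perm (Fin n) → K}
    (hc : IsFam t c) : c = fun w σ => ∑ τ, c 1 τ * δ τ w σ := by
  refine hc.ext ht (IsFam.sum _ _ fun τ _ => h1 τ) fun σ => ?_
  simp [h2]

/-! ### The weight of the modified symmetrization -/

/-- An adjacent transposition changes the relative order of a single pair. -/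
theorem prod_adjacent_swap {n : ℕ} (g : Fin n → Fin n → K) {k l : Fin n} (hkl : (k : ℕ) + 1 = l) :
    (∏ i, ∏ j ∈ Finset.Ioi i, g i j) * g l k
      = (∏ i, ∏ j ∈ Finset.Ioi i, g (swap k l i) (swap k l j)) * g k l := by
  have hlt : k < l := by rw [Fin.lt_def]; omega
  have e1 : ∀ f : Fin n → Fin n → K, (∏ i, ∏ j ∈ Finset.Ioi i, f i j)
      = ∏ i, ∏ j, if i < j then f i j else 1 := by
    intro f
    refine Finset.prod_congr rfl fun i _ => ?_
    rw [← Finset.prod_filter]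
    congr 1; ext j; simp
  have e2 : (∏ i, ∏ j, if i < j then g (swap k l i) (swap k l j) else 1)
      = ∏ i, ∏ j, if swap k l i < swap k l j then g i j else 1 := by
    rw [← Equiv.prod_comp (swap k l)]
    refine Finset.prod_congr rfl fun i _ => ?_
    rw [← Equiv.prod_comp (swap k l)]
    simp
  have e3 : ∀ p q : Fin n, g p q = ∏ i, ∏ j, if i = p ∧ j = q then g i j else 1 := by
    intro p q
    rw [Finset.prod_eq_single p, Finset.prod_eq_single q] <;> simp +contextual
  rw [e1, e1, e2, e3 l k, e3 k l]
  simp only [← Finset.prod_mul_distrib]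
  refine Finset.prod_congr rfl fun i _ => Finset.prod_congr rfl fun j _ => ?_
  by_cases h1 : i = k ∧ j = l
  · obtain ⟨rfl, rfl⟩ := h1
    simp [hlt, hlt.ne, hlt.not_gt]
  by_cases h2 : i = l ∧ j = k
  · obtain ⟨rfl, rfl⟩ := h2
    simp [hlt, hlt.ne', hlt.not_gt]
  simp only [h1, h2, if_false, mul_one, swap_adjacent_lt_iff hkl h1 h2]

theorem qFun_adjacent {t : Fin n → K} (ht : Generic t) {k l : Fin n} (hkl : (k : ℕ) + 1 = l)
    (σ : Perm (Fin n)) :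
    qFun (t ∘ (σ * swap k l)) * (t (σ k) - t (σ l) - 1)
      = qFun (t ∘ σ) * (1 + (t (σ k) - t (σ l))) := by
  have hne : k ≠ l := by rintro rfl; omega
  have h := prod_adjacent_swap
    (fun i j => ((t ∘ σ) i - (t ∘ σ) j - 1) / ((t ∘ σ) i - (t ∘ σ) j)) hkl
  have hd := (ht (σ k) (σ l) (σ.injective.ne hne)).1
  have hd' := (ht (σ l) (σ k) (σ.injective.ne hne.symm)).1
  have e : qFun (t ∘ (σ * swap k l)) = ∏ i, ∏ j ∈ Finset.Ioi i,
      ((t ∘ σ) (swap k l i) - (t ∘ σ) (swap k l j) - 1)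
        / ((t ∘ σ) (swap k l i) - (t ∘ σ) (swap k l j)) := rfl
  rw [← e] at h
  change qFun (t ∘ σ) * _ = _ at h
  simp only [Function.comp_apply] at h
  field_simp at h
  have : (t (σ l) - t (σ k)) * (qFun (t ∘ (σ * swap k l)) * (t (σ k) - t (σ l) - 1)
      - qFun (t ∘ σ) * (1 + (t (σ k) - t (σ l)))) = 0 := by
    linear_combination -h
  exact sub_eq_zero.mp ((mul_eq_zero.mp this).resolve_left hd')

theorem qFun_ne_zero {t : Fin n → K} (ht : Generic t) : qFun t ≠ 0 := by
  refine Finset.prod_ne_zero_iff.mpr fun i _ => Finset.prod_ne_zero_iff.mpr fun j hj => ?_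
  have hne : i ≠ j := (Finset.mem_Ioi.mp hj).ne
  refine div_ne_zero (fun h => (ht j i hne.symm).2 ?_) (ht i j hne).1
  linear_combination -h

-- The polynomial ∏(X - t_l - 1) - ∏(X - t_l) has degree below n and coefficient -n at X^(n-1), and
-- its value at t_m is minus the numerator of the m-th term. Lagrange interpolation compares the
-- two.
open Polynomial in
theorem sum_prod_sub_one_div {n : ℕ} (t : Fin n → K) (ht : Generic t) :
    ∑ m, ∏ l ∈ Finset.univ.erase m, (t m - t l - 1) / (t m - t l) = (n : K) := by
  rcases Nat.eq_zero_or_pos n with rfl | hn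
  · simp
  have hinj : Set.InjOn t (Finset.univ : Finset (Fin n)) := fun i _ j _ h => by
    by_contra hne; exact ht.ne hne h
  let P : K[X] := ∏ l, (X - C (t l + 1)) - ∏ l, (X - C (t l))
  have hcard : (Finset.univ : Finset (Fin n)).card = n := by simp
  have hc : ∀ s : Fin n → K, (∏ l, (X - C (s l))).coeff (n - 1) = - ∑ l, s l := by
    intro s
    have := Polynomial.prod_X_sub_C_coeff_card_pred (Finset.univ : Finset (Fin n)) s
      (by rw [hcard]; exact hn)
    rwa [hcard] at this
  have hm : ∀ s : Fin n → K, (∏ l, (X - C (s l))).Monic := fun s =>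
    Polynomial.monic_prod_of_monic _ _ fun l _ => monic_X_sub_C _
  have hdeg : ∀ s : Fin n → K, (∏ l, (X - C (s l))).degree = (n : WithBot ℕ) := by
    intro s; rw [Polynomial.degree_prod]; simp
  have hPdeg : P.degree < n := by
    have := Polynomial.degree_sub_lt_left (p := ∏ l, (X - C (t l + 1))) (q := ∏ l, (X - C (t l)))
      (by rw [hdeg, hdeg]) (hm _).ne_zero (by rw [(hm _).leadingCoeff, (hm _).leadingCoeff])
    rwa [hdeg] at this
  have h := Lagrange.coeff_eq_sum hinj (P := P) (by rw [hcard]; exact hPdeg)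
  have hPc : P.coeff (n - 1) = -(n : K) := by
    rw [show P.coeff (n - 1) = _ from Polynomial.coeff_sub _ _ _, hc, hc, Finset.sum_add_distrib]
    simp
  rw [hcard, hPc] at h
  rw [neg_eq_iff_eq_neg.mp h, ← Finset.sum_neg_distrib]
  refine Finset.sum_congr rfl fun m _ => ?_
  have hev : P.eval (t m) = -∏ l ∈ Finset.univ.erase m, (t m - t l - 1) := by
    simp only [P, eval_sub, eval_prod, eval_X, eval_C]
    rw [← Finset.mul_prod_erase _ _ (Finset.mem_univ m),
      ← Finset.mul_prod_erase (f := fun l => t m - t l) _ (Finset.mem_univ m)]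
    simp only [sub_self, zero_mul, sub_zero, sub_add_cancel_left, neg_mul, one_mul, sub_sub]
  rw [hev, Finset.prod_div_distrib, neg_div, neg_neg]

/-- Split the permutations by the image of the first index; the remaining variables give the same
sum one size lower, whatever that image is. -/
theorem sum_qFun {n : ℕ} (t : Fin n → K) (ht : Generic t) :
    ∑ σ : Perm (Fin n), qFun (t ∘ σ) = (n.factorial : K) := by
  induction n with
  | zero => simp [qFun]
  | succ n ih =>
    have hq : ∀ s : Fin (n + 1) → K,
        qFun s = (∏ j : Fin n, (s 0 - s j.succ - 1) / (s 0 - s j.succ)) * qFun (s ∘ Fin.succ) := by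
      intro s
      simp only [qFun]
      rw [Fin.prod_univ_succ, Fin.prod_Ioi_zero]
      congr 1
      exact Finset.prod_congr rfl fun i _ => by rw [Fin.prod_Ioi_succ]; rfl
    rw [← Equiv.sum_comp Equiv.Perm.decomposeFin.symm, Fintype.sum_prod_type]
    have h1 : ∀ (p : Fin (n + 1)) (e : Perm (Fin n)),
        qFun (t ∘ Equiv.Perm.decomposeFin.symm (p, e))
          = (∏ l ∈ Finset.univ.erase p, (t p - t l - 1) / (t p - t l))
            * qFun ((fun i : Fin n => t (swap 0 p i.succ)) ∘ e) := by
      intro p e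
      rw [hq]
      congr 1
      · simp only [Function.comp_apply, Equiv.Perm.decomposeFin_symm_apply_zero,
          Equiv.Perm.decomposeFin_symm_apply_succ]
        rw [Equiv.prod_comp e (fun j : Fin n => (t p - t (swap 0 p j.succ) - 1)
          / (t p - t (swap 0 p j.succ)))]
        have := Fin.prod_univ_succ (fun l : Fin (n + 1) => if l = 0 then (1 : K) else
          (t p - t (swap 0 p l) - 1) / (t p - t (swap 0 p l)))
        simp only [if_true, one_mul, Fin.succ_ne_zero, if_false] at this
        rw [← this, ← Equiv.prod_comp (swap 0 p)]
        simp only [swap_apply_self]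
        rw [← Finset.mul_prod_erase _ _ (Finset.mem_univ p)]
        rw [if_pos (swap_apply_right 0 p), one_mul]
        refine Finset.prod_congr rfl fun l hl => ?_
        rw [if_neg]
        intro h
        exact Finset.ne_of_mem_erase hl ((swap 0 p).injective (h.trans (swap_apply_right 0 p).symm))
      · congr 1
        funext i
        simp [Equiv.Perm.decomposeFin_symm_apply_succ]
    simp only [h1]
    have h2 : ∀ p : Fin (n + 1), ∑ e : Perm (Fin n),
        qFun ((fun i : Fin n => t (swap 0 p i.succ)) ∘ e) = (n.factorial : K) := by
      intro p
      exact ih _ fun i j hij => ht _ _ ((swap 0 p).injective.ne (Fin.succ_injective n |>.ne hij))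
    simp only [← Finset.mul_sum, h2]
    rw [← Finset.sum_mul, sum_prod_sub_one_div t ht, Nat.factorial_succ]
    push_cast; ring

/-- The two ways to evaluate a pairing: by definition, as a sum over all members of the families at
two fixed points, or as a weighted sum over the orbit of the members at 1 alone. -/
theorem pairing_eq_sum [CharZero K] {t : Fin n → K} (ht : Generic t)
    {a c : Perm (Fin n) → Perm (Fin n) → K} (ha : IsFam t a) (hc : IsFam t c) :
    pairing a c = ∑ σ : Perm (Fin n), qFun (t ∘ σ) * (a 1 σ * c 1 σ) := by
  obtain ⟨δ, h1, h2, h3⟩ := exists_isFam_single t ht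
  have hpair : ∀ a c : Perm (Fin n) → Perm (Fin n) → K, IsFam t a → IsFam t c →
      pairing a c = ∑ τ, pairing (δ τ) (δ τ) * (a 1 τ * c 1 τ) := by
    intro a c ha hc
    rw [ha.eq_sum ht h1 h2, hc.eq_sum ht h1 h2, pairing_sum_left]
    refine Finset.sum_congr rfl fun τ _ => ?_
    rw [pairing_sum_right, Finset.sum_eq_single τ]
    · rw [← hc.eq_sum ht h1 h2, ← ha.eq_sum ht h1 h2]; ring
    · intro τ' _ h; rw [h3 _ _ h.symm, mul_zero]
    · simp
  have hδ : ∀ τ (k l : Fin n), (k : ℕ) + 1 = l → ∀ σ,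
      (t (σ k) - t (σ l)) * δ τ (swap k l) σ
        = (1 + (t (σ k) - t (σ l))) * (if σ * swap k l = τ then 1 else 0)
          - (if σ = τ then 1 else 0) := by
    intro τ k l hkl σ
    have := h1 τ k l hkl 1 σ
    rw [mul_one, h2, h2] at this
    linear_combination -this
  -- Adjointness of right translation by an adjacent transposition compares neighbouring diagonal
  -- coefficients; the ratio is the one in `qFun_adjacent`.
  have step : ∀ τ (k l : Fin n), (k : ℕ) + 1 = l →
      pairing (δ (τ * swap k l)) (δ (τ * swap k l)) * (t (τ k) - t (τ l) - 1)
        = pairing (δ τ) (δ τ) * (1 + (t (τ k) - t (τ l))) := by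
    intro τ k l hkl
    have hne : k ≠ l := by rintro rfl; omega
    have hs : swap k l ≠ 1 := by simpa [swap_eq_one_iff] using hne
    have hττ : τ * swap k l ≠ τ := fun h => hs (mul_eq_left.mp h)
    have e := pairing_mul_right (swap k l) (δ τ) (δ (τ * swap k l))
    rw [hpair _ _ ((h1 τ).mul_right _) (h1 _), hpair _ _ (h1 _) ((h1 _).mul_right _)] at e
    simp only [h2, swap_inv, one_mul, mul_ite, mul_one, mul_zero, ite_mul, zero_mul,
      Finset.sum_ite_eq', Finset.mem_univ, if_true] at e
    have ea := hδ τ k l hkl (τ * swap k l)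
    have ec := hδ (τ * swap k l) k l hkl τ
    simp only [mul_assoc, swap_mul_self, mul_one, if_true, Perm.mul_apply, swap_apply_left,
      swap_apply_right, hττ, hττ.symm, if_false] at ea ec
    have hd := (ht _ _ (τ.injective.ne hne)).1
    have hA : (t (τ k) - t (τ l)) * δ τ (swap k l) (τ * swap k l) = t (τ k) - t (τ l) - 1 := by
      linear_combination -ea
    have hC : (t (τ k) - t (τ l)) * δ (τ * swap k l) (swap k l) τ = 1 + (t (τ k) - t (τ l)) := by
      linear_combination ec
    rw [← hA, ← hC]
    linear_combination (t (τ k) - t (τ l)) * e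
  obtain ⟨κ, hκ⟩ : ∃ κ : K, ∀ τ, pairing (δ τ) (δ τ) = κ * qFun (t ∘ τ) := by
    refine ⟨pairing (δ 1) (δ 1) / qFun t, fun τ => ?_⟩
    induction τ using adjacent_induction with
    | one => exact (div_mul_cancel₀ _ (qFun_ne_zero ht)).symm
    | mul k l hkl τ ih =>
      have hne : k ≠ l := by rintro rfl; omega
      have e := step τ k l hkl
      have e' := qFun_adjacent ht hkl τ
      have hd : t (τ k) - t (τ l) - 1 ≠ 0 := fun h =>
        (ht _ _ (τ.injective.ne hne.symm)).2 (by linear_combination -h)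
      refine mul_right_cancel₀ hd ?_
      rw [e, ih, mul_assoc, mul_assoc, e']
  -- Constant families fix the normalization: their pairing counts permutations, and the weights
  -- also add up to n!.
  have hone : κ = 1 := by
    have e := hpair _ _ (isFam_one t) (isFam_one t)
    simp only [hκ, mul_one, ← Finset.mul_sum, sum_qFun t ht] at e
    have hf : ((n.factorial : ℕ) : K) ≠ 0 := Nat.cast_ne_zero.mpr n.factorial_ne_zero
    refine mul_right_cancel₀ hf ?_
    rw [← e, pairing]
    simp [Fintype.card_perm]
  rw [hpair a c ha hc]
  simp only [hκ, hone, one_mul]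

end Families

/-! ### Six-vertex partition functions -/

section SixVertex

variable {K : Type*} [Field K] {N : Type*} [AddCommGroup N] [Module K N]

/-- The entry `(a, b)` of the monodromy matrix with spectral parameter `t` along sites with
inhomogeneities `w`, acting on functions of the states of the sites. -/
def siteOp : {m : ℕ} → (w : Fin m → K) → (t : K) → (a b : Bool) → ((Fin m → Bool) → N) →
    (Fin m → Bool) → N
  | 0, _, _, a, b, X => fun κ => if a = b then X κ else 0
  | m + 1, w, t, a, b, X => fun κ =>
      siteOp (Fin.init w) t a b (fun κ' => X (Fin.snoc κ' (κ (Fin.last m)))) (Fin.init κ)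
        + (t - w (Fin.last m))⁻¹ •
          siteOp (Fin.init w) t (κ (Fin.last m)) b (fun κ' => X (Fin.snoc κ' a)) (Fin.init κ)

theorem siteOp_snoc {m : ℕ} (w : Fin m → K) (u t : K) (a b : Bool) (X : (Fin (m + 1) → Bool) → N)
    (κ : Fin m → Bool) (x : Bool) :
    siteOp (Fin.snoc w u : Fin (m + 1) → K) t a b X (Fin.snoc κ x : Fin (m + 1) → Bool)
      = siteOp w t a b (fun κ' => X (Fin.snoc κ' x)) κ
        + (t - u)⁻¹ • siteOp w t x b (fun κ' => X (Fin.snoc κ' a)) κ := by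
  simp [siteOp, Fin.init_snoc, Fin.snoc_last]

theorem siteOp_add_smul {m : ℕ} (w : Fin m → K) (t : K) (a b : Bool) (r : K)
    (X Y : (Fin m → Bool) → N) (κ : Fin m → Bool) :
    siteOp w t a b (fun κ' => X κ' + r • Y κ') κ
      = siteOp w t a b X κ + r • siteOp w t a b Y κ := by
  induction m generalizing a b with
  | zero => simp only [siteOp]; split_ifs <;> simp
  | succ m ih => simp only [siteOp, ih]; module

theorem siteOp_zero {m : ℕ} (w : Fin m → K) (t : K) (a b : Bool) (κ : Fin m → Bool) :
    siteOp w t a b (fun _ => (0 : N)) κ = 0 := by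
  have h := siteOp_add_smul w t a b (-1) (fun _ => (0 : N)) (fun _ => 0) κ
  simpa using h

theorem siteOp_add {m : ℕ} (w : Fin m → K) (t : K) (a b : Bool)
    (X Y : (Fin m → Bool) → N) (κ : Fin m → Bool) :
    siteOp w t a b (fun κ' => X κ' + Y κ') κ
      = siteOp w t a b X κ + siteOp w t a b Y κ := by
  simpa using siteOp_add_smul w t a b 1 X Y κ

theorem siteOp_smul {m : ℕ} (w : Fin m → K) (t : K) (a b : Bool) (r : K)
    (X : (Fin m → Bool) → N) (κ : Fin m → Bool) :
    siteOp w t a b (fun κ' => r • X κ') κ = r • siteOp w t a b X κ := by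
  simpa [siteOp_zero] using siteOp_add_smul w t a b r (fun _ => 0) X κ

theorem siteOp_sum {m : ℕ} {ι : Type*} (s : Finset ι) (w : Fin m → K) (t : K) (a b : Bool)
    (X : ι → (Fin m → Bool) → N) (κ : Fin m → Bool) :
    siteOp w t a b (fun κ' => ∑ i ∈ s, X i κ') κ = ∑ i ∈ s, siteOp w t a b (X i) κ := by
  classical
  induction s using Finset.induction_on with
  | empty => simpa using siteOp_zero w t a b κ
  | insert i s hi ih => simp only [Finset.sum_insert hi, siteOp_add, ih]

theorem snoc_comp_swap_castSucc {α : Type*} {m : ℕ} (f : Fin m → α) (x : α) (k l : Fin m) :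
    (Fin.snoc f x : Fin (m + 1) → α) ∘ swap k.castSucc l.castSucc
      = (Fin.snoc (f ∘ swap k l) x : Fin (m + 1) → α) := by
  funext i
  induction i using Fin.lastCases with
  | last =>
    rw [Function.comp_apply, swap_apply_of_ne_of_ne (Fin.castSucc_lt_last k).ne'
      (Fin.castSucc_lt_last l).ne', Fin.snoc_last, Fin.snoc_last]
  | cast i =>
    rw [Function.comp_apply, ← Function.Injective.map_swap (Fin.castSucc_injective m),
      Fin.snoc_castSucc, Fin.snoc_castSucc, Function.comp_apply]

theorem snoc_snoc_comp_swap {α : Type*} {m : ℕ} (f : Fin m → α) (x y : α) :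
    (Fin.snoc (Fin.snoc f x : Fin (m + 1) → α) y : Fin (m + 2) → α)
        ∘ swap (Fin.last m).castSucc (Fin.last (m + 1))
      = (Fin.snoc (Fin.snoc f y : Fin (m + 1) → α) x : Fin (m + 2) → α) := by
  funext i
  induction i using Fin.lastCases with
  | last => simp
  | cast i =>
    induction i using Fin.lastCases with
    | last => simp
    | cast i =>
      rw [Function.comp_apply, swap_apply_of_ne_of_ne]
      · simp
      · exact fun h => (Fin.castSucc_lt_last i).ne (Fin.castSucc_injective _ h)
      · exact (Fin.castSucc_lt_last _).ne

/-- Matches the recursions that peel off the last site: an adjacent pair either consists of the last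
two sites or survives removal of the last one. -/
theorem adjacent_snoc_cases {motive : (m : ℕ) → Fin m → Fin m → Prop}
    (top : ∀ m : ℕ, motive (m + 2) (Fin.last m).castSucc (Fin.last (m + 1)))
    (step : ∀ (m : ℕ) (k l : Fin m), (k : ℕ) + 1 = l → motive m k l →
      motive (m + 1) k.castSucc l.castSucc)
    (m : ℕ) (k l : Fin m) (hkl : (k : ℕ) + 1 = l) : motive m k l := by
  induction m with
  | zero => exact k.elim0
  | succ m ih =>
    induction l using Fin.lastCases with
    | last =>
      cases m with
      | zero => exfalso; simp at hkl
      | succ m =>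
        have : k = (Fin.last m).castSucc := Fin.ext (by simpa using hkl)
        subst this
        exact top m
    | cast l =>
      induction k using Fin.lastCases with
      | last => exfalso; have := l.2; simp at hkl; omega
      | cast k => exact step m k l (by simpa using hkl) (ih k l (by simpa using hkl))

/-- The Yang-Baxter equation for one auxiliary line crossing two neighbouring sites. -/
theorem siteOp_exchange {m : ℕ} (k l : Fin m) (hkl : (k : ℕ) + 1 = l) (w : Fin m → K) (t : K)
    (hw : ∀ i, t - w i ≠ 0) (a b : Bool) (X : (Fin m → Bool) → K) (κ : Fin m → Bool) :
    siteOp (w ∘ swap k l) t a b (fun κ' => X κ' + (w k - w l) * X (κ' ∘ swap k l)) κ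
      = siteOp w t a b X κ + (w k - w l) * siteOp w t a b X (κ ∘ swap k l) := by
  revert w a b X κ
  refine adjacent_snoc_cases (motive := fun m k l => ∀ (w : Fin m → K), (∀ i, t - w i ≠ 0) →
    ∀ (a b : Bool) (X : (Fin m → Bool) → K) (κ : Fin m → Bool),
    siteOp (w ∘ swap k l) t a b (fun κ' => X κ' + (w k - w l) * X (κ' ∘ swap k l)) κ
      = siteOp w t a b X κ + (w k - w l) * siteOp w t a b X (κ ∘ swap k l)) ?_ ?_ m k l hkl
  · intro m w hw a b X κ
    obtain ⟨w', u, v, rfl⟩ : ∃ (w' : Fin m → K) (u v : K),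
        w = (Fin.snoc (Fin.snoc w' u : Fin (m + 1) → K) v : Fin (m + 2) → K) :=
      ⟨Fin.init (Fin.init w), Fin.init w (Fin.last m), w (Fin.last (m + 1)), by simp⟩
    obtain ⟨κ', x, y, rfl⟩ : ∃ (κ' : Fin m → Bool) (x y : Bool),
        κ = (Fin.snoc (Fin.snoc κ' x : Fin (m + 1) → Bool) y : Fin (m + 2) → Bool) :=
      ⟨Fin.init (Fin.init κ), Fin.init κ (Fin.last m), κ (Fin.last (m + 1)), by simp⟩
    have hu : t - u ≠ 0 := by simpa using hw (Fin.last m).castSucc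
    have hv : t - v ≠ 0 := by simpa using hw (Fin.last (m + 1))
    -- The only rational identity behind the Yang-Baxter equation for R-matrices of the form 1 plus
    -- a multiple of a permutation.
    have hr : (t - u)⁻¹ - (t - v)⁻¹ = (u - v) * (t - u)⁻¹ * (t - v)⁻¹ := by
      field_simp; ring
    simp only [snoc_snoc_comp_swap, siteOp_snoc, Fin.snoc_last, Fin.snoc_castSucc]
    simp only [← smul_eq_mul (u - v), siteOp_add_smul]
    simp only [smul_eq_mul]
    linear_combination
      (-siteOp w' t x b (fun κ' => X (Fin.snoc (Fin.snoc κ' a : Fin (m + 1) → Bool) y)) κ'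
        + siteOp w' t y b (fun κ' => X (Fin.snoc (Fin.snoc κ' x : Fin (m + 1) → Bool) a)) κ') * hr
  · intro m k l _ ih w hw a b X κ
    obtain ⟨w', u, rfl⟩ : ∃ (w' : Fin m → K) (u : K), w = (Fin.snoc w' u : Fin (m + 1) → K) :=
      ⟨Fin.init w, w (Fin.last m), by simp⟩
    obtain ⟨κ', x, rfl⟩ : ∃ (κ' : Fin m → Bool) (x : Bool),
        κ = (Fin.snoc κ' x : Fin (m + 1) → Bool) := ⟨Fin.init κ, κ (Fin.last m), by simp⟩
    have hw' : ∀ i, t - w' i ≠ 0 := fun i => by simpa using hw i.castSucc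
    simp only [snoc_comp_swap_castSucc, siteOp_snoc, Fin.snoc_castSucc, ih w' hw', smul_eq_mul]
    ring

/-- The RTT relation for two auxiliary lines, built up site by site. -/
theorem siteOp_comm {m : ℕ} (w : Fin m → K) (t t' : K) (hw : ∀ i, t - w i ≠ 0)
    (hw' : ∀ i, t' - w i ≠ 0) (a b a' b' : Bool) (X : (Fin m → Bool) → K) (κ : Fin m → Bool) :
    (t - t') * siteOp w t a b (siteOp w t' a' b' X) κ + siteOp w t a' b (siteOp w t' a b' X) κ
      = (t - t') * siteOp w t' a' b' (siteOp w t a b X) κ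
        + siteOp w t' a' b (siteOp w t a b' X) κ := by
  induction m generalizing a b a' b' with
  | zero =>
    simp only [siteOp]
    cases a <;> cases b <;> cases a' <;> cases b' <;> simp
  | succ m ih =>
    obtain ⟨w', u, rfl⟩ : ∃ (w' : Fin m → K) (u : K), w = (Fin.snoc w' u : Fin (m + 1) → K) :=
      ⟨Fin.init w, w (Fin.last m), by simp⟩
    obtain ⟨κ', x, rfl⟩ : ∃ (κ' : Fin m → Bool) (x : Bool),
        κ = (Fin.snoc κ' x : Fin (m + 1) → Bool) := ⟨Fin.init κ, κ (Fin.last m), by simp⟩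
    have h1 : ∀ i, t - w' i ≠ 0 := fun i => by simpa using hw i.castSucc
    have h1' : ∀ i, t' - w' i ≠ 0 := fun i => by simpa using hw' i.castSucc
    have hu : t - u ≠ 0 := by simpa using hw (Fin.last m)
    have hu' : t' - u ≠ 0 := by simpa using hw' (Fin.last m)
    have hr : (t' - u)⁻¹ - (t - u)⁻¹ = (t - t') * (t - u)⁻¹ * (t' - u)⁻¹ := by
      field_simp; ring
    simp only [siteOp_snoc, siteOp_add_smul]
    simp only [smul_eq_mul]
    have i1 := ih w' h1 h1' a b a' b' (fun κ' => X (Fin.snoc κ' x)) κ'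
    have i2 := ih w' h1 h1' a b x b' (fun κ' => X (Fin.snoc κ' a')) κ'
    have i3 := ih w' h1 h1' x b a' b' (fun κ' => X (Fin.snoc κ' a)) κ'
    have i4 := ih w' h1 h1' a' b x b' (fun κ' => X (Fin.snoc κ' a)) κ'
    have i5 := ih w' h1 h1' x b a b' (fun κ' => X (Fin.snoc κ' a')) κ'
    set M := fun (p q p' q' : Bool) (Y : (Fin m → Bool) → K) =>
      siteOp w' t p q (siteOp w' t' p' q' Y) κ' with hM
    set M' := fun (p q p' q' : Bool) (Y : (Fin m → Bool) → K) =>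
      siteOp w' t' p q (siteOp w' t p' q' Y) κ' with hM'
    linear_combination i1 + (t' - u)⁻¹ * i2 + (t - u)⁻¹ * i3 + (t - u)⁻¹ * (t' - u)⁻¹ * i4
      + (-M x b a b' (fun κ' => X (Fin.snoc κ' a'))
          + M a' b x b' (fun κ' => X (Fin.snoc κ' a))) * hr

/-- On the empty state a line can exchange at most one excitation. In the last case the line enters
as `true` and leaves as `false`, so it deposits its excitation at some site `k`, after having
crossed the sites above `k` without a choice. -/
theorem siteOp_empty {m : ℕ} (w : Fin m → K) (t : K) (X : (Fin m → Bool) → K) :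
    siteOp w t false true X (fun _ => false) = 0 ∧
    siteOp w t true true X (fun _ => false) = X (fun _ => false) ∧
    siteOp w t false false X (fun _ => false)
      = (∏ l, (1 + (t - w l)⁻¹)) * X (fun _ => false) ∧
    siteOp w t true false X (fun _ => false)
      = ∑ k, (t - w k)⁻¹ * (∏ l ∈ Finset.Iio k, (1 + (t - w l)⁻¹)) * X (Pi.single k true) := by
  induction m with
  | zero => simp [siteOp]
  | succ m ih =>
    obtain ⟨w', u, rfl⟩ : ∃ (w' : Fin m → K) (u : K), w = (Fin.snoc w' u : Fin (m + 1) → K) :=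
      ⟨Fin.init w, w (Fin.last m), by simp⟩
    have e : (fun _ : Fin (m + 1) => false) = (Fin.snoc (fun _ : Fin m => false) false) := by
      funext i; induction i using Fin.lastCases <;> simp
    have e1 : ∀ k : Fin m, (Fin.snoc (Pi.single k true : Fin m → Bool) false : Fin (m + 1) → Bool)
        = Pi.single k.castSucc true := by
      intro k; funext i
      induction i using Fin.lastCases with
      | last => rw [Fin.snoc_last, Pi.single_eq_of_ne (Fin.castSucc_lt_last k).ne']; rfl
      | cast i =>
        rw [Fin.snoc_castSucc]
        by_cases h : i = k
        · subst h; simp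
        · rw [Pi.single_eq_of_ne h, Pi.single_eq_of_ne fun h' => h (Fin.castSucc_injective _ h')]
    have e2 : (Fin.snoc (fun _ : Fin m => false) true : Fin (m + 1) → Bool)
        = Pi.single (Fin.last m) true := by
      funext i
      induction i using Fin.lastCases with
      | last => simp
      | cast i => rw [Fin.snoc_castSucc, Pi.single_eq_of_ne (Fin.castSucc_lt_last i).ne]; rfl
    have e3 : ∀ k : Fin m, ∏ l ∈ Finset.Iio k.castSucc, (1 + (t - (Fin.snoc w' u : Fin (m + 1) → K) l)⁻¹)
        = ∏ l ∈ Finset.Iio k, (1 + (t - w' l)⁻¹) := by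
      intro k; rw [← Fin.map_castSuccEmb_Iio, Finset.prod_map]; simp
    have e4 : ∏ l ∈ Finset.Iio (Fin.last m), (1 + (t - (Fin.snoc w' u : Fin (m + 1) → K) l)⁻¹)
        = ∏ l, (1 + (t - w' l)⁻¹) := by
      rw [Fin.Iio_last_eq_map, Finset.prod_map]; simp
    simp only [e, siteOp_snoc, Fin.prod_univ_castSucc, Fin.sum_univ_castSucc]
    refine ⟨?_, ?_, ?_, ?_⟩
    · rw [(ih w' _).1]; simp
    · rw [(ih w' _).2.1, (ih w' _).1]; simp
    · rw [(ih w' _).2.2.1]; simp; ring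
    · rw [(ih w' _).2.2.2, (ih w' _).2.2.1]
      simp only [e1, e2, e3, e4, Fin.snoc_castSucc, Fin.snoc_last, smul_eq_mul]
      ring

/-- The line and the last site carry the same state, so passing and exchanging lead to the same
configuration and their weights add. -/
theorem siteOp_snoc_true {m : ℕ} (w : Fin m → K) (u t : K) (b : Bool)
    (X : (Fin (m + 1) → Bool) → K) (κ : Fin m → Bool) :
    siteOp (Fin.snoc w u : Fin (m + 1) → K) t true b X (Fin.snoc κ true : Fin (m + 1) → Bool)
      = (1 + (t - u)⁻¹) * siteOp w t true b (fun κ' => X (Fin.snoc κ' true)) κ := by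
  rw [siteOp_snoc, smul_eq_mul]; ring

/-- The number of sites in the state `true`. -/
def countTrue {m : ℕ} (κ : Fin m → Bool) : ℤ := ∑ i, if κ i then 1 else 0

theorem countTrue_snoc {m : ℕ} (κ : Fin m → Bool) (x : Bool) :
    countTrue (Fin.snoc κ x : Fin (m + 1) → Bool) = countTrue κ + if x then 1 else 0 := by
  simp only [countTrue, Fin.sum_univ_castSucc, Fin.snoc_castSucc, Fin.snoc_last]

/-- Excitations are conserved (the ice rule), so a factor depending only on their number leaves the
operator with a shifted argument. -/
theorem siteOp_smul_count {m : ℕ} (w : Fin m → K) (t : K) (a b : Bool) (X : (Fin m → Bool) → K)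
    (ε : ℤ → N) (κ : Fin m → Bool) :
    siteOp w t a b (fun κ' => X κ' • ε (countTrue κ')) κ
      = siteOp w t a b X κ • ε (countTrue κ + (if a then 1 else 0) - if b then 1 else 0) := by
  induction m generalizing a b ε with
  | zero =>
    simp only [siteOp]
    by_cases h : a = b
    · subst h; simp
    · simp [h]
  | succ m ih =>
    obtain ⟨w', u, rfl⟩ : ∃ (w' : Fin m → K) (u : K), w = (Fin.snoc w' u : Fin (m + 1) → K) :=
      ⟨Fin.init w, w (Fin.last m), by simp⟩
    obtain ⟨κ', x, rfl⟩ : ∃ (κ' : Fin m → Bool) (x : Bool),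
        κ = (Fin.snoc κ' x : Fin (m + 1) → Bool) := ⟨Fin.init κ, κ (Fin.last m), by simp⟩
    simp only [siteOp_snoc, countTrue_snoc]
    rw [ih w' _ _ _ (fun z => ε (z + if x then 1 else 0)),
      ih w' _ _ _ (fun z => ε (z + if a then 1 else 0)), add_smul, smul_eq_mul, mul_smul]
    congr 3
    · ring_nf
    · ring_nf

theorem countTrue_succ {n : ℕ} (b : Fin (n + 1) → Bool) :
    countTrue b = (if b 0 then 1 else 0) + countTrue (Fin.tail b) :=
  Fin.sum_univ_succ _

/-- The product of the entries `(true, b_k)` of monodromy matrices with parameters `t_k`. -/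
def chainOp {m : ℕ} (w : Fin m → K) : {n : ℕ} → (t : Fin n → K) → (b : Fin n → Bool) →
    ((Fin m → Bool) → N) → (Fin m → Bool) → N
  | 0, _, _, X => X
  | _ + 1, t, b, X => siteOp w (t 0) true (b 0) (chainOp w (Fin.tail t) (Fin.tail b) X)

theorem chainOp_smul_count {m n : ℕ} (w : Fin m → K) (t : Fin n → K) (b : Fin n → Bool)
    (X : (Fin m → Bool) → K) (ε : ℤ → N) (κ : Fin m → Bool) :
    chainOp w t b (fun κ' => X κ' • ε (countTrue κ')) κ
      = chainOp w t b X κ • ε (countTrue κ + n - countTrue b) := by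
  induction n generalizing κ with
  | zero => simp [chainOp, countTrue]
  | succ n ih =>
    simp only [chainOp]
    have e : chainOp w (Fin.tail t) (Fin.tail b) (fun κ' => X κ' • ε (countTrue κ'))
        = fun κ => chainOp w (Fin.tail t) (Fin.tail b) X κ
            • (fun z => ε (z + n - countTrue (Fin.tail b))) (countTrue κ) :=
      funext fun κ => ih _ _ κ
    rw [e, siteOp_smul_count w (t 0) true (b 0) (chainOp w (Fin.tail t) (Fin.tail b) X)
      (fun z => ε (z + n - countTrue (Fin.tail b)))]
    congr 2
    rw [countTrue_succ b]
    push_cast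
    simp only [if_true]
    ring

/-- The boundary weight of the states of the sites. -/
def boundaryWeight (c : K) : {m : ℕ} → (w : Fin m → K) → (κ : Fin m → Bool) → K
  | 0, _, _ => 1
  | m + 1, w, κ =>
      if κ (Fin.last m) then (w (Fin.last m) + c) * boundaryWeight c (Fin.init w) (Fin.init κ)
      else boundaryWeight (c + 1) (Fin.init w) (Fin.init κ)

theorem boundaryWeight_snoc (c : K) {m : ℕ} (w : Fin m → K) (u : K) (κ : Fin m → Bool) (x : Bool) :
    boundaryWeight c (Fin.snoc w u : Fin (m + 1) → K) (Fin.snoc κ x : Fin (m + 1) → Bool)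
      = if x then (u + c) * boundaryWeight c w κ else boundaryWeight (c + 1) w κ := by
  simp [boundaryWeight]

/-- A site in state `true` contributes its parameter plus `c` plus the number of `false` sites after
it. For two neighbours this is a check of four cases. -/
theorem boundaryWeight_exchange (c : K) {m : ℕ} (k l : Fin m) (hkl : (k : ℕ) + 1 = l)
    (w : Fin m → K) (κ : Fin m → Bool) :
    (1 + (w k - w l)) * boundaryWeight c (w ∘ swap k l) κ
      = boundaryWeight c w κ + (w k - w l) * boundaryWeight c w (κ ∘ swap k l) := by
  revert c w κ
  refine adjacent_snoc_cases (motive := fun m k l => ∀ (c : K) (w : Fin m → K) (κ : Fin m → Bool),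
    (1 + (w k - w l)) * boundaryWeight c (w ∘ swap k l) κ
      = boundaryWeight c w κ + (w k - w l) * boundaryWeight c w (κ ∘ swap k l)) ?_ ?_ m k l hkl
  · intro m c w κ
    obtain ⟨w', u, v, rfl⟩ : ∃ (w' : Fin m → K) (u v : K),
        w = (Fin.snoc (Fin.snoc w' u : Fin (m + 1) → K) v : Fin (m + 2) → K) :=
      ⟨Fin.init (Fin.init w), Fin.init w (Fin.last m), w (Fin.last (m + 1)), by simp⟩
    obtain ⟨κ', x, y, rfl⟩ : ∃ (κ' : Fin m → Bool) (x y : Bool),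
        κ = (Fin.snoc (Fin.snoc κ' x : Fin (m + 1) → Bool) y : Fin (m + 2) → Bool) :=
      ⟨Fin.init (Fin.init κ), Fin.init κ (Fin.last m), κ (Fin.last (m + 1)), by simp⟩
    simp only [snoc_snoc_comp_swap, boundaryWeight_snoc, Fin.snoc_last, Fin.snoc_castSucc]
    cases x <;> cases y <;> simp <;> ring
  · intro m k l _ ih c w κ
    obtain ⟨w', u, rfl⟩ : ∃ (w' : Fin m → K) (u : K), w = (Fin.snoc w' u : Fin (m + 1) → K) :=
      ⟨Fin.init w, w (Fin.last m), by simp⟩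
    obtain ⟨κ', x, rfl⟩ : ∃ (κ' : Fin m → Bool) (x : Bool),
        κ = (Fin.snoc κ' x : Fin (m + 1) → Bool) := ⟨Fin.init κ, κ (Fin.last m), by simp⟩
    simp only [snoc_comp_swap_castSucc, boundaryWeight_snoc, Fin.snoc_castSucc]
    have h1 := ih c w' κ'
    have h2 := ih (c + 1) w' κ'
    cases x
    · simpa using h2
    · simp only [if_true]; linear_combination (u + c) * h1

/-- The relation for the boundary weight is carried through the rows one at a time by
`siteOp_exchange`. It is the `IsFam` relation in the parameters of the sites. -/
theorem chainOp_exchange {m n : ℕ} (c : K) (k l : Fin m) (hkl : (k : ℕ) + 1 = l) (w : Fin m → K)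
    (t : Fin n → K) (hw : ∀ j i, t j - w i ≠ 0) (b : Fin n → Bool) (κ : Fin m → Bool) :
    (1 + (w k - w l)) * chainOp (w ∘ swap k l) t b (boundaryWeight c (w ∘ swap k l)) κ
      = chainOp w t b (boundaryWeight c w) κ
        + (w k - w l) * chainOp w t b (boundaryWeight c w) (κ ∘ swap k l) := by
  induction n generalizing κ with
  | zero => exact boundaryWeight_exchange c k l hkl w κ
  | succ n ih =>
    simp only [chainOp]
    rw [← siteOp_exchange k l hkl w (t 0) (hw 0), ← smul_eq_mul, ← siteOp_smul]
    congr 1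
    funext κ'
    exact ih (Fin.tail t) (fun j i => hw j.succ i) (Fin.tail b) κ'

/-- All rows enter as `true`, so a last site in state `true` is frozen and splits off as a scalar.
-/
theorem chainOp_snoc_true {m n : ℕ} (c : K) (w : Fin m → K) (u : K) (t : Fin n → K)
    (b : Fin n → Bool) (κ : Fin m → Bool) :
    chainOp (Fin.snoc w u : Fin (m + 1) → K) t b
        (boundaryWeight c (Fin.snoc w u : Fin (m + 1) → K)) (Fin.snoc κ true : Fin (m + 1) → Bool)
      = (∏ l, (1 + (t l - u)⁻¹)) * (u + c) * chainOp w t b (boundaryWeight c w) κ := by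
  induction n generalizing κ with
  | zero => simp [chainOp, boundaryWeight_snoc]
  | succ n ih =>
    simp only [chainOp]
    rw [siteOp_snoc_true, Fin.prod_univ_succ]
    have e : (fun κ' => chainOp (Fin.snoc w u : Fin (m + 1) → K) (Fin.tail t) (Fin.tail b)
          (boundaryWeight c (Fin.snoc w u : Fin (m + 1) → K)) (Fin.snoc κ' true))
        = fun κ' => ((∏ l, (1 + (Fin.tail t l - u)⁻¹)) * (u + c)) •
            chainOp w (Fin.tail t) (Fin.tail b) (boundaryWeight c w) κ' :=
      funext fun κ' => ih _ _ κ'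
    rw [e, siteOp_smul, smul_eq_mul]
    simp only [Fin.tail]
    ring

theorem tail_comp_swap_zero {α : Type*} {n : ℕ} (f : Fin (n + 2) → α) :
    (f ∘ swap 0 1) 0 = f 1 ∧ Fin.tail (f ∘ swap 0 1) 0 = f 0 ∧
      Fin.tail (Fin.tail (f ∘ swap 0 1)) = Fin.tail (Fin.tail f) := by
  refine ⟨by simp, by simp [Fin.tail], ?_⟩
  funext i
  simp only [Fin.tail, Function.comp_apply]
  rw [swap_apply_of_ne_of_ne (Fin.succ_ne_zero _)]
  rw [← Fin.succ_zero_eq_one]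
  exact fun h => Fin.succ_ne_zero _ (Fin.succ_injective _ h)

theorem tail_comp_swap_succ {α : Type*} {n : ℕ} (f : Fin (n + 1) → α) (k l : Fin n) :
    (f ∘ swap k.succ l.succ) 0 = f 0 ∧
      Fin.tail (f ∘ swap k.succ l.succ) = Fin.tail f ∘ swap k l := by
  constructor
  · rw [Function.comp_apply, swap_apply_of_ne_of_ne (Fin.succ_ne_zero _).symm
      (Fin.succ_ne_zero _).symm]
  · funext i
    simp only [Fin.tail, Function.comp_apply]
    rw [← Function.Injective.map_swap (Fin.succ_injective n)]

theorem chainOp_comm {m n : ℕ} (w : Fin m → K) (t : Fin n → K) (hw : ∀ j i, t j - w i ≠ 0)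
    (k l : Fin n) (hkl : (k : ℕ) + 1 = l) (b : Fin n → Bool) (X : (Fin m → Bool) → K)
    (κ : Fin m → Bool) :
    (1 + (t k - t l)) * chainOp w t b X κ
      = chainOp w (t ∘ swap k l) b X κ
        + (t k - t l) * chainOp w (t ∘ swap k l) (b ∘ swap k l) X κ := by
  induction n generalizing κ with
  | zero => exact k.elim0
  | succ n ih =>
    induction k using Fin.cases with
    | zero =>
      cases n with
      | zero => exfalso; have := l.2; simp at hkl
      | succ n =>
        have hl : l = 1 := Fin.ext (by simpa using hkl.symm)
        subst hl
        simp only [chainOp, (tail_comp_swap_zero t).1, (tail_comp_swap_zero t).2.1,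
          (tail_comp_swap_zero t).2.2, (tail_comp_swap_zero b).1, (tail_comp_swap_zero b).2.1,
          (tail_comp_swap_zero b).2.2]
        rw [show Fin.tail t 0 = t 1 from rfl, show Fin.tail b 0 = b 1 from rfl]
        have h := siteOp_comm w (t 0) (t 1) (hw 0) (hw 1) true (b 0) true (b 1)
          (chainOp w (Fin.tail (Fin.tail t)) (Fin.tail (Fin.tail b)) X) κ
        linear_combination h
    | succ k =>
      induction l using Fin.cases with
      | zero => exfalso; simp at hkl
      | succ l =>
        simp only [chainOp, (tail_comp_swap_succ t k l).1, (tail_comp_swap_succ t k l).2,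
          (tail_comp_swap_succ b k l).1, (tail_comp_swap_succ b k l).2]
        rw [← smul_eq_mul, ← siteOp_smul, ← smul_eq_mul (t k.succ - t l.succ), ← siteOp_add_smul]
        congr 1
        funext κ'
        simp only [smul_eq_mul]
        exact ih (Fin.tail t) (fun j i => hw j.succ i) k l (by simpa using hkl) (Fin.tail b) κ'

end SixVertex

/-! ### Partition functions as modified symmetrizations -/

section Symmetrization

variable {K : Type*} [Field K]

theorem qFun_snoc {m : ℕ} (s : Fin (m + 1) → K) :
    qFun s = (∏ i : Fin m, (s i.castSucc - s (Fin.last m) - 1) / (s i.castSucc - s (Fin.last m)))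
      * qFun (Fin.init s) := by
  have e1 : ∀ {n : ℕ} (f : Fin n → Fin n → K), (∏ i, ∏ j ∈ Finset.Ioi i, f i j)
      = ∏ i, ∏ j, if i < j then f i j else 1 := by
    intro n f
    refine Finset.prod_congr rfl fun i _ => ?_
    rw [← Finset.prod_filter]
    congr 1; ext j; simp
  unfold qFun
  rw [e1, e1, Fin.prod_univ_castSucc]
  have e2 : ∀ j : Fin m, ¬ Fin.last m < j.castSucc := fun j => (Fin.castSucc_lt_last j).not_gt
  simp only [Fin.prod_univ_castSucc, Fin.castSucc_lt_last, if_true, Fin.castSucc_lt_castSucc_iff,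
    e2, if_false, lt_irrefl, Finset.prod_const_one, mul_one, Finset.prod_mul_distrib]
  rw [mul_comm]
  rfl

/-- A permutation of all but the last index. -/
def extendLast {m : ℕ} (ρ : Perm (Fin m)) : Perm (Fin (m + 1)) :=
  finSuccEquivLast.symm.permCongr (Equiv.optionCongr ρ)

theorem extendLast_castSucc {m : ℕ} (ρ : Perm (Fin m)) (i : Fin m) :
    extendLast ρ i.castSucc = (ρ i).castSucc := by
  simp [extendLast, Equiv.permCongr_apply]

theorem extendLast_last {m : ℕ} (ρ : Perm (Fin m)) : extendLast ρ (Fin.last m) = Fin.last m := by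
  simp [extendLast, Equiv.permCongr_apply]

theorem Generic.init {m : ℕ} {w : Fin (m + 1) → K} (hw : Generic w) : Generic (Fin.init w) :=
  fun _ _ h => hw _ _ (Fin.castSucc_injective m |>.ne h)

/-- Inner permutations can be absorbed in the outer sum, because the part of the weight involving
the last variable is symmetric in the others. What is left of the inner sum is the total weight m!
from `sum_qFun`. -/
theorem sum_symBar_init {m : ℕ} (w : Fin (m + 1) → K) (hw : Generic w) (h : K → K)
    (g : (Fin m → K) → K) :
    ∑ σ : Perm (Fin (m + 1)), qFun (w ∘ σ) * (h (w (σ (Fin.last m)))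
        * symBar g (Fin.init (w ∘ σ)))
      = (m.factorial : K) * ∑ σ : Perm (Fin (m + 1)), qFun (w ∘ σ) * (h (w (σ (Fin.last m)))
        * g (Fin.init (w ∘ σ))) := by
  have hext : ∀ (s : Fin (m + 1) → K) (ρ : Perm (Fin m)),
      Fin.init (s ∘ extendLast ρ) = Fin.init s ∘ ρ := by
    intro s ρ; funext i
    simp [Fin.init, extendLast_castSucc]
  have hq : ∀ (s : Fin (m + 1) → K) (ρ : Perm (Fin m)),
      (∏ i : Fin m, ((s ∘ extendLast ρ) i.castSucc - (s ∘ extendLast ρ) (Fin.last m) - 1)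
        / ((s ∘ extendLast ρ) i.castSucc - (s ∘ extendLast ρ) (Fin.last m)))
      = ∏ i : Fin m, (s i.castSucc - s (Fin.last m) - 1) / (s i.castSucc - s (Fin.last m)) := by
    intro s ρ
    simp only [Function.comp_apply, extendLast_last, extendLast_castSucc]
    exact Equiv.prod_comp ρ fun i : Fin m =>
      (s i.castSucc - s (Fin.last m) - 1) / (s i.castSucc - s (Fin.last m))
  set q : (Fin (m + 1) → K) → K := fun s =>
    ∏ i : Fin m, (s i.castSucc - s (Fin.last m) - 1) / (s i.castSucc - s (Fin.last m)) with hqdef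
  have hq' : ∀ s, qFun s = q s * qFun (Fin.init s) := qFun_snoc
  have step : ∀ ρ : Perm (Fin m), ∑ σ : Perm (Fin (m + 1)), qFun (w ∘ σ) *
        (h (w (σ (Fin.last m))) * (g (Fin.init (w ∘ σ) ∘ ρ) * qFun (Fin.init (w ∘ σ) ∘ ρ)))
      = ∑ σ : Perm (Fin (m + 1)), q (w ∘ σ) * qFun (Fin.init (w ∘ σ) ∘ ⇑ρ⁻¹) *
        (h (w (σ (Fin.last m))) * (g (Fin.init (w ∘ σ)) * qFun (Fin.init (w ∘ σ)))) := by
    intro ρ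
    rw [← Equiv.sum_comp (Equiv.mulRight (extendLast ρ))
      (fun σ : Perm (Fin (m + 1)) => q (w ∘ σ) * qFun (Fin.init (w ∘ σ) ∘ ⇑ρ⁻¹) *
        (h (w (σ (Fin.last m))) * (g (Fin.init (w ∘ σ)) * qFun (Fin.init (w ∘ σ)))))]
    refine Finset.sum_congr rfl fun σ _ => ?_
    have e : w ∘ ⇑((Equiv.mulRight (extendLast ρ)) σ) = (w ∘ σ) ∘ extendLast ρ := rfl
    have e' : (Fin.init (w ∘ σ) ∘ ⇑ρ) ∘ ⇑ρ⁻¹ = Fin.init (w ∘ σ) := by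
      funext i; simp
    have e'' : (Equiv.mulRight (extendLast ρ)) σ (Fin.last m) = σ (Fin.last m) := by
      simp [extendLast_last]
    have e3 : q ((w ∘ σ) ∘ extendLast ρ) = q (w ∘ σ) := hq _ ρ
    rw [e, e'', hext, e', hq' (w ∘ σ), e3]
  calc _ = ∑ ρ : Perm (Fin m), ∑ σ : Perm (Fin (m + 1)), qFun (w ∘ σ) *
        (h (w (σ (Fin.last m))) * (g (Fin.init (w ∘ σ) ∘ ρ) * qFun (Fin.init (w ∘ σ) ∘ ρ))) := by
        rw [Finset.sum_comm]
        simp only [symBar, sym, Finset.mul_sum]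
    _ = _ := by
        simp only [step]
        rw [Finset.sum_comm, Finset.mul_sum]
        refine Finset.sum_congr rfl fun σ _ => ?_
        have hs := sum_qFun (Fin.init (w ∘ σ)) (hw.comp σ).init
        rw [← Equiv.sum_comp (Equiv.inv (Perm (Fin m)))] at hs
        simp only [Equiv.inv_apply] at hs
        rw [← hs, hq', Finset.sum_mul]
        refine Finset.sum_congr rfl fun ρ _ => ?_
        ring

/-- The number of `false` values. -/
def countFalse {n : ℕ} (b : Fin n → Bool) : ℕ := ∑ i, if b i then 0 else 1

theorem countFalse_succ {n : ℕ} (b : Fin (n + 1) → Bool) :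
    countFalse b = (if b 0 then 0 else 1) + countFalse (Fin.tail b) :=
  Fin.sum_univ_succ _

/-- The function whose modified symmetrization is the six-vertex partition function with boundary
weight given by `c`. -/
def chainFun (c : K) : {n m : ℕ} → (t : Fin n → K) → (b : Fin n → Bool) → (s : Fin m → K) → K
  | 0, _, _, _, _ => 1
  | _ + 1, 0, t, b, s => if b 0 then chainFun c (Fin.tail t) (Fin.tail b) s else 0
  | n + 1, m + 1, t, b, s =>
      if b 0 then chainFun c (Fin.tail t) (Fin.tail b) s
      else (s (Fin.last m) + c) * (t 0 - s (Fin.last m))⁻¹ *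
        (∏ l : Fin n, (1 + (t l.succ - s (Fin.last m))⁻¹)) *
          chainFun c (Fin.tail t) (Fin.tail b) (Fin.init s)

theorem sum_perm_apply {m : ℕ} (f : Fin (m + 1) → K) (i : Fin (m + 1)) :
    ∑ u : Perm (Fin (m + 1)), f (u i) = (m.factorial : K) * ∑ k, f k := by
  have h0 : ∀ g : Fin (m + 1) → K,
      ∑ u : Perm (Fin (m + 1)), g (u 0) = (m.factorial : K) * ∑ k, g k := by
    intro g
    rw [← Equiv.sum_comp Equiv.Perm.decomposeFin.symm, Fintype.sum_prod_type]
    simp [Equiv.Perm.decomposeFin_symm_apply_zero, Fintype.card_perm, Finset.mul_sum]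
  rw [← h0, ← Equiv.sum_comp (Equiv.mulRight (swap 0 i))]
  simp

theorem prod_Ioi_comp_swap {m : ℕ} (g : Fin m → K) {k l p : Fin m} (hkl : (k : ℕ) + 1 = l)
    (hk : p ≠ k) (hl : p ≠ l) :
    ∏ i ∈ Finset.Ioi p, g (swap k l i) = ∏ i ∈ Finset.Ioi p, g i := by
  refine Finset.prod_equiv (swap k l) (fun i => ?_) fun i _ => rfl
  rw [Finset.mem_Ioi, Finset.mem_Ioi]
  have e : swap k l p = p := swap_apply_of_ne_of_ne hk hl
  conv_rhs => rw [← e]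
  exact (swap_adjacent_lt_iff hkl (fun h => hk h.1) (fun h => hl h.1)).symm

theorem prod_Ioi_adjacent {m : ℕ} (g : Fin m → K) {k l : Fin m} (hkl : (k : ℕ) + 1 = l) :
    ∏ i ∈ Finset.Ioi k, g i = g l * ∏ i ∈ Finset.Ioi l, g i := by
  have : Finset.Ioi k = insert l (Finset.Ioi l) := by
    ext i; simp only [Finset.mem_Ioi, Finset.mem_insert, Fin.lt_def, Fin.ext_iff]; omega
  rw [this, Finset.prod_insert (by simp)]

/-- The family of one-particle weights. -/
theorem isFam_oneParticle {m : ℕ} (w : Fin m → K) (t : K) (hw : ∀ i, t - w i ≠ 0) (j : Fin m) :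
    IsFam w fun v σ => (t - w (σ (v j)))⁻¹ * ∏ i ∈ Finset.Ioi (v j), (1 + (t - w (σ i))⁻¹) := by
  intro k l hkl v σ
  have hne : k ≠ l := by rintro rfl; omega
  have hk := hw (σ k)
  have hl := hw (σ l)
  have hIl : ∏ i ∈ Finset.Ioi l, (1 + (t - w (σ (swap k l i)))⁻¹)
      = ∏ i ∈ Finset.Ioi l, (1 + (t - w (σ i))⁻¹) := by
    refine Finset.prod_congr rfl fun i hi => ?_
    rw [Finset.mem_Ioi, Fin.lt_def] at hi
    rw [swap_apply_of_ne_of_ne] <;> rintro rfl <;> omega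
  simp only [Perm.mul_apply]
  by_cases h1 : v j = k
  · rw [h1, swap_apply_left, prod_Ioi_adjacent (fun i => 1 + (t - w (σ (swap k l i)))⁻¹) hkl,
      prod_Ioi_adjacent (fun i => 1 + (t - w (σ i))⁻¹) hkl, hIl, swap_apply_right]
    field_simp
    ring
  by_cases h2 : v j = l
  · rw [h2, swap_apply_right, hIl, prod_Ioi_adjacent (fun i => 1 + (t - w (σ i))⁻¹) hkl]
    field_simp
    ring
  · rw [swap_apply_of_ne_of_ne h1 h2,
      prod_Ioi_comp_swap (fun i => 1 + (t - w (σ i))⁻¹) hkl h1 h2]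
    ring

/-- Induction on the rows. A first row leaving as `true` is trivial on the empty state. One leaving
as `false` gives a sum over the site that it excites; this sum is a pairing, and evaluating it over
the orbit leaves only terms with the last site excited, which is then frozen. -/
theorem chainOp_eq_symBar [CharZero K] (c : K) {n m : ℕ} (t : Fin n → K) (b : Fin n → Bool)
    (w : Fin m → K) (hw : Generic w) (htw : ∀ j i, t j - w i ≠ 0) :
    ((m - countFalse b).factorial : K) * chainOp w t b (boundaryWeight c w) (fun _ => false)
      = symBar (fun s : Fin m → K => chainFun c t b s) w := by
  induction n generalizing m with
  | zero =>
    have hb : ∀ (c : K) {m : ℕ} (w : Fin m → K), boundaryWeight c w (fun _ => false) = 1 := by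
      intro c m w
      induction m generalizing c with
      | zero => rfl
      | succ m ih =>
        simp only [boundaryWeight, Bool.false_eq_true, if_false]
        exact ih (c + 1) (Fin.init w)
    simp [chainOp, chainFun, symBar, sym, sum_qFun w hw, countFalse, hb]
  | succ n ih =>
    have ht' : ∀ (j : Fin n) (i : Fin m), Fin.tail t j - w i ≠ 0 := fun j i => htw j.succ i
    cases hb0 : b 0 with
    | true =>
      have e : (fun s : Fin m → K => chainFun c t b s)
          = fun s : Fin m → K => chainFun c (Fin.tail t) (Fin.tail b) s := by
        funext s
        cases m <;> simp [chainFun, hb0]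
      rw [e, ← ih (Fin.tail t) (Fin.tail b) w hw ht', countFalse_succ, hb0]
      simp only [chainOp, hb0, (siteOp_empty w (t 0) _).2.1, if_true, zero_add]
    | false =>
      cases m with
      | zero => simp [chainOp, hb0, siteOp, symBar, sym, chainFun]
      | succ m =>
        set X : (Fin (m + 1) → K) → (Fin (m + 1) → Bool) → K := fun w' =>
          chainOp w' (Fin.tail t) (Fin.tail b) (boundaryWeight c w') with hX
        -- The remaining rows, with one site excited, form a family in the position of that
        -- excitation.
        have hfam : IsFam w fun v σ => X (w ∘ σ) (Pi.single (v (Fin.last m)) true) := by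
          intro k l hkl v σ
          have h := chainOp_exchange c k l hkl (w ∘ σ) (Fin.tail t) (fun j i => ht' j (σ i))
            (Fin.tail b) (Pi.single (v (Fin.last m)) true)
          have es : (Pi.single (v (Fin.last m)) true : Fin (m + 1) → Bool) ∘ swap k l
              = Pi.single ((swap k l * v) (Fin.last m)) true := by
            funext i
            by_cases hi : swap k l i = v (Fin.last m)
            · have : i = swap k l (v (Fin.last m)) := by rw [← hi, swap_apply_self]
              subst this; simp
            · have hi' : i ≠ (swap k l * v) (Fin.last m) := by
                rintro rfl; simp at hi
              rw [Function.comp_apply, Pi.single_eq_of_ne hi, Pi.single_eq_of_ne hi']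
          rw [es] at h
          exact h
        have hp := pairing_eq_sum hw
          (isFam_oneParticle w (t 0) (htw 0) (Fin.last m)) hfam
        -- The reversal in the pairing turns the product over later sites into the product over
        -- earlier sites required by `siteOp_empty`. The factorial counts the permutations with a
        -- given image of the last index.
        have hL : pairing (fun v σ => (t 0 - w (σ (v (Fin.last m))))⁻¹ *
              ∏ i ∈ Finset.Ioi (v (Fin.last m)), (1 + (t 0 - w (σ i))⁻¹))
              (fun v σ => X (w ∘ σ) (Pi.single (v (Fin.last m)) true))
            = (m.factorial : K) * siteOp w (t 0) true false (X w) (fun _ => false) := by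
          rw [(siteOp_empty w (t 0) _).2.2.2, ← sum_perm_apply _ (Fin.last m), pairing]
          refine Finset.sum_congr rfl fun u _ => ?_
          congr 2
          · simp
          · simp only [Perm.mul_apply, Fin.revPerm_apply]
            refine Finset.prod_equiv Fin.revPerm (fun i => ?_) fun i _ => rfl
            simp only [Finset.mem_Ioi, Finset.mem_Iio, Fin.revPerm_apply]
            rw [← Fin.rev_lt_rev, Fin.rev_rev]
        have hR : ∀ σ : Perm (Fin (m + 1)), X (w ∘ σ) (Pi.single (Fin.last m) true)
            = (∏ l, (1 + (Fin.tail t l - w (σ (Fin.last m)))⁻¹)) * (w (σ (Fin.last m)) + c)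
              * chainOp (Fin.init (w ∘ σ)) (Fin.tail t) (Fin.tail b)
                (boundaryWeight c (Fin.init (w ∘ σ))) (fun _ => false) := by
          intro σ
          rw [← chainOp_snoc_true]
          have e1 : (Fin.snoc (Fin.init (w ∘ σ)) (w (σ (Fin.last m))) : Fin (m + 1) → K)
              = w ∘ σ := Fin.snoc_init_self (w ∘ σ)
          have e2 : (Fin.snoc (fun _ : Fin m => false) true : Fin (m + 1) → Bool)
              = Pi.single (Fin.last m) true := by
            funext i
            induction i using Fin.lastCases with
            | last => simp
            | cast i =>
              rw [Fin.snoc_castSucc, Pi.single_eq_of_ne (Fin.castSucc_lt_last i).ne]; rfl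
          rw [e1, e2]
        rw [hL] at hp
        have hf : ((m.factorial : ℕ) : K) ≠ 0 := Nat.cast_ne_zero.mpr m.factorial_ne_zero
        refine mul_left_cancel₀ hf ?_
        have hcf : m + 1 - countFalse b = m - countFalse (Fin.tail b) := by
          rw [countFalse_succ, hb0]; simp; omega
        have hih : ∀ σ : Perm (Fin (m + 1)), ((m - countFalse (Fin.tail b)).factorial : K) *
            chainOp (Fin.init (w ∘ σ)) (Fin.tail t) (Fin.tail b)
                (boundaryWeight c (Fin.init (w ∘ σ))) (fun _ => false)
            = symBar (fun s : Fin m → K => chainFun c (Fin.tail t) (Fin.tail b) s)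
                (Fin.init (w ∘ σ)) := fun σ =>
          ih (Fin.tail t) (Fin.tail b) _ (hw.comp σ).init fun j i => ht' j _
        -- The induction hypothesis is already symmetrized in the first `m` variables; this merges
        -- it with the outer symmetrization and cancels the factorial.
        have hs := sum_symBar_init w hw (fun z => (z + c) * (t 0 - z)⁻¹ *
          ∏ l : Fin n, (1 + (t l.succ - z)⁻¹))
          (fun s : Fin m → K => chainFun c (Fin.tail t) (Fin.tail b) s)
        have e1 : chainOp w t b (boundaryWeight c w) (fun _ => false)
            = siteOp w (t 0) true false (X w) (fun _ => false) := by
          simp only [chainOp, hb0, hX]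
        rw [hcf, e1, mul_left_comm, hp, Finset.mul_sum]
        have e2 : symBar (fun s : Fin (m + 1) → K => chainFun c t b s) w
            = ∑ σ : Perm (Fin (m + 1)), qFun (w ∘ σ) * (((fun z => (z + c) * (t 0 - z)⁻¹ *
          ∏ l : Fin n, (1 + (t l.succ - z)⁻¹)) (w (σ (Fin.last m)))) *
            chainFun c (Fin.tail t) (Fin.tail b) (Fin.init (w ∘ σ))) := by
          unfold symBar sym
          refine Finset.sum_congr rfl fun σ _ => ?_
          simp only [chainFun, hb0]
          rw [mul_comm]
          rfl
        rw [e2, ← hs]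
        refine Finset.sum_congr rfl fun σ _ => ?_
        have e3 : (Finset.Ioi (Fin.last m)) = ∅ := by ext i; simp [Fin.le_last]
        simp only [Perm.one_apply, e3, Finset.prod_empty, hR]
        rw [← hih]
        simp only [Fin.tail]
        ring

end Symmetrization

/-! ### Symmetrization of G as a sum of products of two partition functions -/

section Combination

variable {K : Type*} [Field K]

theorem chainFun_of_true (c : K) {n m : ℕ} (t : Fin (n + 1) → K) (b : Fin (n + 1) → Bool)
    (s : Fin m → K) (hb : b 0 = true) :
    chainFun c t b s = chainFun c (Fin.tail t) (Fin.tail b) s := by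
  cases m <;> simp [chainFun, hb]

/-- Each row leaving as `false` uses up one variable of `s`. -/
theorem chainFun_eq_zero (c : K) {n m : ℕ} (t : Fin n → K) (b : Fin n → Bool) (s : Fin m → K)
    (h : m < countFalse b) : chainFun c t b s = 0 := by
  induction n generalizing m with
  | zero => simp [countFalse] at h
  | succ n ih =>
    rw [countFalse_succ] at h
    cases hb : b 0 with
    | true =>
      rw [chainFun_of_true c t b s hb]
      exact ih _ _ _ (by simpa [hb] using h)
    | false =>
      cases m with
      | zero => simp [chainFun, hb]
      | succ m =>
        simp only [hb, Bool.false_eq_true, if_false] at h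
        simp [chainFun, hb, ih (Fin.tail t) (Fin.tail b) (Fin.init s) (by omega)]

/-- The state of the sites with excitations exactly at the values of a sequence. -/
def avoid {n q : ℕ} (i : Fin q → Fin n) (k : Fin n) : Bool := decide (∀ a, i a ≠ k)

theorem avoid_eq_false {n q : ℕ} (i : Fin q → Fin n) (k : Fin n) :
    avoid i k = false ↔ ∃ a, i a = k := by simp [avoid]

/-- The recursion consumes the variables from the end, so the smallest value of `i` goes with the
last variable; this accounts for `Fin.rev`. -/
theorem chainFun_avoid (c : K) {n m q : ℕ} (hq : q ≤ m) (t : Fin n → K) (i : Fin q → Fin n)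
    (hi : StrictMono i) (s : Fin m → K) :
    chainFun c t (avoid i) s = ∏ a : Fin q, ((s (Fin.rev (Fin.castLE hq a)) + c)
      * (t (i a) - s (Fin.rev (Fin.castLE hq a)))⁻¹
      * ∏ l ∈ Finset.Ioi (i a), (1 + (t l - s (Fin.rev (Fin.castLE hq a)))⁻¹)) := by
  induction n generalizing m q with
  | zero =>
    cases q with
    | zero => simp [chainFun]
    | succ q => exact (i 0).elim0
  | succ n ih =>
    by_cases h0 : ∃ a, i a = 0
    · obtain ⟨a, ha⟩ := h0
      cases q with
      | zero => exact a.elim0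
      | succ q =>
        have hi0 : i 0 = 0 := by
          have := hi.monotone (Fin.zero_le a)
          rw [ha] at this; exact Fin.le_zero_iff.mp this
        cases m with
        | zero => omega
        | succ m =>
          have hne : ∀ a : Fin q, i a.succ ≠ 0 := fun a h => by
            have := hi (Fin.succ_pos a); rw [hi0, h] at this; exact lt_irrefl _ this
          have hb : avoid i 0 = false := (avoid_eq_false _ _).mpr ⟨0, hi0⟩
          have htail : Fin.tail (avoid i) = avoid fun a : Fin q => (i a.succ).pred (hne a) := by
            funext k
            simp only [Fin.tail, avoid]
            congr 1
            rw [Fin.forall_fin_succ, hi0]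
            simp only [Fin.pred_eq_iff_eq_succ, ne_eq, (Fin.succ_ne_zero k).symm,
              not_false_eq_true, true_and]
          rw [chainFun, hb, htail, ih (Nat.le_of_succ_le_succ hq) (Fin.tail t)
            (fun a : Fin q => (i a.succ).pred (hne a))
            (fun a a' h => Fin.pred_lt_pred_iff.mpr (hi (Fin.succ_lt_succ_iff.mpr h))) (Fin.init s),
            Fin.prod_univ_succ]
          have e0 : Fin.rev (Fin.castLE hq 0) = Fin.last m := by
            ext; simp
          have e1 : ∀ a : Fin q, Fin.init s (Fin.rev (Fin.castLE (Nat.le_of_succ_le_succ hq) a))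
              = s (Fin.rev (Fin.castLE hq a.succ)) := by
            intro a
            simp only [Fin.init]
            congr 1
            ext; simp
          simp only [Bool.false_eq_true, if_false, e0, hi0, e1, Fin.prod_Ioi_zero]
          congr 1
          refine Finset.prod_congr rfl fun a _ => ?_
          have e2 := Fin.succ_pred (i a.succ) (hne a)
          congr 1
          · simp [Fin.tail]
          · conv_rhs => rw [← e2, Fin.prod_Ioi_succ]
            rfl
    · push Not at h0
      have hb : avoid i 0 = true := by simpa [avoid] using h0
      have htail : Fin.tail (avoid i) = avoid fun a : Fin q => (i a).pred (h0 a) := by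
        funext k
        simp only [Fin.tail, avoid, ne_eq, Fin.pred_eq_iff_eq_succ]
      rw [chainFun_of_true c t _ s hb, htail, ih hq (Fin.tail t)
            (fun a : Fin q => (i a).pred (h0 a))
            (fun a a' h => Fin.pred_lt_pred_iff.mpr (hi h)) s]
      refine Finset.prod_congr rfl fun a _ => ?_
      have e2 := Fin.succ_pred (i a) (h0 a)
      congr 1
      · simp [Fin.tail]
      · conv_rhs => rw [← e2, Fin.prod_Ioi_succ]
        rfl

theorem countFalse_eq_card {n : ℕ} (b : Fin n → Bool) :
    countFalse b = (Finset.univ.filter fun k => b k = false).card := by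
  rw [Finset.card_filter]
  refine Finset.sum_congr rfl fun k _ => ?_
  cases b k <;> rfl

theorem filter_avoid {n q : ℕ} (i : Fin q → Fin n) :
    (Finset.univ.filter fun k => avoid i k = false) = Finset.univ.image i := by
  ext k; simp [avoid_eq_false]

theorem countFalse_avoid {n q : ℕ} (i : Fin q ↪o Fin n) : countFalse (avoid i) = q := by
  rw [countFalse_eq_card, filter_avoid, Finset.card_image_of_injective _ i.injective]
  simp

theorem qFun_neg_rev {m : ℕ} (s : Fin m → K) : qFun (fun i => -s (Fin.rev i)) = qFun s := by
  have e1 : ∀ {n : ℕ} (f : Fin n → Fin n → K), (∏ i, ∏ j ∈ Finset.Ioi i, f i j)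
      = ∏ i, ∏ j, if i < j then f i j else 1 := by
    intro n f
    refine Finset.prod_congr rfl fun i _ => ?_
    rw [← Finset.prod_filter]
    congr 1; ext j; simp
  unfold qFun
  rw [e1, e1, Finset.prod_comm, ← Equiv.prod_comp Fin.revPerm]
  refine Finset.prod_congr rfl fun i _ => ?_
  rw [← Equiv.prod_comp Fin.revPerm]
  refine Finset.prod_congr rfl fun j _ => ?_
  simp only [Fin.revPerm_apply, Fin.rev_lt_rev, Fin.rev_rev, neg_sub_neg]

/-- Negation changes the sign of every difference and reversal restores it, so the weight is
unchanged under both together. -/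
theorem symBar_neg {m : ℕ} (f : (Fin m → K) → K) (t : Fin m → K) :
    symBar f (fun i => -t i) = symBar (fun s => f fun i => -s (Fin.rev i)) t := by
  unfold symBar sym
  rw [← Equiv.sum_comp (Equiv.mulRight Fin.revPerm)]
  refine Finset.sum_congr rfl fun σ _ => ?_
  beta_reduce
  rw [← qFun_neg_rev (t ∘ σ)]
  rfl

theorem Generic.neg {m : ℕ} {t : Fin m → K} (ht : Generic t) : Generic fun i => -t i :=
  fun i j h => ⟨fun h' => (ht j i h.symm).1 (by linear_combination h'),
    fun h' => (ht j i h.symm).2 (by linear_combination h')⟩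

/-- The six-vertex partition function for the variables `w`, `t` and boundary weight `c`. -/
def partFun (c : K) {n m : ℕ} (w : Fin m → K) (t : Fin n → K) (b : Fin n → Bool) : K :=
  chainOp w t b (boundaryWeight c w) fun _ => false

/-- The partition function in the negatives of the variables. -/
def partFunNeg (c : K) {n m : ℕ} (w : Fin m → K) (t : Fin n → K) (b : Fin n → Bool) : K :=
  (-1) ^ countFalse b * partFun c (fun i => -w i) (fun i => -t i) b

theorem countFalse_comp {n : ℕ} (b : Fin n → Bool) (σ : Perm (Fin n)) :
    countFalse (b ∘ σ) = countFalse b := Equiv.sum_comp σ fun i => if b i then 0 else 1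

/-- In `chainOp_comm` the difference of neighbouring parameters has the sign opposite to that in
`IsFam`; listing the rows in reverse corrects this. The inverse of `u` turns precomposition with a
transposition into left multiplication. -/
theorem isFam_partFun (c : K) {n m : ℕ} (w : Fin m → K) (t : Fin n → K)
    (htw : ∀ j i, t j - w i ≠ 0) (b : Fin n → Bool) :
    IsFam t fun u σ => partFun c w ((t ∘ σ) ∘ Fin.rev) ((b ∘ ⇑u⁻¹) ∘ Fin.rev) := by
  intro k l hkl u σ
  have hkl' : ((Fin.rev l : Fin n) : ℕ) + 1 = (Fin.rev k : Fin n) := by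
    rw [Fin.val_rev, Fin.val_rev]; omega
  have h := chainOp_comm w ((t ∘ ⇑(σ * swap k l)) ∘ Fin.rev) (fun j i => htw _ i)
    (Fin.rev l) (Fin.rev k) hkl' ((b ∘ ⇑u⁻¹) ∘ Fin.rev) (boundaryWeight c w) (fun _ => false)
  have hs : ∀ i : Fin n, Fin.rev (swap (Fin.rev l) (Fin.rev k) i) = swap k l (Fin.rev i) := by
    intro i
    rw [Function.Injective.map_swap Fin.rev_injective, Fin.rev_rev, Fin.rev_rev, swap_comm]
  have e1 : ((t ∘ ⇑(σ * swap k l)) ∘ Fin.rev) ∘ swap (Fin.rev l) (Fin.rev k)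
      = (t ∘ σ) ∘ Fin.rev := by
    funext i; simp [hs]
  have e2 : ((b ∘ ⇑u⁻¹) ∘ Fin.rev) ∘ swap (Fin.rev l) (Fin.rev k)
      = (b ∘ ⇑(swap k l * u)⁻¹) ∘ Fin.rev := by
    funext i; simp [hs]
  rw [e1, e2] at h
  simp only [Function.comp_apply, Perm.mul_apply, Fin.rev_rev, swap_apply_left,
    swap_apply_right] at h
  exact h

/-- Here the sign is corrected by negating the variables instead of reversing the rows. -/
theorem isFam_partFunNeg (c : K) {n m : ℕ} (w : Fin m → K) (t : Fin n → K)
    (htw : ∀ j i, t j - w i ≠ 0) (b : Fin n → Bool) :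
    IsFam t fun u σ => partFunNeg c w (t ∘ σ) (b ∘ ⇑u⁻¹) := by
  intro k l hkl u σ
  have h := chainOp_comm (fun i => -w i) (fun j => -(t ∘ ⇑(σ * swap k l)) j)
    (fun j i h' => htw ((σ * swap k l) j) i
      (neg_eq_zero.mp (by rw [← h', Function.comp_apply]; ring)))
    k l hkl (b ∘ ⇑u⁻¹) (boundaryWeight c fun i => -w i) (fun _ => false)
  have e1 : (fun j => -(t ∘ ⇑(σ * swap k l)) j) ∘ swap k l = fun j => -(t ∘ σ) j := by
    funext i; simp
  have e2 : (b ∘ ⇑u⁻¹) ∘ swap k l = b ∘ ⇑(swap k l * u)⁻¹ := by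
    funext i; simp
  rw [e1, e2] at h
  simp only [Function.comp_apply, Perm.mul_apply, swap_apply_left, swap_apply_right] at h
  simp only [partFunNeg, partFun, countFalse_comp]
  simp only [Function.comp_def, Perm.mul_apply] at h ⊢
  linear_combination (-1) ^ countFalse b * h

theorem partFun_eq_symBar [CharZero K] (c : K) {n m : ℕ} (w : Fin m → K) (hw : Generic w)
    (t : Fin n → K) (htw : ∀ j i, t j - w i ≠ 0) (b : Fin n → Bool) :
    ((m - countFalse b).factorial : K) * partFun c w t b
      = symBar (fun s : Fin m → K => chainFun c t b s) w :=
  chainOp_eq_symBar c t b w hw htw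

theorem partFunNeg_eq_symBar [CharZero K] (c : K) {n m : ℕ} (w : Fin m → K) (hw : Generic w)
    (t : Fin n → K) (htw : ∀ j i, t j - w i ≠ 0) (b : Fin n → Bool) :
    ((m - countFalse b).factorial : K) * partFunNeg c w t b
      = symBar (fun s : Fin m → K => (-1) ^ countFalse b *
          chainFun c (fun i => -t i) b fun i => -s (Fin.rev i)) w := by
  have h := partFun_eq_symBar c (fun i => -w i) hw.neg (fun i => -t i)
    (fun j i h' => htw j i (neg_eq_zero.mp (by linear_combination h'))) b
  rw [symBar_neg] at h
  unfold partFunNeg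
  rw [mul_left_comm, h, symBar, sym, symBar, sym, Finset.mul_sum]
  simp only [mul_assoc]

theorem partFun_eq_zero [CharZero K] (c : K) {n m : ℕ} (w : Fin m → K) (hw : Generic w)
    (t : Fin n → K) (htw : ∀ j i, t j - w i ≠ 0) (b : Fin n → Bool) (h : m < countFalse b) :
    partFun c w t b = 0 := by
  have e := partFun_eq_symBar c w hw t htw b
  simp only [symBar, sym, chainFun_eq_zero c t b _ h, zero_mul, Finset.sum_const_zero] at e
  exact (mul_eq_zero.mp e).resolve_left (Nat.cast_ne_zero.mpr (Nat.factorial_ne_zero _))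

theorem partFunNeg_eq_zero [CharZero K] (c : K) {n m : ℕ} (w : Fin m → K) (hw : Generic w)
    (t : Fin n → K) (htw : ∀ j i, t j - w i ≠ 0) (b : Fin n → Bool) (h : m < countFalse b) :
    partFunNeg c w t b = 0 := by
  rw [partFunNeg, partFun_eq_zero c _ hw.neg _ _ b h, mul_zero]
  exact fun j i h' => htw j i (neg_eq_zero.mp (by linear_combination h'))

/-- The t¹-factor of G. With the rows reversed, the largest value of `j` meets the last variable,
and products over later rows become products over earlier ones. -/
theorem chainFun_rev_eq (c : K) {k₁ k₂ q : ℕ} (hq : q ≤ k₁) (j : Fin q ↪o Fin k₂)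
    (s1 : Fin k₁ → K) (s2 : Fin k₂ → K) (h : ∀ k l, s2 k - s1 l ≠ 0) :
    chainFun c (s2 ∘ Fin.rev) (avoid j ∘ Fin.rev) s1
      = ∏ s : Fin q,
        let w := s1 (Fin.cast (Nat.sub_add_cancel hq) (Fin.natAdd (k₁ - q) s))
        (w + c) / (s2 (j s) - w) * ∏ l ∈ Finset.Iio (j s), (s2 l - w + 1) / (s2 l - w) := by
  have ha : avoid j ∘ Fin.rev = avoid fun a : Fin q => Fin.rev (j (Fin.rev a)) := by
    funext k
    simp only [Function.comp_apply, avoid]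
    congr 1
    rw [Fin.revPerm.forall_congr_left]
    simp only [Fin.revPerm_symm, Fin.revPerm_apply, ne_eq, eq_iff_iff]
    refine forall_congr' fun a => ?_
    rw [← Fin.rev_inj, Fin.rev_rev]
  rw [ha, chainFun_avoid c hq (s2 ∘ Fin.rev) (fun a : Fin q => Fin.rev (j (Fin.rev a)))
    (fun a b hab => by simpa using hab)]
  rw [← Equiv.prod_comp Fin.revPerm]
  refine Finset.prod_congr rfl fun a _ => ?_
  have e : Fin.rev (Fin.castLE hq (Fin.rev a))
      = Fin.cast (Nat.sub_add_cancel hq) (Fin.natAdd (k₁ - q) a) := by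
    ext; simp [Fin.val_rev]; omega
  simp only [Fin.revPerm_apply, Fin.rev_rev, e, Function.comp_apply, div_eq_mul_inv]
  congr 1
  refine Finset.prod_equiv Fin.revPerm (fun l => ?_) fun l _ => ?_
  · simp only [Finset.mem_Ioi, Finset.mem_Iio, Fin.revPerm_apply]
    rw [← Fin.rev_lt_rev, Fin.rev_rev]
  · simp only [Fin.revPerm_apply]
    rw [add_mul, mul_inv_cancel₀ (h _ _), one_mul]

/-- The t³-factor of G. Each of the `p` factors changes sign under negation, which explains the
power of -1 in `partFunNeg`. -/
theorem chainFun_neg_eq (c : K) {k₂ k₃ p : ℕ} (hp : p ≤ k₃) (i : Fin p ↪o Fin k₂)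
    (s2 : Fin k₂ → K) (s3 : Fin k₃ → K) (h : ∀ k l, s3 k - s2 l ≠ 0) :
    (-1) ^ p * chainFun c (fun k => -s2 k) (avoid i) (fun k => -s3 (Fin.rev k))
      = ∏ a : Fin p,
        let u := s3 (Fin.castLE hp a)
        (u - c) / (u - s2 (i a)) * ∏ l ∈ Finset.Ioi (i a), (u - s2 l + 1) / (u - s2 l) := by
  rw [chainFun_avoid c hp _ i i.strictMono]
  have : ((-1 : K)) ^ p = ∏ _a : Fin p, (-1 : K) := by simp
  rw [this, ← Finset.prod_mul_distrib]
  refine Finset.prod_congr rfl fun a _ => ?_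
  simp only [Fin.rev_rev, div_eq_mul_inv, neg_sub_neg, ← mul_assoc]
  congr 1
  · ring
  · refine Finset.prod_congr rfl fun l _ => ?_
    rw [add_mul, mul_inv_cancel₀ (h _ _), one_mul]

/-- Once t² is fixed, G is a product of a function of t¹ and one of t³, whose symmetrizations are
partition functions. The remaining weighted sum over the orbit of t² is a pairing, evaluated by its
definition. -/
theorem symBar_gFun [CharZero K] {k₁ k₂ k₃ p q : ℕ} (hp : p ≤ k₃) (hq : q ≤ k₁) (x Λ2 Λ3 : K)
    (i : Fin p ↪o Fin k₂) (j : Fin q ↪o Fin k₂) (t1 : Fin k₁ → K) (t2 : Fin k₂ → K)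
    (t3 : Fin k₃ → K) (h1 : Generic t1) (h2 : Generic t2) (h3 : Generic t3)
    (h21 : ∀ k l, t2 k - t1 l ≠ 0) (h32 : ∀ k l, t3 k - t2 l ≠ 0) :
    symBar (fun s1 => symBar (fun s2 => symBar (fun s3 =>
      gFun hp hq x Λ2 Λ3 i j s1 s2 s3) t3) t2) t1
      = (((k₁ - q).factorial * (k₃ - p).factorial : ℕ) : K) * ∑ u : Perm (Fin k₂),
          partFun (Λ2 - x) t1 t2 (avoid j ∘ u) * partFunNeg (x - Λ3) t3 t2 (avoid i ∘ u) := by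
  have h23 : ∀ k l, t2 k - t3 l ≠ 0 := fun k l h => h32 l k (by linear_combination -h)
  have hfac : ∀ (σ1 : Perm (Fin k₁)) (σ2 : Perm (Fin k₂)) (σ3 : Perm (Fin k₃)),
      gFun hp hq x Λ2 Λ3 i j (t1 ∘ σ1) (t2 ∘ σ2) (t3 ∘ σ3)
        = ((-1) ^ countFalse (avoid i) * chainFun (x - Λ3) (fun k => -(t2 ∘ σ2) k) (avoid i)
            (fun k => -(t3 ∘ σ3) (Fin.rev k)))
          * chainFun (Λ2 - x) ((t2 ∘ σ2) ∘ Fin.rev) (avoid j ∘ Fin.rev) (t1 ∘ σ1) := by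
    intro σ1 σ2 σ3
    rw [countFalse_avoid, chainFun_neg_eq (x - Λ3) hp i (t2 ∘ σ2) (t3 ∘ σ3) fun k l => h32 _ _,
      chainFun_rev_eq (Λ2 - x) hq j (t1 ∘ σ1) (t2 ∘ σ2) fun k l => h21 _ _]
    unfold gFun
    have e1 : ∀ u : K, u - x + Λ3 = u - (x - Λ3) := fun u => by ring
    have e2 : ∀ u : K, u - x + Λ2 = u + (Λ2 - x) := fun u => by ring
    simp only [e1, e2]
  have hp' := pairing_eq_sum h2 (isFam_partFun (Λ2 - x) t1 t2 h21 (avoid j))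
    (isFam_partFunNeg (x - Λ3) t3 t2 h23 (avoid i))
  -- The reversal built into the first family cancels the one in the pairing, so both partition
  -- functions are taken at `t2` itself.
  have hL : pairing (fun u σ => partFun (Λ2 - x) t1 ((t2 ∘ ⇑σ) ∘ Fin.rev)
        ((avoid j ∘ ⇑u⁻¹) ∘ Fin.rev))
        (fun u σ => partFunNeg (x - Λ3) t3 (t2 ∘ ⇑σ) (avoid i ∘ ⇑u⁻¹))
      = ∑ u : Perm (Fin k₂),
          partFun (Λ2 - x) t1 t2 (avoid j ∘ u) * partFunNeg (x - Λ3) t3 t2 (avoid i ∘ u) := by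
    unfold pairing
    rw [← Equiv.sum_comp (Equiv.inv (Perm (Fin k₂)))]
    refine Finset.sum_congr rfl fun u _ => ?_
    have e1 : (t2 ∘ ⇑(Fin.revPerm : Perm (Fin k₂))) ∘ Fin.rev = t2 := by funext k; simp
    have e2 : (avoid j ∘ ⇑((Fin.revPerm * u⁻¹)⁻¹ : Perm (Fin k₂))) ∘ Fin.rev = avoid j ∘ u := by
      funext k; simp
    simp only [Equiv.inv_apply, e1, e2, inv_inv, Perm.coe_one, Function.comp_id]
  rw [← hL, hp', Finset.mul_sum]
  have hA : ∀ σ : Perm (Fin k₂), ((k₁ - q).factorial : K)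
      * partFun (Λ2 - x) t1 ((t2 ∘ σ) ∘ Fin.rev) (avoid j ∘ Fin.rev)
      = symBar (fun s1 : Fin k₁ → K =>
          chainFun (Λ2 - x) ((t2 ∘ σ) ∘ Fin.rev) (avoid j ∘ Fin.rev) s1) t1 := by
    intro σ
    have hc : countFalse (avoid j ∘ Fin.rev) = q :=
      (countFalse_comp (avoid j) Fin.revPerm).trans (countFalse_avoid j)
    have := partFun_eq_symBar (Λ2 - x) t1 h1 ((t2 ∘ σ) ∘ Fin.rev) (fun k l => h21 _ _)
      (avoid j ∘ Fin.rev)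
    rwa [hc] at this
  have hC : ∀ σ : Perm (Fin k₂), ((k₃ - p).factorial : K)
      * partFunNeg (x - Λ3) t3 (t2 ∘ σ) (avoid i)
      = symBar (fun s : Fin k₃ → K => (-1) ^ countFalse (avoid i) *
          chainFun (x - Λ3) (fun k => -(t2 ∘ σ) k) (avoid i) fun k => -s (Fin.rev k)) t3 := by
    intro σ
    have := partFunNeg_eq_symBar (x - Λ3) t3 h3 (t2 ∘ σ) (fun k l => h23 _ _) (avoid i)
    rwa [countFalse_avoid] at this ⊢
  have hR : ∀ σ : Perm (Fin k₂), (((k₁ - q).factorial * (k₃ - p).factorial : ℕ) : K) *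
      (qFun (t2 ∘ σ) * (partFun (Λ2 - x) t1 ((t2 ∘ σ) ∘ Fin.rev) ((avoid j ∘ ⇑(1 : Perm (Fin k₂))⁻¹)
        ∘ Fin.rev) * partFunNeg (x - Λ3) t3 (t2 ∘ σ) (avoid i ∘ ⇑(1 : Perm (Fin k₂))⁻¹)))
      = qFun (t2 ∘ σ) * (symBar (fun s1 : Fin k₁ → K =>
          chainFun (Λ2 - x) ((t2 ∘ σ) ∘ Fin.rev) (avoid j ∘ Fin.rev) s1) t1
        * symBar (fun s : Fin k₃ → K => (-1) ^ countFalse (avoid i) *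
          chainFun (x - Λ3) (fun k => -(t2 ∘ σ) k) (avoid i) fun k => -s (Fin.rev k)) t3) := by
    intro σ
    rw [← hA, ← hC]
    simp only [inv_one, Perm.coe_one, Function.comp_id]
    push_cast
    ring
  simp only [hR]
  simp only [symBar, sym, hfac, Finset.mul_sum, Finset.sum_mul]
  rw [Finset.sum_comm]
  refine Finset.sum_congr rfl fun σ2 _ => ?_
  rw [Finset.sum_comm]
  refine Finset.sum_congr rfl fun σ1 _ => Finset.sum_congr rfl fun σ3 _ => ?_
  ring

end Combination

/-! ### Orbits of configurations under permutations of the sites -/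

section Orbits

/-- The number of points where a function takes a given value. -/
def fiberCard {ι α : Type*} [Fintype ι] [DecidableEq α] (κ : ι → α) (a : α) : ℕ :=
  (Finset.univ.filter fun k => κ k = a).card

theorem exists_perm_of_fiberCard {ι α : Type*} [Fintype ι] [DecidableEq α] (κ κ' : ι → α)
    (h : ∀ a, fiberCard κ a = fiberCard κ' a) : ∃ u : Perm ι, κ' ∘ u = κ := by
  have e : ∀ a, Nonempty ({k // κ k = a} ≃ {k // κ' k = a}) := fun a => by
    rw [← Fintype.card_eq, Fintype.card_subtype, Fintype.card_subtype]
    exact h a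
  let g := fun a => (e a).some
  refine ⟨(Equiv.sigmaFiberEquiv κ).symm.trans
    ((Equiv.sigmaCongrRight g).trans (Equiv.sigmaFiberEquiv κ')), funext fun k => ?_⟩
  exact (g (κ k) ⟨k, rfl⟩).2

theorem fiberCard_comp {ι α : Type*} [Fintype ι] [DecidableEq α] (κ : ι → α) (u : Perm ι) (a : α) :
    fiberCard (κ ∘ u) a = fiberCard κ a := by
  unfold fiberCard
  refine Finset.card_bij (fun k _ => u k) (by simp) (by simp) fun k hk =>
    ⟨u.symm k, by simpa using hk, by simp⟩

/-- Orbit-stabilizer: an orbit consists of the functions with given fibre sizes, and the stabilizer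
permutes each fibre separately. -/
theorem sum_perm_comp {ι α N : Type*} [Fintype ι] [DecidableEq ι] [Fintype α] [DecidableEq α]
    [AddCommMonoid N] (κ : ι → α) (F : (ι → α) → N) :
    ∑ u : Perm ι, F (κ ∘ u) = (∏ a, (fiberCard κ a).factorial) •
      ∑ κ' : ι → α, if ∀ a, fiberCard κ' a = fiberCard κ a then F κ' else 0 := by
  have hstab : (Finset.univ.filter fun u : Perm ι => κ ∘ u = κ).card
      = ∏ a, (fiberCard κ a).factorial := by
    rw [← Fintype.card_subtype, DomMulAct.stabilizer_card]
    simp only [Fintype.card_subtype, fiberCard]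
  have hcard : ∀ κ' : ι → α, (Finset.univ.filter fun u : Perm ι => κ ∘ u = κ').card
      = if ∀ a, fiberCard κ' a = fiberCard κ a then ∏ a, (fiberCard κ a).factorial else 0 := by
    intro κ'
    split_ifs with h
    · obtain ⟨u₀, rfl⟩ := exists_perm_of_fiberCard κ' κ h
      rw [← hstab]
      refine Finset.card_bij (fun u _ => u * u₀⁻¹) ?_ (by simp) ?_
      · intro u hu
        simp only [Finset.mem_filter, Finset.mem_univ, true_and] at hu ⊢
        rw [Perm.coe_mul, ← Function.comp_assoc, hu, Function.comp_assoc, ← Perm.coe_mul]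
        simp
      · intro u hu
        refine ⟨u * u₀, ?_, by simp⟩
        simp only [Finset.mem_filter, Finset.mem_univ, true_and] at hu ⊢
        rw [Perm.coe_mul, ← Function.comp_assoc, hu]
    · rw [Finset.card_eq_zero, Finset.filter_eq_empty_iff]
      rintro u - rfl
      exact h (fiberCard_comp κ u)
  rw [← Finset.sum_fiberwise_of_maps_to (g := fun u : Perm ι => κ ∘ u) (t := Finset.univ)
    (fun _ _ => Finset.mem_univ _), Finset.smul_sum]
  refine Finset.sum_congr rfl fun κ' _ => ?_
  rw [Finset.sum_congr rfl (g := fun _ => F κ') fun u hu => by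
    rw [(Finset.mem_filter.mp hu).2], Finset.sum_const, hcard κ']
  split_ifs <;> simp

/-- The number of sites in the first state in both configurations. -/
def countBoth {n : ℕ} (b b' : Fin n → Bool) : ℕ :=
  (Finset.univ.filter fun k => b k = false ∧ b' k = false).card

theorem fiberCard_pair {n : ℕ} (κ : Fin n → Bool × Bool) :
    fiberCard κ (false, false) = countBoth (Prod.fst ∘ κ) (Prod.snd ∘ κ) ∧
    fiberCard κ (false, false) + fiberCard κ (false, true) = countFalse (Prod.fst ∘ κ) ∧
    fiberCard κ (false, false) + fiberCard κ (true, false) = countFalse (Prod.snd ∘ κ) ∧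
    fiberCard κ (false, false) + fiberCard κ (false, true) + fiberCard κ (true, false)
      + fiberCard κ (true, true) = n := by
  have hn : n = ∑ _k : Fin n, 1 := by simp
  refine ⟨?_, ?_, ?_, ?_⟩
  · simp [fiberCard, countBoth, Prod.ext_iff]
  · simp only [fiberCard, countFalse, Finset.card_filter, ← Finset.sum_add_distrib]
    refine Finset.sum_congr rfl fun k _ => ?_
    rcases h : κ k with ⟨_ | _, _ | _⟩ <;> simp [h]
  · simp only [fiberCard, countFalse, Finset.card_filter, ← Finset.sum_add_distrib]
    refine Finset.sum_congr rfl fun k _ => ?_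
    rcases h : κ k with ⟨_ | _, _ | _⟩ <;> simp [h]
  · conv_rhs => rw [hn]
    simp only [fiberCard, Finset.card_filter, ← Finset.sum_add_distrib]
    refine Finset.sum_congr rfl fun k _ => ?_
    rcases h : κ k with ⟨_ | _, _ | _⟩ <;> simp

theorem countBoth_avoid {n p q : ℕ} (i : Fin p ↪o Fin n) (j : Fin q ↪o Fin n) :
    countBoth (avoid j) (avoid i) = interCard i j := by
  unfold countBoth interCard
  rw [← filter_avoid, ← filter_avoid, Finset.inter_comm, Finset.filter_and]

theorem countBoth_le {n : ℕ} (b b' : Fin n → Bool) :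
    countBoth b b' ≤ countFalse b ∧ countBoth b b' ≤ countFalse b' ∧
      countFalse b + countFalse b' ≤ n + countBoth b b' := by
  obtain ⟨h1, h2, h3, h4⟩ := fiberCard_pair fun k => (b k, b' k)
  change _ = countBoth b b' at h1
  change _ = countFalse b at h2
  change _ = countFalse b' at h3
  omega

/-- Two configurations form one function with four values, whose fibre sizes are determined by p, q
and the size of the intersection. -/
theorem sum_perm_avoid {N : Type*} [AddCommMonoid N] {n p q : ℕ} (i : Fin p ↪o Fin n)
    (j : Fin q ↪o Fin n) (F : (Fin n → Bool) → (Fin n → Bool) → N) :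
    ∑ u : Perm (Fin n), F (avoid j ∘ u) (avoid i ∘ u)
      = ((n + interCard i j - p - q).factorial * (q - interCard i j).factorial *
          (p - interCard i j).factorial * (interCard i j).factorial) •
        ∑ b : Fin n → Bool, ∑ b' : Fin n → Bool,
          if countFalse b' = p ∧ countFalse b = q ∧ countBoth b b' = interCard i j then F b b'
          else 0 := by
  have h := sum_perm_comp (fun k => (avoid j k, avoid i k))
    fun κ => F (Prod.fst ∘ κ) (Prod.snd ∘ κ)
  obtain ⟨h1, h2, h3, h4⟩ := fiberCard_pair fun k => (avoid j k, avoid i k)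
  have c1 : countFalse (avoid j) = q := countFalse_avoid j
  have c2 : countFalse (avoid i) = p := countFalse_avoid i
  have c3 := countBoth_avoid i j
  simp only [Function.comp_def] at h1 h2 h3
  rw [c3] at h1
  rw [c1] at h2
  rw [c2] at h3
  refine h.trans ?_
  congr 1
  · rw [Fintype.prod_prod_type]
    simp only [Fintype.prod_bool]
    rw [h1, show fiberCard (fun k => (avoid j k, avoid i k)) (false, true) = q - interCard i j by
      omega, show fiberCard (fun k => (avoid j k, avoid i k)) (true, false) = p - interCard i j by
      omega, show fiberCard (fun k => (avoid j k, avoid i k)) (true, true)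
        = n + interCard i j - p - q by omega]
    ring
  · rw [← Fintype.sum_prod_type', ← Equiv.sum_comp (Equiv.arrowProdEquivProdArrow ..)]
    refine Finset.sum_congr rfl fun κ _ => ?_
    obtain ⟨g1, g2, g3, g4⟩ := fiberCard_pair κ
    simp only [Function.comp_def] at g1 g2 g3
    simp only [Equiv.arrowProdEquivProdArrow, Equiv.coe_fn_mk, Function.comp_def]
    refine if_congr ?_ rfl rfl
    simp only [Prod.forall, Bool.forall_bool]
    omega

end Orbits

/-! ### Collecting pairs of configurations by their counts -/

section Total

variable {K : Type*} [Field K] [CharZero K]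

/-- Two of the six factorials come from the symmetrizations over t¹ and t³, the other four from the
stabilizer. The sequences enter the right side only through `interCard i j`, whence the independence
of their choice. -/
theorem sum_partFun_eq {k₁ k₂ k₃ p q : ℕ} (hp : p ≤ k₃) (hq : q ≤ k₁) (x Λ2 Λ3 : K)
    (i : Fin p ↪o Fin k₂) (j : Fin q ↪o Fin k₂) (t1 : Fin k₁ → K) (t2 : Fin k₂ → K)
    (t3 : Fin k₃ → K) (h1 : Generic t1) (h2 : Generic t2) (h3 : Generic t3)
    (h21 : ∀ k l, t2 k - t1 l ≠ 0) (h32 : ∀ k l, t3 k - t2 l ≠ 0) :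
    symBar (fun s1 => symBar (fun s2 => symBar (fun s3 =>
      gFun hp hq x Λ2 Λ3 i j s1 s2 s3) t3) t2) t1
      = (factProd k₁ k₂ k₃ p q (interCard i j) : K) *
        ∑ b : Fin k₂ → Bool, ∑ b' : Fin k₂ → Bool,
          if countFalse b' = p ∧ countFalse b = q ∧ countBoth b b' = interCard i j then
            partFun (Λ2 - x) t1 t2 b * partFunNeg (x - Λ3) t3 t2 b' else 0 := by
  rw [symBar_gFun hp hq x Λ2 Λ3 i j t1 t2 t3 h1 h2 h3 h21 h32,
    sum_perm_avoid i j fun b b' => partFun (Λ2 - x) t1 t2 b * partFunNeg (x - Λ3) t3 t2 b',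
    nsmul_eq_mul, ← mul_assoc]
  congr 1
  unfold factProd
  push_cast
  ring

theorem sum_partFun_smul {N : Type*} [AddCommGroup N] [Module K N] {k₁ k₂ k₃ : ℕ} (x Λ2 Λ3 : K)
    (t1 : Fin k₁ → K) (t2 : Fin k₂ → K) (t3 : Fin k₃ → K) (h1 : Generic t1) (h2 : Generic t2)
    (h3 : Generic t3) (h21 : ∀ k l, t2 k - t1 l ≠ 0) (h32 : ∀ k l, t3 k - t2 l ≠ 0)
    (i : (p : Fin (min k₂ k₃ + 1)) → Fin (min k₂ k₁ + 1) → ℕ → (Fin p ↪o Fin k₂))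
    (j : Fin (min k₂ k₃ + 1) → (q : Fin (min k₂ k₁ + 1)) → ℕ → (Fin q ↪o Fin k₂))
    (hij : ∀ (p : Fin (min k₂ k₃ + 1)) (q : Fin (min k₂ k₁ + 1)),
      ∀ r ∈ Finset.Icc ((p : ℕ) + q - k₂) (min p q), interCard (i p q r) (j p q r) = r)
    (D : ℕ → ℕ → ℕ → N) :
    ∑ b : Fin k₂ → Bool, ∑ b' : Fin k₂ → Bool,
      (partFun (Λ2 - x) t1 t2 b * partFunNeg (x - Λ3) t3 t2 b') •
        D (countFalse b') (countFalse b) (countBoth b b')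
      = ∑ p : Fin (min k₂ k₃ + 1), ∑ q : Fin (min k₂ k₁ + 1),
          ∑ r ∈ Finset.Icc ((p : ℕ) + q - k₂) (min p q),
            (symBar (fun s1 => symBar (fun s2 => symBar (fun s3 =>
              gFun (le_right_of_fin p) (le_right_of_fin q) x Λ2 Λ3 (i p q r) (j p q r) s1 s2 s3)
              t3) t2) t1 / ((factProd k₁ k₂ k₃ p q r : ℕ) : K)) • D p q r := by
  have h23 : ∀ k l, t2 k - t3 l ≠ 0 := fun k l h => h32 l k (by linear_combination -h)
  have hr : ∀ (p : Fin (min k₂ k₃ + 1)) (q : Fin (min k₂ k₁ + 1)),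
      ∀ r ∈ Finset.Icc ((p : ℕ) + q - k₂) (min p q),
      (symBar (fun s1 => symBar (fun s2 => symBar (fun s3 =>
        gFun (le_right_of_fin p) (le_right_of_fin q) x Λ2 Λ3 (i p q r) (j p q r) s1 s2 s3)
        t3) t2) t1 / ((factProd k₁ k₂ k₃ p q r : ℕ) : K)) • D p q r
      = ∑ b : Fin k₂ → Bool, ∑ b' : Fin k₂ → Bool,
          if countFalse b' = p ∧ countFalse b = q ∧ countBoth b b' = r then
            (partFun (Λ2 - x) t1 t2 b * partFunNeg (x - Λ3) t3 t2 b') •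
              D (countFalse b') (countFalse b) (countBoth b b') else 0 := by
    intro p q r hrI
    rw [sum_partFun_eq _ _ x Λ2 Λ3 _ _ t1 t2 t3 h1 h2 h3 h21 h32, hij p q r hrI,
      mul_div_cancel_left₀]
    · simp only [Finset.sum_smul]
      refine Finset.sum_congr rfl fun b _ => Finset.sum_congr rfl fun b' _ => ?_
      split_ifs with h
      · rw [h.1, h.2.1, h.2.2]
      · rw [zero_smul]
    · rw [Nat.cast_ne_zero]
      unfold factProd
      simp [Nat.factorial_ne_zero]
  rw [Finset.sum_congr rfl fun p _ => Finset.sum_congr rfl fun q _ =>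
    Finset.sum_congr rfl (hr p q)]
  have sc : ∀ {α : Type} [Fintype α] (G : Fin (min k₂ k₃ + 1) → Fin (min k₂ k₁ + 1) → ℕ → α → N),
      ∑ p : Fin (min k₂ k₃ + 1), ∑ q : Fin (min k₂ k₁ + 1),
        ∑ r ∈ Finset.Icc ((p : ℕ) + q - k₂) (min p q), ∑ b : α, G p q r b
      = ∑ b : α, ∑ p : Fin (min k₂ k₃ + 1), ∑ q : Fin (min k₂ k₁ + 1),
        ∑ r ∈ Finset.Icc ((p : ℕ) + q - k₂) (min p q), G p q r b := fun G =>
    (Finset.sum_congr rfl fun p _ => (Finset.sum_congr rfl fun q _ =>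
      Finset.sum_comm).trans Finset.sum_comm).trans Finset.sum_comm
  rw [sc]
  simp only [sc]
  refine Finset.sum_congr rfl fun b _ => Finset.sum_congr rfl fun b' _ => ?_
  obtain ⟨c1, c2, c3⟩ := countBoth_le b b'
  have l : ∀ b : Fin k₂ → Bool, countFalse b ≤ k₂ := fun b => by
    rw [countFalse_eq_card]; exact (Finset.card_le_univ _).trans (by simp)
  -- A pair of configurations occurs for exactly one triple p, q, r if its counts are in range;
  -- otherwise one of its partition functions vanishes. The truncated subtraction in the lower bound
  -- for r encodes the maximum with 0.
  by_cases hb : countFalse b ≤ k₁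
  · by_cases hb' : countFalse b' ≤ k₃
    · rw [Finset.sum_eq_single (⟨countFalse b', Nat.lt_succ_iff.mpr (le_min (l b') hb')⟩ :
        Fin (min k₂ k₃ + 1)), Finset.sum_eq_single (⟨countFalse b, Nat.lt_succ_iff.mpr
        (le_min (l b) hb)⟩ : Fin (min k₂ k₁ + 1)), Finset.sum_eq_single (countBoth b b')]
      · simp
      · exact fun r _ hr => if_neg fun h => hr h.2.2.symm
      · intro hr
        exact absurd (Finset.mem_Icc.mpr ⟨by simp; omega, by simp; omega⟩) hr
      · exact fun q _ hq => Finset.sum_eq_zero fun r _ => if_neg fun h =>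
          hq (Fin.ext h.2.1.symm)
      · exact fun h => absurd (Finset.mem_univ _) h
      · exact fun p _ hp => Finset.sum_eq_zero fun q _ => Finset.sum_eq_zero fun r _ =>
          if_neg fun h => hp (Fin.ext h.1.symm)
      · exact fun h => absurd (Finset.mem_univ _) h
    · simp [partFunNeg_eq_zero (x - Λ3) t3 h3 t2 h23 b' (by omega)]
  · simp [partFun_eq_zero (Λ2 - x) t1 h1 t2 h21 b (by omega)]

end Total

/-! ### Yang-Baxter equation for ordered products over blocks -/

section BlockYangBaxter

variable {A I : Type*} [Monoid A]

/-- The ordered product of `r a b` over `a` in increasing and, inside, `b` in decreasing order. -/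
def gridProd (r : I → I → A) (S T : List I) : A :=
  (S.map fun a => (T.map fun b => r a b).reverse.prod).prod

theorem gridProd_cons (r : I → I → A) (a : I) (S T : List I) :
    gridProd r (a :: S) T = gridProd r [a] T * gridProd r S T := by
  simp [gridProd]

theorem gridProd_single_cons (r : I → I → A) (a b : I) (T : List I) :
    gridProd r [a] (b :: T) = gridProd r [a] T * r a b := by
  simp [gridProd]

theorem Commute.gridProd_right {r : I → I → A} {S T : List I} {y : A}
    (h : ∀ a ∈ S, ∀ b ∈ T, Commute y (r a b)) : Commute y (gridProd r S T) := by
  refine Commute.list_prod_right _ _ fun z hz => ?_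
  obtain ⟨a, ha, rfl⟩ := List.mem_map.mp hz
  refine Commute.list_prod_right _ _ fun z hz => ?_
  obtain ⟨b, hb, rfl⟩ := List.mem_map.mp (List.mem_reverse.mp hz)
  exact h a ha b hb

theorem Commute.gridProd_gridProd {r r' : I → I → A} {S T S' T' : List I}
    (h : ∀ a ∈ S, ∀ b ∈ T, ∀ a' ∈ S', ∀ b' ∈ T', Commute (r a b) (r' a' b')) :
    Commute (gridProd r S T) (gridProd r' S' T') :=
  Commute.gridProd_right fun a' ha' b' hb' =>
    (Commute.gridProd_right fun a ha b hb => (h a ha b hb a' ha' b' hb').symm).symm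

/-- The Yang-Baxter equation for products over three blocks. -/
theorem gridProd_yangBaxter (r : I → I → A) (S T U : List I) (hS : S.Nodup) (hT : T.Nodup)
    (hU : U.Nodup)
    (hyb : ∀ a ∈ S, ∀ b ∈ T, ∀ c ∈ U, r a b * (r a c * r b c) = r b c * (r a c * r a b))
    (h1 : ∀ a ∈ S, ∀ b ∈ T, ∀ b' ∈ T, ∀ c ∈ U, b ≠ b' → Commute (r a b) (r b' c))
    (h2 : ∀ a ∈ S, ∀ a' ∈ S, ∀ b ∈ T, ∀ c ∈ U, a ≠ a' → Commute (r a b) (r a' c))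
    (h3 : ∀ a ∈ S, ∀ b ∈ T, ∀ c ∈ U, ∀ c' ∈ U, c ≠ c' → Commute (r a c) (r b c')) :
    gridProd r S T * (gridProd r S U * gridProd r T U)
      = gridProd r T U * (gridProd r S U * gridProd r S T) := by
  -- The single equation is fused first in the third index, then in the second, then in the first;
  -- factors without a common index commute, so each new index can be carried through alone.
  have key1 : ∀ a ∈ S, ∀ b ∈ T, ∀ U' : List I, U' ⊆ U → U'.Nodup →
      r a b * (gridProd r [a] U' * gridProd r [b] U')
        = gridProd r [b] U' * (gridProd r [a] U' * r a b) := by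
    intro a ha b hb U'
    induction U' with
    | nil => intro _ _; simp [gridProd]
    | cons c U' ih =>
      intro hs hn
      rw [List.cons_subset] at hs
      rw [List.nodup_cons] at hn
      have ih := ih hs.2 hn.2
      have c1 : Commute (r a c) (gridProd r [b] U') := Commute.gridProd_right fun b' hb' c' hc' => by
        rw [List.mem_singleton.mp hb']
        exact h3 a ha b hb c hs.1 c' (hs.2 hc') fun h => hn.1 (h ▸ hc')
      have c2 : Commute (r b c) (gridProd r [a] U') := Commute.gridProd_right fun a' ha' c' hc' => by
        rw [List.mem_singleton.mp ha']
        exact (h3 a ha b hb c' (hs.2 hc') c hs.1 fun h => hn.1 (h ▸ hc')).symm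
      rw [gridProd_single_cons, gridProd_single_cons]
      calc r a b * (gridProd r [a] U' * r a c * (gridProd r [b] U' * r b c))
          = r a b * (gridProd r [a] U' * gridProd r [b] U') * (r a c * r b c) := by
            simp only [mul_assoc]; rw [← mul_assoc (r a c), c1.eq]; simp only [mul_assoc]
        _ = gridProd r [b] U' * gridProd r [a] U' * (r a b * (r a c * r b c)) := by
            rw [ih]; simp only [mul_assoc]
        _ = gridProd r [b] U' * (gridProd r [a] U' * r b c) * (r a c * r a b) := by
            rw [hyb a ha b hb c hs.1]; simp only [mul_assoc]
        _ = _ := by rw [← c2.eq]; simp only [mul_assoc]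
  have key2 : ∀ a ∈ S, ∀ T' : List I, T' ⊆ T → T'.Nodup →
      gridProd r [a] T' * (gridProd r [a] U * gridProd r T' U)
        = gridProd r T' U * (gridProd r [a] U * gridProd r [a] T') := by
    intro a ha T'
    induction T' with
    | nil => intro _ _; simp [gridProd]
    | cons b T' ih =>
      intro hs hn
      rw [List.cons_subset] at hs
      rw [List.nodup_cons] at hn
      have ih := ih hs.2 hn.2
      have c1 : Commute (r a b) (gridProd r T' U) := Commute.gridProd_right fun b' hb' c hc =>
        h1 a ha b hs.1 b' (hs.2 hb') c hc fun h => hn.1 (h ▸ hb')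
      have c2 : Commute (gridProd r [a] T') (gridProd r [b] U) :=
        Commute.gridProd_gridProd fun a' ha' b' hb' b'' hb'' c hc => by
          rw [List.mem_singleton.mp ha', List.mem_singleton.mp hb'']
          exact h1 a ha b' (hs.2 hb') b hs.1 c hc fun h => hn.1 (h ▸ hb')
      rw [gridProd_single_cons, gridProd_cons r b]
      calc gridProd r [a] T' * r a b * (gridProd r [a] U * (gridProd r [b] U * gridProd r T' U))
          = gridProd r [a] T' * (r a b * (gridProd r [a] U * gridProd r [b] U))
              * gridProd r T' U := by simp only [mul_assoc]
        _ = gridProd r [a] T' * gridProd r [b] U * (gridProd r [a] U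
              * (r a b * gridProd r T' U)) := by
            rw [key1 a ha b hs.1 U (List.Subset.refl _) hU]; simp only [mul_assoc]
        _ = gridProd r [b] U * (gridProd r [a] T' * (gridProd r [a] U * gridProd r T' U))
              * r a b := by rw [c1.eq, c2.eq]; simp only [mul_assoc]
        _ = _ := by rw [ih]; simp only [mul_assoc]
  have key3 : ∀ S' : List I, S' ⊆ S → S'.Nodup →
      gridProd r S' T * (gridProd r S' U * gridProd r T U)
        = gridProd r T U * (gridProd r S' U * gridProd r S' T) := by
    intro S'
    induction S' with
    | nil => intro _ _; simp [gridProd]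
    | cons a S' ih =>
      intro hs hn
      rw [List.cons_subset] at hs
      rw [List.nodup_cons] at hn
      have ih := ih hs.2 hn.2
      have c1 : Commute (gridProd r S' T) (gridProd r [a] U) :=
        Commute.gridProd_gridProd fun a' ha' b hb a'' ha'' c hc => by
          rw [List.mem_singleton.mp ha'']
          exact h2 a' (hs.2 ha') a hs.1 b hb c hc fun h => hn.1 (h ▸ ha')
      have c2 : Commute (gridProd r [a] T) (gridProd r S' U) :=
        Commute.gridProd_gridProd fun a'' ha'' b hb a' ha' c hc => by
          rw [List.mem_singleton.mp ha'']
          exact h2 a hs.1 a' (hs.2 ha') b hb c hc fun h => hn.1 (h ▸ ha')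
      rw [gridProd_cons r a S' T, gridProd_cons r a S' U]
      calc gridProd r [a] T * gridProd r S' T * (gridProd r [a] U * gridProd r S' U
            * gridProd r T U)
          = gridProd r [a] T * (gridProd r S' T * gridProd r [a] U) * (gridProd r S' U
              * gridProd r T U) := by simp only [mul_assoc]
        _ = gridProd r [a] T * gridProd r [a] U * (gridProd r S' T * (gridProd r S' U
              * gridProd r T U)) := by rw [c1.eq]; simp only [mul_assoc]
        _ = gridProd r [a] T * (gridProd r [a] U * gridProd r T U) * (gridProd r S' U
              * gridProd r S' T) := by rw [ih]; simp only [mul_assoc]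
        _ = gridProd r T U * gridProd r [a] U * (gridProd r [a] T * gridProd r S' U)
              * gridProd r S' T := by
            rw [key2 a hs.1 T (List.Subset.refl _) hT]; simp only [mul_assoc]
        _ = _ := by rw [c2.eq]; simp only [mul_assoc]
  exact key3 S (List.Subset.refl _) hS

/-- A product over a grid may be taken in either order of the two indices. -/
theorem grid_prod_comm {J J' : Type*} (r : J → J' → A) (S : List J) (T : List J') (hS : S.Nodup)
    (hT : T.Nodup) (h : ∀ a ∈ S, ∀ a' ∈ S, ∀ b ∈ T, ∀ b' ∈ T, a ≠ a' → b ≠ b' →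
      Commute (r a b) (r a' b')) :
    (S.map fun a => (T.map fun b => r a b).prod).prod
      = (T.map fun b => (S.map fun a => r a b).prod).prod := by
  induction S with
  | nil => simp
  | cons a S ih =>
    rw [List.nodup_cons] at hS
    have ih := ih hS.2 fun a ha a' ha' => h a (List.mem_cons_of_mem _ ha) a'
      (List.mem_cons_of_mem _ ha')
    rw [List.map_cons, List.prod_cons, ih]
    -- One line is interleaved into the lines already regrouped: its later factors pass the columns
    -- treated before, where both indices differ.
    have mulDistrib : ∀ T' : List J', T' ⊆ T → T'.Nodup →
        (T'.map fun b => r a b).prod * (T'.map fun b => (S.map fun a => r a b).prod).prod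
          = (T'.map fun b => r a b * (S.map fun a => r a b).prod).prod := by
      intro T'
      induction T' with
      | nil => simp
      | cons b T' ih' =>
        intro hs hn
        rw [List.cons_subset] at hs
        rw [List.nodup_cons] at hn
        have c : Commute (T'.map fun b => r a b).prod (S.map fun a => r a b).prod := by
          refine Commute.list_prod_right _ _ fun z hz => ?_
          obtain ⟨a', ha', rfl⟩ := List.mem_map.mp hz
          refine (Commute.list_prod_right _ _ fun z hz => ?_).symm
          obtain ⟨b', hb', rfl⟩ := List.mem_map.mp hz
          exact h a' (List.mem_cons_of_mem _ ha') a List.mem_cons_self b hs.1 b' (hs.2 hb')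
            (fun e => hS.1 (e ▸ ha')) fun e => hn.1 (e ▸ hb')
        simp only [List.map_cons, List.prod_cons]
        rw [← ih' hs.2 hn.2]
        simp only [mul_assoc]
        rw [← mul_assoc (T'.map fun b => r a b).prod, c.eq]
        simp only [mul_assoc]
    rw [mulDistrib T (List.Subset.refl _) hT]
    simp

end BlockYangBaxter

/-! ### Matrices and permutations acting in a tensor power -/

section Matrices

variable {P : Type*} [Fintype P] [DecidableEq P] {n : ℕ}

/-- The permutation of the tensor factors. -/
def permMat (A : Type*) [Ring A] (n : ℕ) (σ : Perm P) : Matrix (P → Fin n) (P → Fin n) A :=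
  Matrix.of fun f g => if f ∘ σ = g then 1 else 0

variable {A : Type*} [Ring A]

theorem permMat_mul_apply (σ : Perm P) (X : Matrix (P → Fin n) (P → Fin n) A) (f g : P → Fin n) :
    (permMat A n σ * X) f g = X (f ∘ σ) g := by
  simp [permMat, Matrix.mul_apply]

theorem mul_permMat_apply (σ : Perm P) (X : Matrix (P → Fin n) (P → Fin n) A) (f g : P → Fin n) :
    (X * permMat A n σ) f g = X f (g ∘ σ.symm) := by
  have : ∀ h : P → Fin n, h ∘ σ = g ↔ h = g ∘ σ.symm := fun h => by
    constructor
    · rintro rfl; funext k; simp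
    · rintro rfl; funext k; simp
  simp [permMat, Matrix.mul_apply, this]

theorem permMat_mul (σ τ : Perm P) : permMat A n σ * permMat A n τ = permMat A n (σ * τ) := by
  ext f g
  rw [permMat_mul_apply]
  rfl

theorem onePos_mul_apply (N : Matrix (Fin n) (Fin n) A) (i : P)
    (X : Matrix (P → Fin n) (P → Fin n) A) (f g : P → Fin n) :
    (onePos N i * X) f g = ∑ a, N (f i) a * X (Function.update f i a) g := by
  simp only [Matrix.mul_apply, onePos, Matrix.of_apply, ite_mul, zero_mul]
  rw [← Finset.sum_filter]
  refine Finset.sum_bij' (fun h _ => h i) (fun a _ => Function.update f i a) ?_ ?_ ?_ ?_ ?_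
  · simp
  · intro a _
    simp only [Finset.mem_filter, Finset.mem_univ, true_and]
    intro k hk
    rw [Function.update_of_ne hk]
  · intro h hh
    simp only [Finset.mem_filter, Finset.mem_univ, true_and] at hh
    funext k
    by_cases hk : k = i
    · subst hk; simp
    · rw [Function.update_of_ne hk, hh k hk]
  · simp
  · intro h hh
    simp only [Finset.mem_filter, Finset.mem_univ, true_and] at hh
    congr 2
    funext k
    by_cases hk : k = i
    · subst hk; simp
    · rw [Function.update_of_ne hk, hh k hk]

theorem onePos_list_prod (N : P → Matrix (Fin n) (Fin n) A) (l : List P) (hl : l.Nodup)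
    (f g : P → Fin n) :
    (l.map fun i => onePos (N i) i).prod f g
      = if ∀ k, k ∉ l → f k = g k then (l.map fun i => N i (f i) (g i)).prod else 0 := by
  induction l generalizing f with
  | nil => simp [Matrix.one_apply, funext_iff]
  | cons i l ih =>
    rw [List.nodup_cons] at hl
    rw [List.map_cons, List.prod_cons, onePos_mul_apply, Finset.sum_eq_single (g i)]
    · rw [ih hl.2]
      have e : (∀ k, k ∉ l → Function.update f i (g i) k = g k) ↔ ∀ k, k ∉ i :: l → f k = g k := by
        refine forall_congr' fun k => ?_
        by_cases hk : k = i
        · subst hk; simp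
        · simp [hk]
      simp only [e]
      split_ifs
      · rw [List.map_cons, List.prod_cons]
        congr 2
        refine List.map_congr_left fun k hk => ?_
        rw [Function.update_of_ne (ne_of_mem_of_not_mem hk hl.1)]
      · simp
    · intro a _ ha
      rw [ih hl.2, if_neg, mul_zero]
      intro h
      exact ha (by simpa using h i hl.1)
    · simp

theorem onePos_one (i : P) : onePos (1 : Matrix (Fin n) (Fin n) A) i = 1 := by
  ext f g
  simp only [onePos, Matrix.of_apply, Matrix.one_apply, ← ite_and]
  refine if_congr ⟨fun h => funext fun k => ?_, ?_⟩ rfl rfl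
  · by_cases hk : k = i
    · exact hk ▸ h.2
    · exact h.1 k hk
  · rintro rfl; simp

theorem onePos_mul_onePos (N N' : Matrix (Fin n) (Fin n) A) {i j : P} (hij : i ≠ j)
    (f g : P → Fin n) : (onePos N i * onePos N' j) f g
      = if ∀ k, k ≠ i → k ≠ j → f k = g k then N (f i) (g i) * N' (f j) (g j) else 0 := by
  rw [onePos_mul_apply, Finset.sum_eq_single (g i)]
  · simp only [onePos, Matrix.of_apply, mul_ite, mul_zero, Function.update_of_ne hij.symm]
    refine if_congr (forall_congr' fun k => ?_) rfl rfl
    by_cases hk : k = i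
    · subst hk; simp
    · simp [hk]
  · intro a _ ha
    simp only [onePos, Matrix.of_apply]
    rw [if_neg, mul_zero]
    intro h
    exact ha (by simpa using h i hij)
  · simp

theorem onePos_mul_permMat_swap (N : Matrix (Fin n) (Fin n) A) {i j : P} (hij : i ≠ j)
    (f g : P → Fin n) : (onePos N i * permMat A n (swap i j)) f g
      = if ∀ k, k ≠ i → k ≠ j → f k = g k then (if f j = g i then N (f i) (g j) else 0) else 0 := by
  rw [mul_permMat_apply]
  simp only [onePos, Matrix.of_apply, symm_swap, Function.comp_apply, swap_apply_left, ← ite_and]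
  refine if_congr ⟨fun h => ⟨fun k hi hj => ?_, ?_⟩, fun h k hi => ?_⟩ rfl rfl
  · simpa [swap_apply_of_ne_of_ne hi hj] using h k hi
  · simpa using h j hij.symm
  · by_cases hj : k = j
    · subst hj; simpa using h.2
    · simpa [swap_apply_of_ne_of_ne hi hj] using h.1 k hi hj

theorem permMat_mul_onePos (N : Matrix (Fin n) (Fin n) A) (σ : Perm P) (i : P) :
    permMat A n σ * onePos N i = onePos N (σ i) * permMat A n σ := by
  ext f g
  rw [permMat_mul_apply, mul_permMat_apply]
  simp only [onePos, Matrix.of_apply, Function.comp_apply, Equiv.symm_apply_apply]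
  refine if_congr ?_ rfl rfl
  rw [σ.forall_congr_left]
  simp [Equiv.symm_apply_eq]

end Matrices

/-! ### Yang-Baxter and RTT relations from permutation identities -/

section Exchange

variable {K : Type*} [Field K] {A : Type*} [Ring A] [Algebra K A]

theorem yangBaxter_of_perm {p q r : A} (h1 : p * q = q * r) (h2 : r * p = q * r)
    (h3 : q * p = p * r) (h4 : r * q = p * r) (h5 : p * (q * r) = r * (q * p)) {a b c : K}
    (h : a * c = a * b + b * c) :
    (1 + a • p) * ((1 + b • q) * (1 + c • r)) = (1 + c • r) * ((1 + b • q) * (1 + a • p)) := by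
  simp only [add_mul, mul_add, one_mul, mul_one, smul_mul_assoc, mul_smul_comm, h5]
  rw [h1, h2, h3, h4]
  linear_combination (norm := module) h • (p * r - q * r)

/-- The commutator hypothesis replaces the group relations of the Yang-Baxter case: `x` and `y` are
generator matrices in two factors that `p` interchanges. -/
theorem rtt_of_perm {p x y : A} (h1 : p * x = y * p) (h2 : p * y = x * p)
    (h3 : x * y - y * x = (y - x) * p) {a b c : K} (h : a * (c - b) = b * c) :
    (1 + a • p) * ((1 + b • x) * (1 + c • y)) = (1 + c • y) * ((1 + b • x) * (1 + a • p)) := by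
  have h5 : p * (x * y) = y * (x * p) := by rw [← mul_assoc, h1, mul_assoc, h2]
  have h6 : x * y = y * x + y * p - x * p := by
    rw [sub_eq_iff_eq_add'.mp h3]; noncomm_ring
  simp only [add_mul, mul_add, one_mul, mul_one, smul_mul_assoc, mul_smul_comm, h5]
  rw [h1, h2, h6]
  linear_combination (norm := module) h • (x * p - y * p)

end Exchange

/-! ### Moving R²¹ to the left of the T-blocks -/

section Rearrange

variable {K : Type*} [Field K] {A : Type*} [Ring A] [Algebra K A] {P : Type*} [Fintype P]
  [DecidableEq P] {n : ℕ}

/-- The commutation relations of the generators of `gl_n`. -/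
def IsGlFamily (e : Fin n → Fin n → A) : Prop :=
  ∀ a b c d, e a b * e c d - e c d * e a b
    = (if b = c then e a d else 0) - (if a = d then e c b else 0)

/-- The matrix with the entry `e b a` in the row `a` and the column `b`, acting in one factor. -/
def genPos (e : Fin n → Fin n → A) (i : P) : Matrix (P → Fin n) (P → Fin n) A :=
  onePos (Matrix.of fun a b => e b a) i

/-- The commutation relations of all generators, written as one matrix identity. -/
theorem genPos_lie {e : Fin n → Fin n → A} (he : IsGlFamily e) {i j : P} (hij : i ≠ j) :
    genPos e i * genPos e j - genPos e j * genPos e i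
      = (genPos e j - genPos e i) * permMat A n (swap i j) := by
  ext f g
  have hc : (∀ k, k ≠ j → k ≠ i → f k = g k) ↔ ∀ k, k ≠ i → k ≠ j → f k = g k :=
    forall_congr' fun k => ⟨fun h a b => h b a, fun h a b => h b a⟩
  have h2 : permMat A n (swap i j) = permMat A n (swap j i) := by rw [swap_comm]
  rw [sub_mul, Matrix.sub_apply, Matrix.sub_apply]
  unfold genPos
  rw [onePos_mul_onePos _ _ hij, onePos_mul_onePos _ _ hij.symm, onePos_mul_permMat_swap _ hij,
    h2, onePos_mul_permMat_swap _ hij.symm]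
  simp only [hc, Matrix.of_apply]
  by_cases h : ∀ k, k ≠ i → k ≠ j → f k = g k
  · simp only [if_pos h]
    rw [he, if_congr (eq_comm (a := f i)) rfl rfl, if_congr (eq_comm (a := f j)) rfl rfl]
  · simp only [if_neg h]

variable (t : P → K) (x : K) (e : Fin n → Fin n → A)

/-- The `R`-matrices acting in two factors, and the `L`-matrices acting in one factor. -/
def rtMat : Option P → Option P → Matrix (P → Fin n) (P → Fin n) A
  | some i, some j => 1 + (t i - t j)⁻¹ • permMat A n (swap i j)
  | some i, none => 1 + (t i - x)⁻¹ • genPos e i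
  -- The value `none` stands for the quantum space, which never occurs as a first index in the
  -- products used; this is a default.
  | none, _ => 1

theorem rtMat_commute {i j k l : Option P} (hij : i ≠ j) (hik : i ≠ k) (hil : i ≠ l)
    (hjk : j ≠ k) (hjl : j ≠ l) (hkl : k ≠ l) :
    Commute (rtMat t x e i j) (rtMat t x e k l) := by
  have comm : ∀ {p q : Matrix (P → Fin n) (P → Fin n) A} (a b : K), Commute p q →
      Commute (1 + a • p) (1 + b • q) := fun a b h =>
    ((Commute.one_left _).add_left (((Commute.one_right _).add_right
      (h.smul_right b)).smul_left a))
  have gen : ∀ i j k : P, i ≠ j → i ≠ k → Commute (genPos e i) (permMat A n (swap j k)) := by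
    intro i j k hij hik
    rw [commute_iff_eq, genPos, permMat_mul_onePos, swap_apply_of_ne_of_ne hij hik]
  rcases i with _ | i
  · exact Commute.one_left _
  rcases k with _ | k
  · exact Commute.one_right _
  rcases j with _ | j <;> rcases l with _ | l
  · exact absurd rfl hjl
  · exact comm _ _ (gen i k l (by simpa using hik) (by simpa using hil))
  · exact comm _ _ (gen k i j (by simpa using hik.symm) (by simpa using hjk.symm)).symm
  · refine comm _ _ ?_
    rw [commute_iff_eq, permMat_mul, permMat_mul]
    congr 1
    refine (Perm.disjoint_iff_disjoint_support.mpr ?_).commute.eq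
    rw [support_swap (by simpa using hij), support_swap (by simpa using hkl)]
    simp only [ne_eq, Option.some.injEq] at hik hil hjk hjl
    simp [Ne.symm hik, Ne.symm hil, Ne.symm hjk, Ne.symm hjl]

/-- Treating the quantum space as one more index makes the RTT relation an instance of the
Yang-Baxter equation, so that the block version applies to both. -/
theorem rtMat_yangBaxter (he : IsGlFamily e) (ht : ∀ i j, i ≠ j → t i - t j ≠ 0)
    (hx : ∀ i, t i - x ≠ 0) {i j : P} {k : Option P} (hij : i ≠ j) (hik : some i ≠ k)
    (hjk : some j ≠ k) :
    rtMat t x e (some i) (some j) * (rtMat t x e (some i) k * rtMat t x e (some j) k)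
      = rtMat t x e (some j) k * (rtMat t x e (some i) k * rtMat t x e (some i) (some j)) := by
  rcases k with _ | k
  · refine rtt_of_perm ?_ ?_ (genPos_lie he hij) ?_
    · rw [genPos, permMat_mul_onePos, swap_apply_left]; rfl
    · rw [genPos, permMat_mul_onePos, swap_apply_right]; rfl
    · have := ht i j hij; have := hx i; have := hx j
      field_simp
      ring
  · simp only [ne_eq, Option.some.injEq] at hik hjk
    have g1 : swap i j * swap i k = swap j k * swap i j := by
      rw [mul_swap_eq_swap_mul]; simp [swap_apply_of_ne_of_ne (Ne.symm hik) (Ne.symm hjk)]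
    have g2 : swap i j * swap j k = swap i k * swap i j := by
      rw [mul_swap_eq_swap_mul]; simp [swap_apply_of_ne_of_ne (Ne.symm hik) (Ne.symm hjk)]
    have g3 : swap i k * swap j k = swap i j * swap i k := by
      rw [mul_swap_eq_swap_mul]; simp [swap_apply_of_ne_of_ne (Ne.symm hij) hjk, swap_comm]
    have g4 : swap i k * swap i j = swap j k * swap i k := by
      rw [mul_swap_eq_swap_mul]
      simp [swap_apply_of_ne_of_ne (Ne.symm hij) hjk, swap_comm]
    refine yangBaxter_of_perm ?_ ?_ ?_ ?_ ?_ ?_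
    · rw [permMat_mul, permMat_mul, g3]
    · rw [permMat_mul, permMat_mul, g3, g1]
    · rw [permMat_mul, permMat_mul, g2]
    · rw [permMat_mul, permMat_mul, ← g4, g2]
    · simp only [permMat_mul, ← mul_assoc]
      rw [mul_assoc, g3, ← mul_assoc, swap_mul_self, ← g4, mul_assoc, swap_mul_self, one_mul,
        mul_one]
    · have := ht i j hij; have := ht i k hik; have := ht j k hjk
      field_simp
      ring

/-- The rearrangement of the product of all blocks. -/
theorem gridProd_rearrange (he : IsGlFamily e) (ht : ∀ i j, i ≠ j → t i - t j ≠ 0)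
    (hx : ∀ i, t i - x ≠ 0) (S T U : List P) (hS : S.Nodup) (hT : T.Nodup) (hU : U.Nodup)
    (hST : S.Disjoint T) (hSU : S.Disjoint U) (hTU : T.Disjoint U) :
    gridProd (rtMat t x e) (S.map some) [none] * gridProd (rtMat t x e) (T.map some) [none] *
        gridProd (rtMat t x e) (U.map some) [none] *
        (gridProd (rtMat t x e) (U.map some) (T.map some) *
          gridProd (rtMat t x e) (U.map some) (S.map some) *
          gridProd (rtMat t x e) (T.map some) (S.map some))
      = gridProd (rtMat t x e) (T.map some) (S.map some) *
        (gridProd (rtMat t x e) (T.map some) [none] * gridProd (rtMat t x e) (S.map some) [none] *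
          gridProd (rtMat t x e) (U.map some) [none]) *
        (gridProd (rtMat t x e) (U.map some) (S.map some) *
          gridProd (rtMat t x e) (U.map some) (T.map some)) := by
  have yb : ∀ (X Y : List P) (Z : List (Option P)), X.Nodup → Y.Nodup → Z.Nodup → X.Disjoint Y →
      (X.map some).Disjoint Z → (Y.map some).Disjoint Z →
      gridProd (rtMat t x e) (X.map some) (Y.map some) * (gridProd (rtMat t x e) (X.map some) Z *
        gridProd (rtMat t x e) (Y.map some) Z) = gridProd (rtMat t x e) (Y.map some) Z *
        (gridProd (rtMat t x e) (X.map some) Z *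
          gridProd (rtMat t x e) (X.map some) (Y.map some)) := by
    intro X Y Z hX hY hZ hXY hXZ hYZ
    have dXY : ∀ {a b}, a ∈ X.map some → b ∈ Y.map some → a ≠ b := by
      rintro a b ha hb rfl
      obtain ⟨a, ha', rfl⟩ := List.mem_map.mp ha
      exact hXY (by simpa using ha) (by simpa using hb)
    have dXZ : ∀ {a b}, a ∈ X.map some → b ∈ Z → a ≠ b := by
      rintro a b ha hb rfl
      exact hXZ ha hb
    have dYZ : ∀ {a b}, a ∈ Y.map some → b ∈ Z → a ≠ b := by
      rintro a b ha hb rfl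
      exact hYZ ha hb
    refine gridProd_yangBaxter _ _ _ _ (hX.map (Option.some_injective _))
      (hY.map (Option.some_injective _)) hZ ?_ ?_ ?_ ?_
    · intro a ha b hb c hc
      obtain ⟨i, hi, rfl⟩ := List.mem_map.mp ha
      obtain ⟨j, hj, rfl⟩ := List.mem_map.mp hb
      exact rtMat_yangBaxter t x e he ht hx (fun h => dXY ha hb (congrArg some h)) (dXZ ha hc)
        (dYZ hb hc)
    · exact fun a ha b hb b' hb' c hc h => rtMat_commute t x e (dXY ha hb) (dXY ha hb') (dXZ ha hc)
        h (dYZ hb hc) (dYZ hb' hc)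
    · exact fun a ha a' ha' b hb c hc h => rtMat_commute t x e (dXY ha hb) h (dXZ ha hc)
        (dXY ha' hb).symm (dYZ hb hc) (dXZ ha' hc)
    · exact fun a ha b hb c hc c' hc' h => rtMat_commute t x e (dXZ ha hc) (dXY ha hb) (dXZ ha hc')
        (dYZ hb hc).symm h (dYZ hb hc')
  have dn : ∀ X : List P, (X.map some).Disjoint [none] := fun X => by simp [List.Disjoint]
  have dm : ∀ {X Y : List P}, X.Disjoint Y → (X.map some).Disjoint (Y.map some) := fun h =>
    List.disjoint_map (Option.some_injective _) h
  -- R³²R³¹R²¹ = R²¹R³¹R³². Then R²¹ passes T³ by `e3`, having no index in common with it outside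
  -- the quantum space, and passes T¹T² by the RTT relation `e2`, reversing their order.
  have e1 := yb U T (S.map some) hU hT (hS.map (Option.some_injective _)) hTU.symm (dm hSU.symm)
    (dm hST.symm)
  have e2 := yb T S [none] hT hS (List.nodup_singleton _) hST.symm (dn _) (dn _)
  have e3 : Commute (gridProd (rtMat t x e) (U.map some) [none])
      (gridProd (rtMat t x e) (T.map some) (S.map some)) := by
    refine Commute.gridProd_gridProd fun a ha b hb a' ha' b' hb' => ?_
    obtain ⟨i, hi, rfl⟩ := List.mem_map.mp ha
    obtain ⟨j, hj, rfl⟩ := List.mem_map.mp ha'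
    obtain ⟨k, hk, rfl⟩ := List.mem_map.mp hb'
    rw [List.mem_singleton.mp hb]
    refine rtMat_commute t x e (by simp) ?_ ?_ (by simp) (by simp) ?_
    · rintro ⟨⟩; exact hTU hj hi
    · rintro ⟨⟩; exact hSU hk hi
    · rintro ⟨⟩; exact hST hk hj
  rw [mul_assoc (gridProd (rtMat t x e) (U.map some) (T.map some)), e1]
  simp only [← mul_assoc] at e2 ⊢
  rw [mul_assoc _ (gridProd (rtMat t x e) (U.map some) [none]), e3.eq, ← mul_assoc, ← e2]

end Rearrange

/-! ### R-matrices as exchange operators on functions of words -/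

section ExchangeOperators

variable {K : Type*} [Field K] {N : Type*} [AddCommGroup N] [Module K N]
  {P α : Type*} [DecidableEq P]

/-- The action of `1 + c • (i j)` on functions of words. -/
def exch (N α : Type*) [AddCommGroup N] [Module K N] (i j : P) (c : K) :
    Module.End K ((P → α) → N) :=
  1 + c • LinearMap.funLeft K N fun f => f ∘ swap i j

theorem exch_apply (i j : P) (c : K) (Ψ : (P → α) → N) (f : P → α) :
    exch N α i j c Ψ f = Ψ f + c • Ψ (f ∘ swap i j) := rfl

theorem exch_commute {i j k l : P} (hik : i ≠ k) (hil : i ≠ l) (hjk : j ≠ k) (hjl : j ≠ l)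
    (c c' : K) : Commute (exch N α i j c) (exch N α k l c') := by
  refine LinearMap.ext fun Ψ => funext fun f => ?_
  have h : (f ∘ swap i j) ∘ swap k l = (f ∘ swap k l) ∘ swap i j := by
    funext p
    simp only [Function.comp_apply]
    congr 1
    by_cases hi : p = i
    · subst hi; simp [swap_apply_of_ne_of_ne hik hil, swap_apply_of_ne_of_ne hjk hjl]
    by_cases hj : p = j
    · subst hj; simp [swap_apply_of_ne_of_ne hik hil, swap_apply_of_ne_of_ne hjk hjl]
    rw [swap_apply_of_ne_of_ne hi hj]
    by_cases hk : p = k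
    · subst hk; simp [swap_apply_of_ne_of_ne hil.symm hjl.symm]
    by_cases hl : p = l
    · subst hl; simp [swap_apply_of_ne_of_ne hik.symm hjk.symm]
    rw [swap_apply_of_ne_of_ne hk hl, swap_apply_of_ne_of_ne hi hj]
  simp only [Module.End.mul_apply, exch_apply, h]
  module

/-- The product over a line of sites, as the sum of the entries of a monodromy matrix. -/
theorem exch_line_apply {m : ℕ} (w : Fin m → K) (t : K) (p : P) (q : Fin m → P)
    (W : Bool → (Fin m → Bool) → P → α)
    (hW : ∀ a κ l, W a κ ∘ swap p (q l) = W (κ l) (Function.update κ l a))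
    (Ψ : (P → α) → N) (a : Bool) (κ : Fin m → Bool) :
    ((List.ofFn fun l => exch N α p (q l) (t - w l)⁻¹).reverse.prod) Ψ (W a κ)
      = ∑ b, siteOp w t a b (fun κ' => Ψ (W b κ')) κ := by
  induction m generalizing a with
  | zero => simp [siteOp]
  | succ m ih =>
    have ih' : ∀ (y : Bool) (a : Bool) (κ' : Fin m → Bool),
        (((List.ofFn fun l : Fin m => exch N α p (q l.castSucc) (t - w l.castSucc)⁻¹).reverse.prod)
          Ψ (W a (Fin.snoc κ' y)))
        = ∑ b, siteOp (Fin.init w) t a b (fun κ'' => Ψ (W b (Fin.snoc κ'' y))) κ' := fun y a κ' =>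
      ih (Fin.init w) (fun l => q l.castSucc) (fun a κ' => W a (Fin.snoc κ' y)) (by
        intro a κ l
        rw [hW, Fin.snoc_castSucc, Fin.snoc_update]) a κ'
    obtain ⟨κ', x, rfl⟩ : ∃ (κ' : Fin m → Bool) (x : Bool),
        κ = (Fin.snoc κ' x : Fin (m + 1) → Bool) := ⟨Fin.init κ, κ (Fin.last m), by simp⟩
    rw [List.ofFn_succ', List.concat_eq_append, List.reverse_concat, List.prod_cons, Module.End.mul_apply, exch_apply,
      ih', hW, Fin.snoc_last, Fin.update_snoc_last, ih', Finset.smul_sum,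
      ← Finset.sum_add_distrib]
    refine Finset.sum_congr rfl fun b _ => ?_
    simp only [siteOp, Fin.snoc_last, Fin.init_snoc]

/-- The product over a grid, as a sum of products of entries of monodromy matrices. -/
theorem exch_grid_apply {m n : ℕ} (w : Fin m → K) (t : Fin n → K) (p : Fin n → P) (q : Fin m → P)
    (W : (Fin n → Bool) → (Fin m → Bool) → P → α)
    (hW : ∀ a κ k l, W a κ ∘ swap (p k) (q l)
      = W (Function.update a k (κ l)) (Function.update κ l (a k)))
    (Ψ : (P → α) → N) (κ : Fin m → Bool) :
    ((List.ofFn fun k => (List.ofFn fun l => exch N α (p k) (q l) (t k - w l)⁻¹).reverse.prod).prod)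
        Ψ (W (fun _ => true) κ)
      = ∑ b, chainOp w t b (fun κ' => Ψ (W b κ')) κ := by
  induction n generalizing κ with
  | zero =>
    rw [Fintype.sum_unique, Subsingleton.elim (fun _ => true : Fin 0 → Bool) default,
      List.ofFn_zero]
    simp only [List.prod_nil, chainOp, Module.End.one_apply]
    exact congrArg (fun a => Ψ (W a κ)) (Subsingleton.elim _ _)
  | succ n ih =>
    have hcons : (fun _ => true : Fin (n + 1) → Bool) = Fin.cons true fun _ => true := by
      funext k; refine Fin.cases rfl (fun _ => rfl) k
    have ih' := fun b : Bool => ih (Fin.tail t) (Fin.tail p) (fun a κ => W (Fin.cons b a) κ) (by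
      intro a κ k l
      rw [show Fin.tail p k = p k.succ from rfl, hW, Fin.cons_succ, Fin.cons_update])
    rw [List.ofFn_succ, List.prod_cons, Module.End.mul_apply, hcons,
      exch_line_apply w (t 0) (p 0) q (fun b κ => W (Fin.cons b fun _ => true) κ) (by
        intro a κ l
        rw [hW, Fin.cons_zero, Fin.update_cons_zero])]
    rw [← (Fin.consEquiv fun _ : Fin (n + 1) => Bool).sum_comp, Fintype.sum_prod_type]
    refine Finset.sum_congr rfl fun b _ => ?_
    exact (congrArg (fun X => siteOp w (t 0) true b X κ) (funext fun κ' => ih' b κ')).trans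
      (siteOp_sum _ _ _ _ _ _ _)

/-- A product of exchanges with one site is trivial on words that are constant on the other sites,
if the function vanishes when the site carries the same letter. -/
theorem exch_line_trivial (p : P) (l : List P) (hl : l.Nodup) (hp : p ∉ l) (c : P → K) (y : α)
    (Ψ : (P → α) → N) (hΨ : ∀ h, h p = y → Ψ h = 0) (h : P → α) (hh : ∀ q ∈ l, h q = y) :
    (l.map fun q => exch N α p q (c q)).prod Ψ h = Ψ h := by
  induction l generalizing h with
  | nil => simp
  | cons q l ih =>
    rw [List.nodup_cons] at hl
    rw [List.mem_cons, not_or] at hp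
    have ih := ih hl.2 hp.2
    rw [List.map_cons, List.prod_cons, Module.End.mul_apply, exch_apply,
      ih h fun q' hq' => hh q' (List.mem_cons_of_mem _ hq'), ih _ fun q' hq' => ?_,
      hΨ (h ∘ swap p q) (by simpa using hh q List.mem_cons_self), smul_zero, add_zero]
    rw [Function.comp_apply, swap_apply_of_ne_of_ne (ne_of_mem_of_not_mem hq' hp.2)
      (ne_of_mem_of_not_mem hq' hl.1)]
    exact hh q' (List.mem_cons_of_mem _ hq')

/-- Exchanges not involving the position `r` cannot change its letter, so the vanishing condition
there survives them. -/
theorem exch_line_eq_zero (p r : P) (l : List P) (hpr : r ≠ p) (hr : r ∉ l) (c : P → K) (y : α)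
    (Ψ : (P → α) → N) (hΨ : ∀ h, h r = y → Ψ h = 0) (h : P → α) (hh : h r = y) :
    (l.map fun q => exch N α p q (c q)).prod Ψ h = 0 := by
  induction l generalizing h with
  | nil => exact hΨ h hh
  | cons q l ih =>
    rw [List.mem_cons, not_or] at hr
    rw [List.map_cons, List.prod_cons, Module.End.mul_apply, exch_apply, ih hr.2 h hh,
      ih hr.2 _ (by rw [Function.comp_apply, swap_apply_of_ne_of_ne hpr hr.1, hh]), smul_zero,
      add_zero]

/-- Every genuine exchange would bring the letter `y` into a position of `s`, where the function
vanishes. This is what removes R³¹. -/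
theorem exch_grid_trivial (s l : List P) (hs : s.Nodup) (hl : l.Nodup) (hsl : s.Disjoint l)
    (c : P → P → K) (y : α) (Ψ : (P → α) → N) (hΨ : ∀ p ∈ s, ∀ h, h p = y → Ψ h = 0) (h : P → α)
    (hh : ∀ q ∈ l, h q = y) :
    (s.map fun p => (l.map fun q => exch N α p q (c p q)).prod).prod Ψ h = Ψ h := by
  have vanish : ∀ (s : List P) (r : P), r ∉ s → r ∉ l → (∀ h, h r = y → Ψ h = 0) → ∀ h, h r = y →
      (s.map fun p => (l.map fun q => exch N α p q (c p q)).prod).prod Ψ h = 0 := by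
    intro s r hr hrl hΨ
    induction s with
    | nil => exact hΨ
    | cons p s ih =>
      rw [List.mem_cons, not_or] at hr
      intro h hh
      exact exch_line_eq_zero p r l hr.1 hrl (c p) y _ (ih hr.2) h hh
  induction s with
  | nil => rfl
  | cons p s ih =>
    rw [List.nodup_cons] at hs
    rw [List.disjoint_cons_left] at hsl
    have := exch_line_trivial p l hl hsl.1 (c p) y _
      (vanish s p hs.1 hsl.1 (hΨ p List.mem_cons_self)) h hh
    rw [List.map_cons, List.prod_cons]
    exact this.trans (ih hs.2 hsl.2 fun p hp => hΨ p (List.mem_cons_of_mem _ hp))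

end ExchangeOperators

/-! ### Multiplication by R-blocks as operators on row and column indices -/

section Actions

variable {K : Type*} [Field K] {M : Type*} [AddCommGroup M] [Module K M]
  {P : Type*} [Fintype P] [DecidableEq P] {n : ℕ}

/-- Multiplication by `R` on the left is the operator `O` in the row index. -/
def ActsLeft (R : Matrix (P → Fin n) (P → Fin n) (Module.End K M))
    (O : Module.End K ((P → Fin n) → M)) : Prop :=
  ∀ (X : Matrix (P → Fin n) (P → Fin n) (Module.End K M)) (f g : P → Fin n) (m : M),
    (R * X) f g m = O (fun f => X f g m) f

/-- Multiplication by `R` on the right is the operator `O` in the column index. -/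
def ActsRight (R : Matrix (P → Fin n) (P → Fin n) (Module.End K M))
    (O : Module.End K ((P → Fin n) → M)) : Prop :=
  ∀ (X : Matrix (P → Fin n) (P → Fin n) (Module.End K M)) (f g : P → Fin n) (m : M),
    (X * R) f g m = O (fun g => X f g m) g

theorem ActsLeft.mul {R R' : Matrix (P → Fin n) (P → Fin n) (Module.End K M)} {O O'}
    (h : ActsLeft R O) (h' : ActsLeft R' O') : ActsLeft (R * R') (O * O') := fun X f g m => by
  rw [mul_assoc, h, Module.End.mul_apply]
  exact congrArg (fun Z => O Z f) (funext fun f => h' X f g m)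

/-- The operators compose in the opposite order, as the factor on the far right meets the column
index first. -/
theorem ActsRight.mul {R R' : Matrix (P → Fin n) (P → Fin n) (Module.End K M)} {O O'}
    (h : ActsRight R O) (h' : ActsRight R' O') : ActsRight (R * R') (O' * O) := fun X f g m => by
  rw [← mul_assoc, h', Module.End.mul_apply]
  exact congrArg (fun Z => O' Z g) (funext fun g => h X f g m)

theorem ActsLeft.list_prod {J : Type*} (l : List J)
    {R : J → Matrix (P → Fin n) (P → Fin n) (Module.End K M)} {O}
    (h : ∀ a ∈ l, ActsLeft (R a) (O a)) : ActsLeft (l.map R).prod (l.map O).prod := by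
  induction l with
  | nil => intro X f g m; simp
  | cons a l ih =>
    simp only [List.map_cons, List.prod_cons]
    exact (h a List.mem_cons_self).mul (ih fun b hb => h b (List.mem_cons_of_mem _ hb))

theorem ActsRight.list_prod {J : Type*} (l : List J)
    {R : J → Matrix (P → Fin n) (P → Fin n) (Module.End K M)} {O}
    (h : ∀ a ∈ l, ActsRight (R a) (O a)) : ActsRight (l.map R).prod (l.map O).reverse.prod := by
  induction l with
  | nil => intro X f g m; simp
  | cons a l ih =>
    simp only [List.map_cons, List.prod_cons, List.reverse_cons, List.prod_append, List.prod_nil,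
      mul_one]
    exact (h a List.mem_cons_self).mul (ih fun b hb => h b (List.mem_cons_of_mem _ hb))

theorem actsLeft_exch (i j : P) (c : K) :
    ActsLeft (1 + c • permMat (Module.End K M) n (swap i j)) (exch M (Fin n) i j c) := by
  intro X f g m
  rw [exch_apply, add_mul, one_mul, smul_mul_assoc, Matrix.add_apply, Matrix.smul_apply,
    permMat_mul_apply]
  rfl

theorem actsRight_exch (i j : P) (c : K) :
    ActsRight (1 + c • permMat (Module.End K M) n (swap i j)) (exch M (Fin n) i j c) := by
  intro X f g m
  rw [exch_apply, mul_add, mul_one, mul_smul_comm, Matrix.add_apply, Matrix.smul_apply,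
    mul_permMat_apply, symm_swap]
  rfl

theorem actsLeft_gridProd (t : P → K) (x : K) (e : Fin n → Fin n → Module.End K M) (S T : List P) :
    ActsLeft (gridProd (rtMat t x e) (S.map some) (T.map some))
      ((S.map fun a => (T.map fun b => exch M (Fin n) a b (t a - t b)⁻¹).reverse.prod).prod) := by
  unfold gridProd
  rw [List.map_map]
  refine ActsLeft.list_prod S fun a _ => ?_
  simp only [Function.comp_apply, List.map_map, ← List.map_reverse]
  exact ActsLeft.list_prod T.reverse fun b _ => actsLeft_exch a b _

theorem actsRight_gridProd (t : P → K) (x : K) (e : Fin n → Fin n → Module.End K M) (S T : List P) :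
    ActsRight (gridProd (rtMat t x e) (S.map some) (T.map some))
      ((S.reverse.map fun a => (T.map fun b => exch M (Fin n) a b (t a - t b)⁻¹).prod).prod) := by
  unfold gridProd
  rw [List.map_map, List.map_reverse]
  refine ActsRight.list_prod S fun a _ => ?_
  simp only [Function.comp_apply, List.map_map, ← List.map_reverse]
  have h := ActsRight.list_prod (K := K) (M := M) (n := n) T.reverse fun b _ =>
    actsRight_exch a b (t a - t b)⁻¹
  rwa [← List.map_reverse, List.reverse_reverse] at h

end Actions

/-! ### Entries of the T-blocks acting on weight vectors -/

section Blocks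

variable {K : Type*} [Field K] {M : Type*} [AddCommGroup M] [Module K M]

/-- The last factor acts first, and each `F` shifts the weight seen by the earlier factors; this
shift is the `c + 1` in `boundaryWeight`. With `ε = 1` the lemma serves the first block; with `ε =
-1`, where the lowering operator decreases the weight, the third. Hence the negated variables there.
-/
theorem boundary_block (H F : Module.End K M) (y : ℕ → M) (lam ε x : K) (hε : ε * ε = 1)
    (hH : ∀ j, H (y j) = (lam + ε * j) • y j) (hF : ∀ j, F (y j) = y (j + 1)) {m : ℕ}
    (u : Fin m → K) (hu : ∀ k, u k - x ≠ 0) (κ : Fin m → Bool) (j : ℕ) :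
    (List.ofFn fun k => if κ k then 1 + (u k - x)⁻¹ • H else (u k - x)⁻¹ • F).prod (y j)
      = ((∏ k, (u k - x)⁻¹) * ((∏ k, if κ k then ε else 1) *
          boundaryWeight (ε * (lam - x) + j) (fun k => ε * u k) κ)) • y (j + countFalse κ) := by
  induction m generalizing j with
  | zero => simp [boundaryWeight, countFalse]
  | succ m ih =>
    have ih := ih (fun k => u k.castSucc) (fun k => hu _) (fun k => κ k.castSucc)
    rw [List.ofFn_succ', List.concat_eq_append, List.prod_append, List.prod_singleton,
      Module.End.mul_apply, Fin.prod_univ_castSucc, Fin.prod_univ_castSucc]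
    simp only [boundaryWeight, countFalse, Fin.sum_univ_castSucc]
    have hl := hu (Fin.last m)
    cases hκ : κ (Fin.last m)
    · simp only [Bool.false_eq_true, if_false, LinearMap.smul_apply, hF, map_smul]
      have := ih (j + 1)
      rw [this, smul_smul]
      have e : j + 1 + countFalse (fun k : Fin m => κ k.castSucc)
          = j + ((∑ k : Fin m, if κ k.castSucc then 0 else 1) + 1) := by
        unfold countFalse; ring
      rw [e]
      congr 1
      simp only [Fin.init_def, mul_one]
      push_cast
      rw [← add_assoc]
      ring
    · simp only [if_true, LinearMap.add_apply, LinearMap.smul_apply, Module.End.one_apply, hH,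
        map_add, map_smul]
      have := ih j
      rw [this, smul_smul, smul_smul, ← add_smul]
      have e : j + countFalse (fun k : Fin m => κ k.castSucc)
          = j + ((∑ k : Fin m, if κ k.castSucc then 0 else 1) + 0) := rfl
      rw [e]
      congr 1
      simp only [Fin.init_def]
      generalize (∏ k : Fin m, (u k.castSucc - x)⁻¹) = p₁
      generalize (∏ k : Fin m, if κ k.castSucc = true then ε else 1) = p₂
      generalize boundaryWeight (ε * (lam - x) + (j : K)) _ _ = p₃
      field_simp
      linear_combination p₁ * p₂ * p₃ * (x - u (Fin.last m) - lam) * hε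

theorem commuting_block (D : Bool → Bool → Module.End K M)
    (hD : ∀ a a' b b', Commute (D a a') (D b b')) {m : ℕ} (c : Fin m → K) (b b' : Fin m → Bool) :
    (List.ofFn fun k => c k • D (b k) (b' k)).prod
      = (∏ k, c k) • (D true true ^ fiberCard (fun k => (b k, b' k)) (true, true) *
          D false true ^ fiberCard (fun k => (b k, b' k)) (false, true) *
          D true false ^ fiberCard (fun k => (b k, b' k)) (true, false) *
          D false false ^ fiberCard (fun k => (b k, b' k)) (false, false)) := by
  induction m with
  | zero => simp [fiberCard]
  | succ m ih =>
    have hc : ∀ a a', fiberCard (fun k => (b k, b' k)) (a, a')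
        = (if (b 0, b' 0) = (a, a') then 1 else 0)
          + fiberCard (fun k : Fin m => (b k.succ, b' k.succ)) (a, a') := fun a a' => by
      simp only [fiberCard, Finset.card_filter]
      exact Fin.sum_univ_succ _
    rw [List.ofFn_succ, List.prod_cons, ih, Fin.prod_univ_succ, smul_mul_smul_comm]
    congr 1
    simp only [hc]
    have h := fun a a' b b' k => ((hD a a' b b').pow_right k).eq
    have h' : ∀ a a' b b' k (Z : Module.End K M),
        D a a' * (D b b' ^ k * Z) = D b b' ^ k * (D a a' * Z) := fun a a' b b' k Z => by
      rw [← mul_assoc, h, mul_assoc]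
    cases b 0 <;> cases b' 0 <;>
      simp only [Prod.mk.injEq, Bool.false_eq_true, Bool.true_eq_false, and_self, and_true,
        and_false, if_true, if_false, zero_add, pow_add, pow_one, mul_assoc, h, h']

/-- The entries of the evaluated `L`-matrix. -/
def tEnt {n : ℕ} (e : Fin n → Fin n → Module.End K M) (c : K) (a b : Fin n) : Module.End K M :=
  (if a = b then 1 else 0) + c • e b a

/-- The letter 1 in the row 2 gives a multiple of e₁₂. Brackets of e₀₂ and e₁₂ with the generators
e_{h2} occurring in this row are 0 or the operators themselves, so both kill every vector produced
by the block from `v`. -/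
theorem tEnt_block_eq_zero (e : Fin 4 → Fin 4 → Module.End K M) (he : IsGlFamily e) (v : M)
    (hv : ∀ a b, a < b → e a b v = 0) {P : Type*} (c : P → K) (h : P → Fin 4) (l : List P)
    (p : P) (hp : p ∈ l) (hh : h p = 1) : (l.map fun i => tEnt e (c i) 2 (h i)).prod v = 0 := by
  have hcomm : ∀ a b c d m, e a b (e c d m) = e c d (e a b m)
      + ((if b = c then e a d else 0) - (if a = d then e c b else 0)) m := by
    intro a b c d m
    rw [← he]; simp
  have inv : ∀ l : List P, e 0 2 ((l.map fun i => tEnt e (c i) 2 (h i)).prod v) = 0 ∧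
      e 1 2 ((l.map fun i => tEnt e (c i) 2 (h i)).prod v) = 0 := by
    intro l
    induction l with
    | nil => exact ⟨hv _ _ (by decide), hv _ _ (by decide)⟩
    | cons i l ih =>
      simp only [List.map_cons, List.prod_cons, Module.End.mul_apply]
      generalize (l.map fun i => tEnt e (c i) 2 (h i)).prod v = m at ih ⊢
      constructor
      · simp only [tEnt, LinearMap.add_apply, LinearMap.smul_apply, map_add, map_smul, hcomm 0 2,
          if_neg (by decide : ¬(0 : Fin 4) = 2)]
        split_ifs <;> simp [ih]
      · simp only [tEnt, LinearMap.add_apply, LinearMap.smul_apply, map_add, map_smul, hcomm 1 2]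
        split_ifs <;> simp_all
  induction l with
  | nil => simp at hp
  | cons i l ih =>
    simp only [List.map_cons, List.prod_cons, Module.End.mul_apply]
    rcases List.mem_cons.mp hp with rfl | hp
    · have := (inv l).2
      generalize (l.map fun i => tEnt e (c i) 2 (h i)).prod v = m at this ⊢
      simp [hh, tEnt, this]
    · rw [ih hp, map_zero]

end Blocks

/-! ### Words on three blocks of positions -/

section Words

variable {ξ : Fin 3 → ℕ} {α : Type*}

/-- The word with the given letters in the three blocks. -/
def word (f₁ : Fin (ξ 0) → α) (f₂ : Fin (ξ 1) → α) (f₃ : Fin (ξ 2) → α) (k : Pos ξ) : α :=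
  (Fin.cons f₁ (Fin.cons f₂ (Fin.cons f₃ finZeroElim)) : (a : Fin 3) → Fin (ξ a) → α)
    (ofLex k).1 (ofLex k).2

theorem word_zero (f₁ : Fin (ξ 0) → α) (f₂ : Fin (ξ 1) → α) (f₃ : Fin (ξ 2) → α) (i : Fin (ξ 0)) :
    word f₁ f₂ f₃ (pos 0 i) = f₁ i := rfl

theorem word_one (f₁ : Fin (ξ 0) → α) (f₂ : Fin (ξ 1) → α) (f₃ : Fin (ξ 2) → α) (i : Fin (ξ 1)) :
    word f₁ f₂ f₃ (pos 1 i) = f₂ i := rfl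

theorem word_two (f₁ : Fin (ξ 0) → α) (f₂ : Fin (ξ 1) → α) (f₃ : Fin (ξ 2) → α) (i : Fin (ξ 2)) :
    word f₁ f₂ f₃ (pos 2 i) = f₃ i := rfl

theorem forall_pos {p : Pos ξ → Prop} (h0 : ∀ i, p (pos 0 i)) (h1 : ∀ i, p (pos 1 i))
    (h2 : ∀ i, p (pos 2 i)) (k : Pos ξ) : p k := by
  have : ∀ (a : Fin 3) (i : Fin (ξ a)), p (pos a i) := by
    intro a
    fin_cases a
    · exact h0
    · exact h1
    · exact h2
  exact this (ofLex k).1 (ofLex k).2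

theorem pos_injective {m : ℕ} {ξ : Fin m → ℕ} (a : Fin m) : Function.Injective (pos (ξ := ξ) a) := by
  intro i j h
  simpa [pos] using h

theorem pos_ne {m : ℕ} {ξ : Fin m → ℕ} {a b : Fin m} (h : a ≠ b) (i : Fin (ξ a)) (j : Fin (ξ b)) :
    pos a i ≠ pos b j := by
  intro e
  exact h (congrArg (fun k : Pos ξ => (ofLex k).1) e)

theorem word_swap_one_zero (f₁ : Fin (ξ 0) → α) (f₂ : Fin (ξ 1) → α) (f₃ : Fin (ξ 2) → α)
    (k : Fin (ξ 1)) (l : Fin (ξ 0)) : word f₁ f₂ f₃ ∘ swap (pos 1 k) (pos 0 l)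
      = word (Function.update f₁ l (f₂ k)) (Function.update f₂ k (f₁ l)) f₃ := by
  refine funext fun p => forall_pos (p := fun p => (word f₁ f₂ f₃ ∘ swap (pos 1 k) (pos 0 l)) p
    = word (Function.update f₁ l (f₂ k)) (Function.update f₂ k (f₁ l)) f₃ p) (fun i => ?_)
    (fun i => ?_) (fun i => ?_) p
  · rw [word_zero, Function.comp_apply]
    by_cases h : i = l
    · subst h; rw [swap_apply_right, Function.update_self, word_one]
    · rw [swap_apply_of_ne_of_ne (pos_ne (by decide) _ _) ((pos_injective _).ne h),
        Function.update_of_ne h, word_zero]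
  · rw [word_one, Function.comp_apply]
    by_cases h : i = k
    · subst h; rw [swap_apply_left, Function.update_self, word_zero]
    · rw [swap_apply_of_ne_of_ne ((pos_injective _).ne h) (pos_ne (by decide) _ _),
        Function.update_of_ne h, word_one]
  · rw [word_two, Function.comp_apply, swap_apply_of_ne_of_ne (pos_ne (by decide) _ _)
      (pos_ne (by decide) _ _), word_two]

theorem word_swap_one_two (f₁ : Fin (ξ 0) → α) (f₂ : Fin (ξ 1) → α) (f₃ : Fin (ξ 2) → α)
    (k : Fin (ξ 1)) (l : Fin (ξ 2)) : word f₁ f₂ f₃ ∘ swap (pos 1 k) (pos 2 l)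
      = word f₁ (Function.update f₂ k (f₃ l)) (Function.update f₃ l (f₂ k)) := by
  refine funext fun p => forall_pos (p := fun p => (word f₁ f₂ f₃ ∘ swap (pos 1 k) (pos 2 l)) p
    = word f₁ (Function.update f₂ k (f₃ l)) (Function.update f₃ l (f₂ k)) p) (fun i => ?_)
    (fun i => ?_) (fun i => ?_) p
  · rw [word_zero, Function.comp_apply, swap_apply_of_ne_of_ne (pos_ne (by decide) _ _)
      (pos_ne (by decide) _ _), word_zero]
  · rw [word_one, Function.comp_apply]
    by_cases h : i = k
    · subst h; rw [swap_apply_left, Function.update_self, word_two]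
    · rw [swap_apply_of_ne_of_ne ((pos_injective _).ne h) (pos_ne (by decide) _ _),
        Function.update_of_ne h, word_one]
  · rw [word_two, Function.comp_apply]
    by_cases h : i = l
    · subst h; rw [swap_apply_right, Function.update_self, word_one]
    · rw [swap_apply_of_ne_of_ne (pos_ne (by decide) _ _) ((pos_injective _).ne h),
        Function.update_of_ne h, word_two]

/-- The positions in a block. -/
def block {m : ℕ} (ξ : Fin m → ℕ) (a : Fin m) : List (Pos ξ) := List.ofFn (pos a)

theorem block_nodup {m : ℕ} (ξ : Fin m → ℕ) (a : Fin m) : (block ξ a).Nodup :=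
  List.nodup_ofFn.mpr (pos_injective a)

theorem mem_block {m : ℕ} {ξ : Fin m → ℕ} {a : Fin m} {k : Pos ξ} :
    k ∈ block ξ a ↔ ∃ i, pos a i = k := by simp [block, List.mem_ofFn]

theorem block_disjoint {m : ℕ} {ξ : Fin m → ℕ} {a b : Fin m} (h : a ≠ b) :
    (block ξ a).Disjoint (block ξ b) := by
  intro k ha hb
  obtain ⟨i, rfl⟩ := mem_block.mp ha
  obtain ⟨j, hj⟩ := mem_block.mp hb
  exact pos_ne h.symm _ _ hj

end Words

/-! ### Matrix entries of the product T²T¹T³ on a singular vector -/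

section Entry

variable {K : Type*} [Field K] {M : Type*} [AddCommGroup M] [Module K M] {ξ : Fin 3 → ℕ}

theorem weight_pow {H F : Module.End K M} {ε lam : K} (h : H * F - F * H = ε • F) {z : M}
    (hz : H z = lam • z) (j : ℕ) : H ((F ^ j) z) = (lam + ε * j) • (F ^ j) z := by
  induction j with
  | zero => simpa using hz
  | succ j ih =>
    have := congrArg (fun A : Module.End K M => A ((F ^ j) z)) h
    simp only [LinearMap.sub_apply, Module.End.mul_apply, LinearMap.smul_apply, ih,
      sub_eq_iff_eq_add] at this
    rw [pow_succ', Module.End.mul_apply, this, map_smul]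
    push_cast
    module

variable (t : Pos ξ → K) (x : K) (e : Fin 4 → Fin 4 → Module.End K M)

theorem gridProd_none {P : Type*} [Fintype P] [DecidableEq P] (t : P → K) (l : List P) :
    gridProd (rtMat t x e) (l.map some) [none]
      = (l.map fun i => onePos (Matrix.of fun a b => tEnt e (t i - x)⁻¹ a b) i).prod := by
  unfold gridProd
  rw [List.map_map]
  congr 1
  refine List.map_congr_left fun i _ => ?_
  simp only [Function.comp_apply, List.map_cons, List.map_nil, List.reverse_singleton,
    List.prod_singleton, rtMat, genPos]
  rw [← onePos_one i]
  ext f g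
  simp only [onePos, Matrix.add_apply, Matrix.smul_apply, Matrix.of_apply, Matrix.one_apply, tEnt]
  split_ifs <;> simp

/-- The product of the `L`-matrices in the order of blocks `2`, `1`, `3`. -/
def tProd : Matrix (Pos ξ → Fin 4) (Pos ξ → Fin 4) (Module.End K M) :=
  gridProd (rtMat t x e) ((block ξ 1).map some) [none] *
    gridProd (rtMat t x e) ((block ξ 0).map some) [none] *
    gridProd (rtMat t x e) ((block ξ 2).map some) [none]

/-- Each tensor factor occurs once, so no sum over intermediate indices is left. -/
theorem tProd_apply (f g : Pos ξ → Fin 4) : tProd t x e f g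
    = (List.ofFn fun k => tEnt e (t (pos 1 k) - x)⁻¹ (f (pos 1 k)) (g (pos 1 k))).prod *
      (List.ofFn fun k => tEnt e (t (pos 0 k) - x)⁻¹ (f (pos 0 k)) (g (pos 0 k))).prod *
      (List.ofFn fun k => tEnt e (t (pos 2 k) - x)⁻¹ (f (pos 2 k)) (g (pos 2 k))).prod := by
  have hnd : (block ξ 1 ++ block ξ 0 ++ block ξ 2).Nodup := by
    rw [List.nodup_append', List.nodup_append', List.disjoint_append_left]
    exact ⟨⟨block_nodup _ _, block_nodup _ _, block_disjoint (by decide)⟩, block_nodup _ _,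
      block_disjoint (by decide), block_disjoint (by decide)⟩
  have hmem : ∀ k : Pos ξ, k ∈ block ξ 1 ++ block ξ 0 ++ block ξ 2 := by
    intro k
    simp only [List.mem_append, mem_block]
    exact forall_pos (p := fun k => ((∃ i, pos 1 i = k) ∨ ∃ i, pos 0 i = k) ∨ ∃ i, pos 2 i = k)
      (fun i => Or.inl (Or.inr ⟨i, rfl⟩)) (fun i => Or.inl (Or.inl ⟨i, rfl⟩))
      (fun i => Or.inr ⟨i, rfl⟩) k
  rw [tProd, gridProd_none, gridProd_none, gridProd_none, ← List.prod_append, ← List.prod_append,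
    ← List.map_append, ← List.map_append,
    onePos_list_prod (fun i => Matrix.of fun a b => tEnt e (t i - x)⁻¹ a b) _ hnd,
    if_pos fun k hk => absurd (hmem k) hk]
  simp only [List.map_append, List.prod_append, Matrix.of_apply, block, List.map_ofFn]
  rfl

/-- The letters of the first two blocks in the row index. -/
def rowLetter (a : Bool) : Fin 4 := if a then 1 else 0

/-- The letters of the last two blocks in the column index. -/
def colLetter (a : Bool) : Fin 4 := if a then 2 else 3

variable {t x e}

/-- T³ acts first and creates powers of e₃₂, which commute with e₁₁, so T¹ still sees the weight `Λ
1`. The entries of T² lower from the letters 2, 3 to 0, 1 without diagonal terms and commute with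
each other. -/
theorem tProd_apply_vector (he : IsGlFamily e) (hx : ∀ i, t i - x ≠ 0) (Λ : Fin 4 → K) (v : M)
    (hw : ∀ a, e a a v = Λ a • v) (κ : Fin (ξ 0) → Bool) (b b' : Fin (ξ 1) → Bool)
    (κ' : Fin (ξ 2) → Bool) :
    tProd t x e (word (fun i => rowLetter (κ i)) (fun i => rowLetter (b i)) fun _ => 2)
      (word (fun _ => 1) (fun i => colLetter (b' i)) fun i => colLetter (κ' i)) v
      = ((∏ k, (t (pos 1 k) - x)⁻¹) * ((∏ k, (t (pos 0 k) - x)⁻¹) *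
          boundaryWeight (Λ 1 - x) (fun k => t (pos 0 k)) κ) *
          ((∏ k, (t (pos 2 k) - x)⁻¹) * ((∏ k, if κ' k then -1 else 1) *
            boundaryWeight (x - Λ 2) (fun k => -t (pos 2 k)) κ'))) •
        (e 2 1 ^ fiberCard (fun k => (b k, b' k)) (true, true) *
          e 2 0 ^ fiberCard (fun k => (b k, b' k)) (false, true) *
          e 3 1 ^ fiberCard (fun k => (b k, b' k)) (true, false) *
          e 3 0 ^ fiberCard (fun k => (b k, b' k)) (false, false) *
          e 1 0 ^ countFalse κ * e 3 2 ^ countFalse κ') v := by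
  rw [tProd_apply]
  simp only [word_zero, word_one, word_two, Module.End.mul_apply]
  have h3 := boundary_block (e 2 2) (e 3 2) (fun j => (e 3 2 ^ j) v) (Λ 2) (-1) x (by ring)
    (weight_pow (by rw [he]; simp) (hw 2)) (fun j => by rw [pow_succ', Module.End.mul_apply])
    (fun k => t (pos 2 k)) (fun k => hx _) κ' 0
  have h1 := boundary_block (e 1 1) (e 1 0) (fun j => (e 1 0 ^ j) ((e 3 2 ^ countFalse κ') v))
    (Λ 1) 1 x (by ring) (weight_pow (by rw [he]; simp) (by
      have := weight_pow (H := e 1 1) (F := e 3 2) (ε := 0) (by rw [he]; simp) (hw 1) (countFalse κ')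
      simpa using this)) (fun j => by rw [pow_succ', Module.End.mul_apply])
    (fun k => t (pos 0 k)) (fun k => hx _) κ 0
  have h2 := commuting_block (fun a a' => e (colLetter a') (rowLetter a)) (fun a a' b b' => by
    rw [commute_iff_eq, ← sub_eq_zero, he]
    cases a <;> cases a' <;> cases b <;> cases b' <;> simp [rowLetter, colLetter])
    (fun k => (t (pos 1 k) - x)⁻¹) b b'
  have e3 : ∀ (c : K) (a : Bool), tEnt e c 2 (colLetter a)
      = if a then 1 + c • e 2 2 else c • e 3 2 := by
    intro c a; cases a <;> simp [tEnt, colLetter]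
  have e1 : ∀ (c : K) (a : Bool), tEnt e c (rowLetter a) 1
      = if a then 1 + c • e 1 1 else c • e 1 0 := by
    intro c a; cases a <;> simp [tEnt, rowLetter]
  have e2 : ∀ (c : K) (a a' : Bool), tEnt e c (rowLetter a) (colLetter a')
      = c • e (colLetter a') (rowLetter a) := by
    intro c a a'; cases a <;> cases a' <;> simp [tEnt, rowLetter, colLetter]
  simp only [pow_zero, Module.End.one_apply, Nat.cast_zero, add_zero, zero_add, one_mul,
    ite_self, Finset.prod_const_one, neg_one_mul, neg_sub] at h1 h3
  simp only [e1, e2, e3, h3, map_smul, h1, h2, LinearMap.smul_apply, smul_smul,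
    Module.End.mul_apply]
  simp only [rowLetter, colLetter, if_true, Bool.false_eq_true, if_false]
  congr 1
  ring

end Entry

/-! ### From the rearranged product to six-vertex partition functions -/

section Entry

variable {K : Type*} [Field K] {M : Type*} [AddCommGroup M] [Module K M] {ξ : Fin 3 → ℕ}
  {t : Pos ξ → K} {x : K} {e : Fin 4 → Fin 4 → Module.End K M}

theorem tProd_apply_eq_zero (he : IsGlFamily e) (v : M) (hv : ∀ a b, a < b → e a b v = 0)
    (f₁ : Fin (ξ 0) → Fin 4) (f₂ : Fin (ξ 1) → Fin 4) (g : Pos ξ → Fin 4) (p : Pos ξ)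
    (hp : p ∈ block ξ 2) (hg : g p = 1) : tProd t x e (word f₁ f₂ fun _ => 2) g v = 0 := by
  have h := tEnt_block_eq_zero e he v hv (fun i => (t i - x)⁻¹) g (block ξ 2) p hp hg
  rw [block, List.map_ofFn] at h
  rw [tProd_apply, Module.End.mul_apply]
  simp only [word_two]
  exact (congrArg _ h).trans (map_zero _)

/-- The action of the product of the blocks on the column index. -/
theorem column_apply (he : IsGlFamily e) (v : M) (hv : ∀ a b, a < b → e a b v = 0)
    (f₁ : Fin (ξ 0) → Fin 4) (f₂ : Fin (ξ 1) → Fin 4) :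
    (tProd t x e * (gridProd (rtMat t x e) ((block ξ 2).map some) ((block ξ 0).map some) *
        gridProd (rtMat t x e) ((block ξ 2).map some) ((block ξ 1).map some)))
        (word f₁ f₂ fun _ => 2) (word (fun _ => 1) (fun _ => 2) fun _ => 3) v
      = ∑ b : Fin (ξ 1) → Bool, chainOp (fun k => -t (pos 2 k)) (fun k => -t (pos 1 k)) b
          (fun κ => tProd t x e (word f₁ f₂ fun _ => 2)
            (word (fun _ => 1) (fun i => colLetter (b i)) fun i => colLetter (κ i)) v)
          fun _ => false := by
  have hR := (actsRight_gridProd t x e (block ξ 2) (block ξ 0)).mul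
    (actsRight_gridProd t x e (block ξ 2) (block ξ 1))
  -- R³² is regrouped so that the positions of the middle block become the rows of the lattice and
  -- those of the third block its sites.
  rw [hR, Module.End.mul_apply, grid_prod_comm _ _ _ (List.nodup_reverse.mpr (block_nodup ξ 2))
    (block_nodup ξ 1)]
  · have hgrid := exch_grid_apply (N := M) (fun k => -t (pos 2 k)) (fun k => -t (pos 1 k)) (pos 1)
      (pos 2) (fun b κ => word (fun _ => 1) (fun i => colLetter (b i)) fun i => colLetter (κ i))
      (by
        intro a κ k l
        rw [word_swap_one_two]
        congr 1
        · exact (Function.comp_update colLetter a k (κ l)).symm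
        · exact (Function.comp_update colLetter κ l (a k)).symm)
      (((block ξ 2).reverse.map fun a => ((block ξ 0).map fun b =>
        exch M (Fin 4) a b (t a - t b)⁻¹).prod).prod
        fun g => tProd t x e (word f₁ f₂ fun _ => 2) g v) fun _ => false
    -- The R-matrices depend on t³ - t², while a row with a t²-parameter expects its own parameter
    -- first; negating all variables reconciles the two.
    have hops : ((block ξ 1).map fun b => ((block ξ 2).reverse.map fun a =>
          exch M (Fin 4) a b (t a - t b)⁻¹).prod).prod
        = (List.ofFn fun k => (List.ofFn fun l => exch M (Fin 4) (pos (ξ := ξ) 1 k) (pos 2 l)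
            (-t (pos 1 k) - -t (pos 2 l))⁻¹).reverse.prod).prod := by
      simp only [block, List.map_reverse, List.map_ofFn, Function.comp_def, neg_sub_neg]
      simp only [exch, swap_comm]
    rw [hops]
    refine hgrid.trans (Finset.sum_congr rfl fun b _ => ?_)
    congr 1
    -- The column carries the letter 1 throughout the first block, and this letter is not allowed in
    -- the third block, so R³¹ acts trivially.
    refine funext fun κ => exch_grid_trivial (block ξ 2).reverse (block ξ 0)
      (List.nodup_reverse.mpr (block_nodup ξ 2)) (block_nodup ξ 0) (fun k hk =>
        block_disjoint (by decide) (List.mem_reverse.mp hk)) (fun a b => (t a - t b)⁻¹) 1 _ ?_ _ ?_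
    · exact fun p hp g hg => tProd_apply_eq_zero he v hv f₁ f₂ g p (List.mem_reverse.mp hp) hg
    · intro q hq
      obtain ⟨i, rfl⟩ := mem_block.mp hq
      rfl
  · intro a ha a' ha' b hb b' hb' haa hbb
    refine exch_commute haa ?_ ?_ hbb _ _
    · exact fun h => block_disjoint (by decide) (List.mem_reverse.mp ha) (h ▸ hb')
    · exact fun h => block_disjoint (by decide) (List.mem_reverse.mp ha') (h ▸ hb)

/-- The action of the product of the blocks on the row index. -/
theorem row_apply (X : Matrix (Pos ξ → Fin 4) (Pos ξ → Fin 4) (Module.End K M))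
    (g : Pos ξ → Fin 4) (v : M) :
    (gridProd (rtMat t x e) ((block ξ 1).map some) ((block ξ 0).map some) * X)
        (word (fun _ => 0) (fun _ => 1) fun _ => 2) g v
      = ∑ b : Fin (ξ 1) → Bool, chainOp (fun k => t (pos 0 k)) (fun k => t (pos 1 k)) b
          (fun κ => X (word (fun i => rowLetter (κ i)) (fun i => rowLetter (b i)) fun _ => 2) g v)
          fun _ => false := by
  rw [actsLeft_gridProd t x e (block ξ 1) (block ξ 0)]
  have hgrid := exch_grid_apply (N := M) (fun k => t (pos 0 k)) (fun k => t (pos 1 k)) (pos 1)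
      (pos 0) (fun b κ => word (fun i => rowLetter (κ i)) (fun i => rowLetter (b i)) fun _ => 2)
      (by
        intro a κ k l
        rw [word_swap_one_zero]
        congr 1
        · exact (Function.comp_update rowLetter κ l (a k)).symm
        · exact (Function.comp_update rowLetter a k (κ l)).symm)
      (fun f => X f g v) fun _ => false
  refine Eq.trans ?_ hgrid
  simp only [block, List.map_ofFn, Function.comp_def]
  rfl

theorem countTrue_eq {m : ℕ} (κ : Fin m → Bool) : countTrue κ = m - countFalse κ := by
  have : (m : ℤ) = ∑ _k : Fin m, 1 := by simp
  rw [eq_sub_iff_add_eq]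
  conv_rhs => rw [this]
  unfold countTrue countFalse
  push_cast
  rw [← Finset.sum_add_distrib]
  refine Finset.sum_congr rfl fun k _ => ?_
  cases κ k <;> simp

theorem countFalse_le {m : ℕ} (κ : Fin m → Bool) : countFalse κ ≤ m := by
  rw [countFalse_eq_card]; exact (Finset.card_le_univ _).trans (by simp)

theorem prod_ite_eq_pow {m : ℕ} (κ : Fin m → Bool) (y : K) :
    (∏ k, if κ k then y else 1) = y ^ (countTrue κ).toNat := by
  rw [Finset.prod_ite, Finset.prod_const_one, mul_one, Finset.prod_const]
  congr 1
  unfold countTrue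
  rw [Finset.sum_boole]
  simp

/-- The chain of entries of monodromy matrices, applied to the boundary weight and a function of
the number of excitations. -/
theorem chainOp_boundaryWeight {m n : ℕ} (c : K) (w : Fin m → K) (t : Fin n → K) (b : Fin n → Bool)
    (E : ℕ → ℕ → M) (Y : (Fin m → Bool) → M)
    (hY : ∀ κ, Y κ = boundaryWeight c w κ • E (countTrue κ).toNat (countFalse κ)) :
    chainOp w t b Y (fun _ => false)
      = partFun c w t b • E (countFalse b) (m - countFalse b) := by
  have h := chainOp_smul_count w t b (boundaryWeight c w) (fun z => E z.toNat (m - z.toNat))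
    fun _ => false
  have e1 : countTrue (fun _ : Fin m => false) + n - countTrue b = countFalse b := by
    rw [countTrue_eq b]; simp [countTrue]
  rw [e1, Int.toNat_natCast] at h
  refine Eq.trans ?_ h
  congr 1
  funext κ
  rw [hY]
  congr 2
  have := countTrue_eq κ
  have := countFalse_le κ
  omega

/-- The vector with the given exponents of the lowering operators. -/
def lowerVec (e : Fin 4 → Fin 4 → Module.End K M) (v : M) (k₁ k₂ k₃ p q r : ℕ) : M :=
  (e 2 1 ^ (k₂ + r - p - q) * e 2 0 ^ (q - r) * e 3 1 ^ (p - r) * e 3 0 ^ r * e 1 0 ^ (k₁ - q) *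
    e 3 2 ^ (k₃ - p)) v

/-- After the rearrangement, R²¹ gives a partition function through the rows and R³² another through
the columns. The states `b`, `b'` in which the middle positions are left by them are the summation
indices. -/
theorem blocks_apply (he : IsGlFamily e) (ht : ∀ i j, i ≠ j → t i - t j ≠ 0)
    (hx : ∀ i, t i - x ≠ 0) (Λ : Fin 4 → K) (v : M) (hv : ∀ a b, a < b → e a b v = 0)
    (hw : ∀ a, e a a v = Λ a • v) :
    (gridProd (rtMat t x e) ((block ξ 0).map some) [none] *
        gridProd (rtMat t x e) ((block ξ 1).map some) [none] *
        gridProd (rtMat t x e) ((block ξ 2).map some) [none] *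
        (gridProd (rtMat t x e) ((block ξ 2).map some) ((block ξ 1).map some) *
          gridProd (rtMat t x e) ((block ξ 2).map some) ((block ξ 0).map some) *
          gridProd (rtMat t x e) ((block ξ 1).map some) ((block ξ 0).map some)))
        (word (fun _ => 0) (fun _ => 1) fun _ => 2) (word (fun _ => 1) (fun _ => 2) fun _ => 3) v
      = (∏ a : Fin 3, ∏ k : Fin (ξ a), 1 / (t (pos a k) - x)) •
        ∑ b : Fin (ξ 1) → Bool, ∑ b' : Fin (ξ 1) → Bool,
          (partFun (Λ 1 - x) (fun k => t (pos 0 k)) (fun k => t (pos 1 k)) b *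
            partFunNeg (x - Λ 2) (fun k => t (pos 2 k)) (fun k => t (pos 1 k)) b') •
          lowerVec e v (ξ 0) (ξ 1) (ξ 2) (countFalse b') (countFalse b) (countBoth b b') := by
  rw [gridProd_rearrange t x e he ht hx _ _ _ (block_nodup ξ 0) (block_nodup ξ 1) (block_nodup ξ 2)
    (block_disjoint (by decide)) (block_disjoint (by decide)) (block_disjoint (by decide)),
    mul_assoc, ← tProd, row_apply, Finset.smul_sum]
  refine Finset.sum_congr rfl fun b _ => ?_
  simp only [column_apply he v hv]
  set Z : K := ∏ a : Fin 3, ∏ k : Fin (ξ a), 1 / (t (pos a k) - x) with hZ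
  have hZ' : Z = (∏ k, (t (pos 1 k) - x)⁻¹) * (∏ k, (t (pos 0 k) - x)⁻¹) *
      ∏ k, (t (pos 2 k) - x)⁻¹ := by
    rw [hZ, Fin.prod_univ_three]
    simp only [one_div]
    ring
  have hcol : ∀ κ : Fin (ξ 0) → Bool, ∀ b' : Fin (ξ 1) → Bool,
      chainOp (fun k => -t (pos 2 k)) (fun k => -t (pos 1 k)) b' (fun κ' => tProd t x e
        (word (fun i => rowLetter (κ i)) (fun i => rowLetter (b i)) fun _ => 2)
        (word (fun _ => 1) (fun i => colLetter (b' i)) fun i => colLetter (κ' i)) v) (fun _ => false)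
      = boundaryWeight (Λ 1 - x) (fun k => t (pos 0 k)) κ • ((Z *
          partFunNeg (x - Λ 2) (fun k => t (pos 2 k)) (fun k => t (pos 1 k)) b') •
        (e 2 1 ^ fiberCard (fun k => (b k, b' k)) (true, true) *
          e 2 0 ^ fiberCard (fun k => (b k, b' k)) (false, true) *
          e 3 1 ^ fiberCard (fun k => (b k, b' k)) (true, false) *
          e 3 0 ^ fiberCard (fun k => (b k, b' k)) (false, false) *
          e 1 0 ^ countFalse κ * e 3 2 ^ (ξ 2 - countFalse b')) v) := by
    intro κ b'
    -- The sign of an entry counts the `true` sites of the third block; by conservation their number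
    -- is `countFalse b'`, which gives the sign in `partFunNeg`.
    rw [chainOp_boundaryWeight (x - Λ 2) _ _ b' (fun i j =>
      ((-1) ^ i * (boundaryWeight (Λ 1 - x) (fun k => t (pos 0 k)) κ * Z)) •
        (e 2 1 ^ fiberCard (fun k => (b k, b' k)) (true, true) *
          e 2 0 ^ fiberCard (fun k => (b k, b' k)) (false, true) *
          e 3 1 ^ fiberCard (fun k => (b k, b' k)) (true, false) *
          e 3 0 ^ fiberCard (fun k => (b k, b' k)) (false, false) *
          e 1 0 ^ countFalse κ * e 3 2 ^ j) v)]
    · rw [smul_smul, smul_smul, partFunNeg]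
      congr 1
      ring
    · intro κ'
      rw [tProd_apply_vector he hx Λ v hw, prod_ite_eq_pow, smul_smul, hZ']
      congr 1
      ring
  simp only [hcol, ← Finset.smul_sum]
  rw [chainOp_boundaryWeight (Λ 1 - x) (fun k => t (pos 0 k)) (fun k => t (pos 1 k)) b (fun _ j =>
    ∑ b' : Fin (ξ 1) → Bool, (Z *
          partFunNeg (x - Λ 2) (fun k => t (pos 2 k)) (fun k => t (pos 1 k)) b') •
        (e 2 1 ^ fiberCard (fun k => (b k, b' k)) (true, true) *
          e 2 0 ^ fiberCard (fun k => (b k, b' k)) (false, true) *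
          e 3 1 ^ fiberCard (fun k => (b k, b' k)) (true, false) *
          e 3 0 ^ fiberCard (fun k => (b k, b' k)) (false, false) *
          e 1 0 ^ j * e 3 2 ^ (ξ 2 - countFalse b')) v) _ fun κ => rfl]
  rw [Finset.smul_sum, Finset.smul_sum]
  refine Finset.sum_congr rfl fun b' _ => ?_
  obtain ⟨h1, h2, h3, h4⟩ := fiberCard_pair fun k => (b k, b' k)
  change _ = countBoth b b' at h1
  change _ = countFalse b at h2
  change _ = countFalse b' at h3
  rw [smul_smul, smul_smul, lowerVec, h1,
    show fiberCard (fun k => (b k, b' k)) (true, true)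
      = ξ 1 + countBoth b b' - countFalse b' - countFalse b by omega,
    show fiberCard (fun k => (b k, b' k)) (false, true) = countFalse b - countBoth b b' by omega,
    show fiberCard (fun k => (b k, b' k)) (true, false) = countFalse b' - countBoth b b' by omega]
  congr 1
  ring

end Entry

/-! ### Series in the inverse variables -/

section Series

variable {m : ℕ} {ξ : Fin m → ℕ}

theorem coeff_substInv_nsmul {A : Type*} [Semiring A] (i : Pos ξ) (f : PowerSeries A) (k : ℕ) :
    (substInv i f).coeff (k • expo i) = PowerSeries.coeff k f :=
  HahnSeries.embDomain_coeff

theorem coeff_substInv_of_ne {A : Type*} [Semiring A] (i : Pos ξ) (f : PowerSeries A) (g : Expo ξ)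
    (h : ∀ k : ℕ, k • expo i ≠ g) : (substInv i f).coeff g = 0 :=
  HahnSeries.embDomain_of_notMem_range fun ⟨k, hk⟩ => h k hk

theorem scalar_coeff (A : Type*) [Ring A] [Algebra ℂ A] (s : Ser ξ ℂ) (g : Expo ξ) :
    (scalar A s).coeff g = algebraMap ℂ A (s.coeff g) := rfl

theorem scalar_substInv (A : Type*) [Ring A] [Algebra ℂ A] (i : Pos ξ) (f : PowerSeries ℂ) :
    scalar A (substInv i f) = substInv i (PowerSeries.map (algebraMap ℂ A) f) := by
  ext g
  rw [scalar_coeff]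
  by_cases h : ∃ k : ℕ, k • expo i = g
  · obtain ⟨k, rfl⟩ := h
    rw [coeff_substInv_nsmul, coeff_substInv_nsmul, PowerSeries.coeff_map]
  · push Not at h
    rw [coeff_substInv_of_ne i _ g h, coeff_substInv_of_ne i _ g h, map_zero]

theorem substInv_C {A : Type*} [Semiring A] (i : Pos ξ) (y : A) :
    substInv i (PowerSeries.C y) = HahnSeries.C y := by
  ext g
  by_cases h : ∃ k : ℕ, k • expo i = g
  · obtain ⟨k, rfl⟩ := h
    rw [coeff_substInv_nsmul, PowerSeries.coeff_C, HahnSeries.C_apply]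
    by_cases hk : k = 0
    · rw [if_pos hk, hk, zero_smul, HahnSeries.coeff_single_same]
    · rw [if_neg hk, HahnSeries.coeff_single_of_ne]
      exact fun h => hk ((nsmul_left_strictMono (expo_pos i)).injective
        (h.trans (zero_smul ℕ _).symm))
  · push Not at h
    rw [coeff_substInv_of_ne i _ g h, HahnSeries.C_apply, HahnSeries.coeff_single_of_ne]
    rintro rfl
    exact h 0 (zero_smul _ _)

/-- Complex coefficients are central and exponents add commutatively. This makes the Yangian series
act linearly over scalar series. -/
theorem scalar_commute (A : Type*) [Ring A] [Algebra ℂ A] (c : Ser ξ ℂ) (s : Ser ξ A) :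
    Commute (scalar A c) s := by
  rw [commute_iff_eq]
  ext g
  rw [HahnSeries.coeff_mul, HahnSeries.coeff_mul]
  refine Finset.sum_nbij' Prod.swap Prod.swap ?_ ?_ (by simp) (by simp) ?_
  · intro p hp
    rw [Finset.mem_antidiagonal] at hp ⊢
    exact ⟨hp.2.1, hp.1, by rw [← hp.2.2, add_comm]; rfl⟩
  · intro p hp
    rw [Finset.mem_antidiagonal] at hp ⊢
    exact ⟨hp.2.1, hp.1, by rw [← hp.2.2, add_comm]; rfl⟩
  · intro p _
    rw [scalar_coeff]
    exact Algebra.commutes _ _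

theorem expo_injective : Function.Injective (expo (ξ := ξ)) := by
  intro i j h
  by_contra hij
  have h' : (Pi.single i 1 : Pos ξ → ℤ) = Pi.single j 1 := h
  have := congrFun h' i
  rw [Pi.single_eq_same, Pi.single_eq_of_ne hij] at this
  exact one_ne_zero this

theorem tVar_sub_ne_zero (a b : Fin m) (i : Fin (ξ a)) (j : Fin (ξ b)) (h : pos a i ≠ pos b j) :
    tVar ξ a i - tVar ξ b j ≠ 0 := by
  intro e
  have := congrArg (fun s : Ser ξ ℂ => s.coeff (-expo (pos a i))) e
  simp only [tVar, HahnSeries.coeff_sub, HahnSeries.coeff_single_same, HahnSeries.coeff_zero] at this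
  rw [HahnSeries.coeff_single_of_ne fun e' => h (expo_injective (neg_injective e'))] at this
  simp at this

theorem tVar_sub_C_ne_zero (a : Fin m) (i : Fin (ξ a)) (y : ℂ) :
    tVar ξ a i - HahnSeries.C y ≠ 0 := by
  intro e
  have := congrArg (fun s : Ser ξ ℂ => s.coeff (-expo (pos a i))) e
  simp only [tVar, HahnSeries.coeff_sub, HahnSeries.coeff_single_same, HahnSeries.coeff_zero,
    HahnSeries.C_apply] at this
  rw [HahnSeries.coeff_single_of_ne (neg_ne_zero.mpr (expo_pos _).ne')] at this
  simp at this

theorem generic_tVar (a : Fin m) : Generic (tVar ξ a) := by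
  intro i j hij
  have hne : pos a i ≠ pos a j := (pos_injective a).ne hij
  refine ⟨tVar_sub_ne_zero a a i j hne, fun e => ?_⟩
  have := congrArg (fun s : Ser ξ ℂ => s.coeff (-expo (pos a i))) e
  simp only [tVar, HahnSeries.coeff_add, HahnSeries.coeff_sub, HahnSeries.coeff_single_same,
    HahnSeries.coeff_zero, HahnSeries.coeff_one] at this
  rw [HahnSeries.coeff_single_of_ne fun e' => hne (expo_injective (neg_injective e')),
    if_neg (neg_ne_zero.mpr (expo_pos _).ne')] at this
  simp at this

/-- The coefficients of `(t - y)⁻¹`, expanded in the inverse of `t`. -/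
def geomSeries (y : ℂ) : PowerSeries ℂ := PowerSeries.X * PowerSeries.mk fun k => y ^ k

theorem substInv_X_mul_tVar (a : Fin m) (i : Fin (ξ a)) :
    substInv (pos a i) (PowerSeries.X : PowerSeries ℂ) * tVar ξ a i = 1 := by
  have h : substInv (pos a i) (PowerSeries.X : PowerSeries ℂ) = HahnSeries.single (expo (pos a i)) 1 := by
    ext g
    by_cases h : ∃ k : ℕ, k • expo (pos a i) = g
    · obtain ⟨k, rfl⟩ := h
      rw [coeff_substInv_nsmul, PowerSeries.coeff_X]
      by_cases hk : k = 1
      · rw [if_pos hk, hk, one_smul, HahnSeries.coeff_single_same]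
      · rw [if_neg hk, HahnSeries.coeff_single_of_ne]
        exact fun h => hk ((nsmul_left_strictMono (expo_pos (pos a i))).injective
          (h.trans (one_smul ℕ _).symm))
    · push Not at h
      rw [coeff_substInv_of_ne _ _ g h, HahnSeries.coeff_single_of_ne]
      rintro rfl
      exact h 1 (one_smul _ _)
  rw [h, tVar, HahnSeries.single_mul_single, add_neg_cancel, one_mul]
  rfl

/-- The inverse taken in the field of Hahn series is the geometric expansion, as required by the
definition of the evaluation module. -/
theorem tVar_sub_C_inv (a : Fin m) (i : Fin (ξ a)) (y : ℂ) :
    (tVar ξ a i - HahnSeries.C y)⁻¹ = substInv (pos a i) (geomSeries y) := by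
  refine inv_eq_of_mul_eq_one_right ?_
  have hX := substInv_X_mul_tVar a i
  have hX0 : substInv (pos a i) (PowerSeries.X : PowerSeries ℂ) ≠ 0 := left_ne_zero_of_mul_eq_one hX
  refine mul_left_cancel₀ hX0 ?_
  have hg : (1 - PowerSeries.X * PowerSeries.C y) * geomSeries y = PowerSeries.X := by
    have : (1 - PowerSeries.X * PowerSeries.C y) * (PowerSeries.mk fun k => y ^ k) = 1 := by
      ext k
      rw [sub_mul, one_mul, map_sub, mul_assoc, PowerSeries.coeff_mk, PowerSeries.coeff_one]
      cases k with
      | zero => simp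
      | succ k =>
        rw [PowerSeries.coeff_succ_X_mul, PowerSeries.coeff_C_mul, PowerSeries.coeff_mk]
        simp [pow_succ']
    rw [geomSeries, mul_left_comm, this, mul_one]
  have h := congrArg (substInv (pos a i)) hg
  rw [map_mul, map_sub, map_one, map_mul, substInv_C] at h
  rw [mul_one, ← mul_assoc, mul_sub, hX, h]

end Series

/-! ### Yangian series acting on series with values in V(x) -/

section EvaluationModule

variable {n : ℕ} {V : Type*} [AddCommGroup V] [Module ℂ V] [LieRingModule (Gl n) V]
  [LieModule ℂ (Gl n) V] {x : ℂ}

theorem yT_one_smul (a b : Fin n) (w : V) :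
    yT a b 1 • EvalModule.of n x w = EvalModule.of n x (eOp n V b a w) := by
  change evalAction n V x (yT a b 1) w = _
  simp only [evalAction, AlgHom.comp_apply, shiftHom, yangianLift_yT, shiftT, evalHom]
  simp [yangianLift_yT, evalT, eU, eOp, EvalModule.of]

/-- Evaluation keeps only the first coefficient of the unshifted series, so of the binomial sum in
the shift only the term with x^k remains. -/
theorem yT_succ_smul (a b : Fin n) (k : ℕ) (w : EvalModule n V x) :
    yT a b (k + 1) • w = (algebraMap ℂ (Yangian n) (x ^ k) * yT a b 1) • w := by
  have h : ∀ k, evalAction n V x (yT a b (k + 1)) = x ^ k • eOp n V b a := by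
    intro k
    simp only [evalAction, AlgHom.comp_apply, shiftHom, yangianLift_yT, shiftT, evalHom]
    rw [map_sum, Finset.sum_range_succ']
    simp [yangianLift_yT, evalT, eU, eOp]
  change evalAction n V x (yT a b (k + 1)) w
    = evalAction n V x (algebraMap ℂ (Yangian n) (x ^ k) * yT a b 1) w
  rw [map_mul, AlgHom.commutes, h, h 0, pow_zero, one_smul]
  rfl

theorem algebraMap_smul_of (y : ℂ) (w : V) :
    algebraMap ℂ (Yangian n) y • EvalModule.of n x w = EvalModule.of n x (y • w) := by
  change evalAction n V x (algebraMap ℂ (Yangian n) y) w = _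
  rw [AlgHom.commutes]
  rfl

variable {m : ℕ} (ξ : Fin m → ℕ)

theorem C_smul_const (y : Yangian n) (w w' : V)
    (h : y • EvalModule.of n x w = EvalModule.of n x w') :
    (HahnSeries.C y : Ser ξ (Yangian n)) • const n ξ x w = const n ξ x w' := by
  rw [HahnSeries.C_apply, HahnModule.single_zero_smul_eq_smul]
  unfold const
  rw [← h, ← HahnModule.of_smul]
  congr 1
  ext g
  by_cases hg : g = 0
  · subst hg
    rw [HahnSeries.coeff_smul, HahnSeries.coeff_single_same, HahnSeries.coeff_single_same]
  · rw [HahnSeries.coeff_smul, HahnSeries.coeff_single_of_ne hg, HahnSeries.coeff_single_of_ne hg,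
      smul_zero]

variable (n V x)

/-- The scalar series act on the series with coefficients in `V(x)`. -/
abbrev scalarModule : Module (Ser ξ ℂ) (VSer n ξ V x) :=
  Module.compHom (VSer n ξ V x) (scalar (Yangian n))

attribute [local instance] scalarModule

/-- The action of the series with coefficients in the Yangian, linear over scalar series. -/
def serAction : Ser ξ (Yangian n) →+* Module.End (Ser ξ ℂ) (VSer n ξ V x) where
  toFun s :=
    { toFun := fun w => s • w
      map_add' := smul_add s
      map_smul' := fun c w => by
        change s • scalar (Yangian n) c • w = scalar (Yangian n) c • s • w
        rw [smul_smul, smul_smul, (scalar_commute (Yangian n) c s).eq] }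
  map_one' := LinearMap.ext fun w => one_smul _ w
  map_mul' s s' := LinearMap.ext fun w => mul_smul s s' w
  map_zero' := LinearMap.ext fun w => zero_smul _ w
  map_add' s s' := LinearMap.ext fun w => add_smul s s' w

variable {n V x ξ}

theorem serAction_apply (s : Ser ξ (Yangian n)) (w : VSer n ξ V x) :
    serAction n V x ξ s w = s • w := rfl

theorem serAction_scalar (c : Ser ξ ℂ) :
    serAction n V x ξ (scalar (Yangian n) c) = algebraMap _ _ c := LinearMap.ext fun _ => rfl

theorem serAction_eq_zero (s : Ser ξ (Yangian n))
    (h : ∀ g, ∀ w : EvalModule n V x, s.coeff g • w = 0) : serAction n V x ξ s = 0 := by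
  refine LinearMap.ext fun w => ?_
  rw [serAction_apply, LinearMap.zero_apply]
  ext g
  rw [HahnModule.coeff_smul]
  exact Finset.sum_eq_zero fun p _ => h _ _

variable (n V x ξ)

/-- The generators of `gl_n`, acting on series. -/
def genOp (a b : Fin n) : Module.End (Ser ξ ℂ) (VSer n ξ V x) :=
  serAction n V x ξ (HahnSeries.C (yT b a 1))

variable {n V x ξ}

/-- The Yangian relation at orders 0 and 1, where the coefficients of order 0 are central. -/
theorem isGlFamily_genOp : IsGlFamily (genOp n V x ξ) := by
  intro a b c d
  have h := yT_rel b a d c 0 1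
  rw [yT_zero, yT_zero b c, yT_zero] at h
  have h' : yT b a 1 * yT d c 1 - yT d c 1 * yT b a 1
      = (if b = c then yT d a 1 else 0) - (if a = d then yT b c 1 else 0) := by
    have h0 : ∀ (P : Prop) [Decidable P] (y : Yangian n),
        ⁅(if P then 1 else 0 : Yangian n), y⁆ = 0 := by
      intro P _ y; split_ifs <;> simp [Ring.lie_def]
    rw [h0, sub_zero, zero_add, Ring.lie_def] at h
    rw [h, if_congr (eq_comm (a := d)) rfl rfl]
    split_ifs <;> simp
  have := congrArg (fun y => serAction n V x ξ (HahnSeries.C y)) h'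
  simp only [map_sub, map_mul] at this
  rw [genOp, genOp, this]
  split_ifs <;> simp [genOp]

theorem genOp_const (a b : Fin n) (w : V) :
    genOp n V x ξ a b (const n ξ x w) = const n ξ x (eOp n V a b w) :=
  C_smul_const ξ _ _ _ (yT_one_smul b a w)

theorem genOp_pow_const (a b : Fin n) (k : ℕ) (w : V) :
    (genOp n V x ξ a b ^ k) (const n ξ x w) = const n ξ x ((eOp n V a b ^ k) w) := by
  induction k with
  | zero => rfl
  | succ k ih => rw [pow_succ', pow_succ', Module.End.mul_apply, ih, genOp_const]; rfl

/-- The two series differ in the Yangian but not in V(x): each coefficient of their difference acts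
there as zero. -/
theorem serAction_tMatrix (a : Fin m) (i : Fin (ξ a)) (b c : Fin n) :
    serAction n V x ξ (tMatrix n a i b c)
      = tEnt (genOp n V x ξ) (tVar ξ a i - HahnSeries.C x)⁻¹ b c := by
  have h : tEnt (genOp n V x ξ) (tVar ξ a i - HahnSeries.C x)⁻¹ b c
      = serAction n V x ξ (substInv (pos a i) (PowerSeries.C (yT b c 0) +
          PowerSeries.map (algebraMap ℂ (Yangian n)) (geomSeries x) *
            PowerSeries.C (yT b c 1))) := by
    rw [map_add, map_mul, substInv_C, substInv_C, ← scalar_substInv, ← tVar_sub_C_inv, map_add,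
      map_mul, serAction_scalar, yT_zero, tEnt, genOp]
    congr 1
    split_ifs <;> simp
  rw [h, ← sub_eq_zero, ← map_sub, tMatrix, Matrix.of_apply, ← map_sub]
  refine serAction_eq_zero _ fun g w => ?_
  by_cases hg : ∃ k : ℕ, k • expo (pos a i) = g
  · obtain ⟨k, rfl⟩ := hg
    rw [coeff_substInv_nsmul, map_sub, map_add, PowerSeries.coeff_mk, PowerSeries.coeff_mul_C,
      PowerSeries.coeff_map, PowerSeries.coeff_C, geomSeries]
    cases k with
    | zero => simp
    | succ k =>
      rw [PowerSeries.coeff_succ_X_mul, PowerSeries.coeff_mk, sub_smul, add_smul, yT_succ_smul]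
      simp
  · push Not at hg
    rw [coeff_substInv_of_ne _ _ g hg, zero_smul]

end EvaluationModule

attribute [local instance] scalarModule

/-! ### The nested Bethe vector in the evaluation module -/

section Bethe

variable {V : Type*} [AddCommGroup V] [Module ℂ V] [LieRingModule (Gl 4) V]
  [LieModule ℂ (Gl 4) V] {x : ℂ}

/-- The variable at a position. -/
def posVar {m : ℕ} (ξ : Fin m → ℕ) (k : Pos ξ) : Ser ξ ℂ := tVar ξ (ofLex k).1 (ofLex k).2

/-- The sum of E_{ab} ⊗ E_{ba} is the flip of two tensor factors. -/
theorem twoPos_rMatrix {K : Type*} [Field K] {A : Type*} [Ring A] (s : K →+* A) {n : ℕ}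
    {P : Type*} [Fintype P] [DecidableEq P] (u : K) {i j : P} (hij : i ≠ j) :
    twoPos ((rMatrix n u).map s) i j = 1 + s u⁻¹ • permMat A n (swap i j) := by
  ext f g
  have hP : (∑ a : Fin n, ∑ b : Fin n, Matrix.single a b (1 : K) ⊗ₖ Matrix.single b a (1 : K))
      (f i, f j) (g i, g j) = if f i = g j ∧ f j = g i then 1 else 0 := by
    simp only [Matrix.sum_apply, Matrix.kroneckerMap_apply, Matrix.single_apply, ← ite_and,
      mul_ite, mul_one, mul_zero]
    rw [Finset.sum_eq_single (f i), Finset.sum_eq_single (g i)]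
    · refine if_congr ?_ rfl rfl
      constructor
      · rintro ⟨⟨h1, h2⟩, -, -⟩; exact ⟨h2, h1.symm⟩
      · rintro ⟨h1, h2⟩; exact ⟨⟨h2.symm, h1⟩, rfl, rfl⟩
    · intro b _ hb
      rw [if_neg]; rintro ⟨-, -, h⟩; exact hb h
    · simp
    · intro a _ ha
      refine Finset.sum_eq_zero fun b _ => ?_
      rw [if_neg]; rintro ⟨-, h, -⟩; exact ha h
    · simp
  have hswap : f ∘ swap i j = g ↔ (∀ k, k ≠ i → k ≠ j → f k = g k) ∧ f i = g j ∧ f j = g i := by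
    constructor
    · rintro rfl
      refine ⟨fun k hi hj => ?_, ?_, ?_⟩
      · rw [Function.comp_apply, swap_apply_of_ne_of_ne hi hj]
      · rw [Function.comp_apply, swap_apply_right]
      · rw [Function.comp_apply, swap_apply_left]
    · rintro ⟨h, h1, h2⟩
      funext k
      rw [Function.comp_apply]
      by_cases hi : k = i
      · subst hi; rw [swap_apply_left, h2]
      by_cases hj : k = j
      · subst hj; rw [swap_apply_right, h1]
      rw [swap_apply_of_ne_of_ne hi hj, h k hi hj]
  have hone : f = g ↔ (∀ k, k ≠ i → k ≠ j → f k = g k) ∧ f i = g i ∧ f j = g j := by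
    constructor
    · rintro rfl; simp
    · rintro ⟨h, h1, h2⟩
      funext k
      by_cases hi : k = i
      · subst hi; exact h1
      by_cases hj : k = j
      · subst hj; exact h2
      exact h k hi hj
  simp only [twoPos, Matrix.of_apply, Matrix.map_apply, rMatrix, Matrix.add_apply, Matrix.smul_apply,
    hP, permMat, Matrix.one_apply, hswap, hone, Prod.mk.injEq, smul_eq_mul]
  by_cases h : ∀ k, k ≠ i → k ≠ j → f k = g k
  · rw [if_pos h]
    simp only [and_iff_right h]
    split_ifs <;> simp
  · rw [if_neg h, if_neg fun h' => h h'.1, if_neg fun h' => h h'.1]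
    simp

theorem onePos_map {A B : Type*} [Ring A] [Ring B] (s : A →+* B) {n : ℕ} {P : Type*} [Fintype P]
    [DecidableEq P] (N : Matrix (Fin n) (Fin n) A) (i : P) :
    (onePos N i).map s = onePos (N.map s) i := by
  ext f g
  simp only [onePos, Matrix.map_apply, Matrix.of_apply]
  split_ifs <;> simp

variable (V x) in
theorem map_tBlock (ξ : Fin 3 → ℕ) (a : Fin 3) :
    (serAction 4 V x ξ).mapMatrix (tBlock 4 ξ a)
      = gridProd (rtMat (posVar ξ) (HahnSeries.C x) (genOp 4 V x ξ)) ((block ξ a).map some)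
        [none] := by
  rw [gridProd_none, tBlock, map_list_prod, List.map_ofFn, block, List.map_ofFn]
  congr 2
  funext i
  simp only [Function.comp_apply, RingHom.mapMatrix_apply, onePos_map]
  congr 1
  ext b c
  rw [Matrix.map_apply, serAction_tMatrix]
  rfl

variable (V x) in
theorem map_rBlock (ξ : Fin 3 → ℕ) {a b : Fin 3} (hab : a ≠ b) :
    (serAction 4 V x ξ).mapMatrix (rBlock 4 ξ a b)
      = gridProd (rtMat (posVar ξ) (HahnSeries.C x) (genOp 4 V x ξ)) ((block ξ a).map some)
        ((block ξ b).map some) := by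
  rw [gridProd, rBlock, map_list_prod, List.map_ofFn]
  simp only [block, List.map_ofFn]
  congr 2
  funext i
  simp only [Function.comp_apply, map_list_prod, List.map_reverse, List.map_ofFn]
  congr 3
  funext l
  simp only [Function.comp_apply, RingHom.mapMatrix_apply, rtMat]
  rw [twoPos_rMatrix _ _ (pos_ne hab i l)]
  refine Matrix.ext fun f g => ?_
  rw [Matrix.map_apply, Matrix.add_apply, Matrix.add_apply, Matrix.smul_apply, Matrix.smul_apply,
    map_add, smul_eq_mul, map_mul, serAction_scalar]
  refine congrArg₂ (· + ·) ?_ ?_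
  · simp only [Matrix.one_apply]; split_ifs <;> simp
  · simp only [permMat, Matrix.of_apply]
    split_ifs
    · rw [map_one, Algebra.smul_def]
      rfl
    · simp

theorem tHat_eq (ξ : Fin 3 → ℕ) : tHat 4 ξ = tBlock 4 ξ 0 * tBlock 4 ξ 1 * tBlock 4 ξ 2 *
    (rBlock 4 ξ 2 1 * rBlock 4 ξ 2 0 * rBlock 4 ξ 1 0) := by
  have h : List.finRange 3 = [0, 1, 2] := rfl
  simp [tHat, h, List.ofFn_succ, mul_assoc]

theorem lowerVec_const (ξ : Fin 3 → ℕ) (v : V) (p q r : ℕ) :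
    lowerVec (genOp 4 V x ξ) (const 4 ξ x v) (ξ 0) (ξ 1) (ξ 2) p q r
      = const 4 ξ x (monoVec (ξ 0) (ξ 1) (ξ 2) p q r v) := by
  simp only [lowerVec, monoVec, Module.End.mul_apply, genOp_pow_const]

theorem bethe_smul_const (Λ : Fin 4 → ℂ) (v : V) (hv : IsSingularVector Λ v) (ξ : Fin 3 → ℕ) :
    bethe ξ • const 4 ξ x v
      = scalar (Yangian 4) (∏ a : Fin 3, ∏ k : Fin (ξ a), 1 / (tVar ξ a k - HahnSeries.C x)) •
        ∑ b : Fin (ξ 1) → Bool, ∑ b' : Fin (ξ 1) → Bool,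
          (partFun (HahnSeries.C (Λ 1) - HahnSeries.C x) (tVar ξ 0) (tVar ξ 1) b *
            partFunNeg (HahnSeries.C x - HahnSeries.C (Λ 2)) (tVar ξ 2) (tVar ξ 1) b') •
          const 4 ξ x (monoVec (ξ 0) (ξ 1) (ξ 2) (countFalse b') (countFalse b) (countBoth b b')
            v) := by
  have h := blocks_apply (t := posVar ξ) (x := HahnSeries.C x) (e := genOp 4 V x ξ)
    isGlFamily_genOp (forall_pos (fun i => forall_pos (fun j h => tVar_sub_ne_zero _ _ _ _ h)
        (fun j h => tVar_sub_ne_zero _ _ _ _ h) (fun j h => tVar_sub_ne_zero _ _ _ _ h))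
      (fun i => forall_pos (fun j h => tVar_sub_ne_zero _ _ _ _ h)
        (fun j h => tVar_sub_ne_zero _ _ _ _ h) (fun j h => tVar_sub_ne_zero _ _ _ _ h))
      (fun i => forall_pos (fun j h => tVar_sub_ne_zero _ _ _ _ h)
        (fun j h => tVar_sub_ne_zero _ _ _ _ h) (fun j h => tVar_sub_ne_zero _ _ _ _ h)))
    (fun i => tVar_sub_C_ne_zero _ _ _) (fun a => HahnSeries.C (Λ a)) (const 4 ξ x v)
    (fun a b hab => by
      rw [genOp_const, hv.1 a b hab]
      exact congrArg (HahnModule.of (Yangian 4)) (map_zero (HahnSeries.single (0 : Expo ξ))))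
    (fun a => by
      rw [genOp_const, hv.2]
      refine (C_smul_const ξ (algebraMap ℂ (Yangian 4) (Λ a)) v _ (algebraMap_smul_of _ _)).symm.trans ?_
      change _ = (scalar (Yangian 4) (HahnSeries.C (Λ a)) : Ser ξ (Yangian 4)) • const 4 ξ x v
      congr 1
      exact (HahnSeries.map_C ..).symm)
  rw [← map_tBlock, ← map_tBlock, ← map_tBlock, ← map_rBlock _ _ _ (by decide),
    ← map_rBlock _ _ _ (by decide), ← map_rBlock _ _ _ (by decide), ← map_mul, ← map_mul,
    ← map_mul, ← map_mul, ← map_mul, ← tHat_eq] at h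
  simp only [lowerVec_const] at h
  refine Eq.trans ?_ h
  change _ = tHat 4 ξ _ _ • const 4 ξ x v
  rw [bethe]
  congr 2
  · exact funext (forall_pos (fun _ => rfl) (fun _ => rfl) fun _ => rfl)
  · exact funext (forall_pos (fun _ => rfl) (fun _ => rfl) fun _ => rfl)

instance {m : ℕ} (ξ : Fin m → ℕ) : CharZero (Ser ξ ℂ) :=
  charZero_of_injective_algebraMap (R := ℂ) HahnSeries.C_injective

end Bethe

end NestedBethe

end

/-! ### The theorem -/

open NestedBethe in
theorem theorem5p7 {V : Type*} [AddCommGroup V] [Module ℂ V] [LieRingModule (Gl 4) V]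
    [LieModule ℂ (Gl 4) V] (x : ℂ) (Λ : Fin 4 → ℂ) (v : V) (hv : IsSingularVector Λ v)
    (ξ : Fin 3 → ℕ) :
    (∀ (i : (p : Fin (min (ξ 1) (ξ 2) + 1)) → Fin (min (ξ 1) (ξ 0) + 1) → ℕ →
            (Fin p ↪o Fin (ξ 1)))
        (j : Fin (min (ξ 1) (ξ 2) + 1) → (q : Fin (min (ξ 1) (ξ 0) + 1)) → ℕ →
            (Fin q ↪o Fin (ξ 1))),
        (∀ (p : Fin (min (ξ 1) (ξ 2) + 1)) (q : Fin (min (ξ 1) (ξ 0) + 1)),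
          ∀ r ∈ Finset.Icc ((p : ℕ) + q - ξ 1) (min p q), interCard (i p q r) (j p q r) = r) →
        bethe ξ • const 4 ξ x v =
          scalar (Yangian 4) (∏ a : Fin 3, ∏ k : Fin (ξ a), 1 / (tVar ξ a k - HahnSeries.C x)) •
            ∑ p : Fin (min (ξ 1) (ξ 2) + 1), ∑ q : Fin (min (ξ 1) (ξ 0) + 1),
              ∑ r ∈ Finset.Icc ((p : ℕ) + q - ξ 1) (min p q),
                scalar (Yangian 4)
                    (symG ξ (le_right_of_fin p) (le_right_of_fin q) x (Λ 1) (Λ 2)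
                        (i p q r) (j p q r) /
                      ((factProd (ξ 0) (ξ 1) (ξ 2) p q r : ℕ) : Ser ξ ℂ)) •
                  const 4 ξ x (monoVec (ξ 0) (ξ 1) (ξ 2) p q r v)) ∧
    (∀ (p q r : ℕ) (hp : p ≤ ξ 2) (hq : q ≤ ξ 0)
        (i i' : Fin p ↪o Fin (ξ 1)) (j j' : Fin q ↪o Fin (ξ 1)),
        interCard i j = r → interCard i' j' = r →
        symG ξ hp hq x (Λ 1) (Λ 2) i j = symG ξ hp hq x (Λ 1) (Λ 2) i' j') := by
  have h21 : ∀ k l, tVar ξ 1 k - tVar ξ 0 l ≠ 0 := fun k l =>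
    tVar_sub_ne_zero _ _ _ _ (pos_ne (by decide) _ _)
  have h32 : ∀ k l, tVar ξ 2 k - tVar ξ 1 l ≠ 0 := fun k l =>
    tVar_sub_ne_zero _ _ _ _ (pos_ne (by decide) _ _)
  refine ⟨fun i j hij => ?_, fun p q r hp hq i i' j j' h h' => ?_⟩
  -- With this module structure, multiplication by a scalar series is by definition multiplication
  -- by its image under `scalar`, so the formulas over the field apply literally.
  · let := scalarModule 4 V x ξ
    rw [bethe_smul_const Λ v hv ξ]
    congr 1
    exact sum_partFun_smul (HahnSeries.C x) (HahnSeries.C (Λ 1)) (HahnSeries.C (Λ 2)) (tVar ξ 0)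
      (tVar ξ 1) (tVar ξ 2) (generic_tVar 0) (generic_tVar 1) (generic_tVar 2) h21 h32 i j hij
      fun p q r => const 4 ξ x (monoVec (ξ 0) (ξ 1) (ξ 2) p q r v)
  -- Both sides equal the expression in `sum_partFun_eq`, in which the sequences enter only through
  -- p, q and r.
  · unfold symG
    rw [sum_partFun_eq hp hq _ _ _ i j _ _ _ (generic_tVar 0) (generic_tVar 1) (generic_tVar 2)
      h21 h32, sum_partFun_eq hp hq _ _ _ i' j' _ _ _ (generic_tVar 0) (generic_tVar 1)
      (generic_tVar 2) h21 h32, h, h']
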